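/- Let $n\ge 1$, $1<p<\infty$ and $1<q<\infty$, and let $p'=p/(p-1)$. All cubes are cubes in $\mathbb{R}^n$ with sides parallel to the coordinate axes. A weight is a non-negative locally integrable function $w$ on $\mathbb{R}^n$, not almost everywhere zero, and $w\in A_p$ means $$[w]_{A_p}:=\sup_Q\Big(\frac1{|Q|}\int_Q w\,dy\Big)\Big(\frac1{|Q|}\int_Q w^{1-p'}\,dy\Big)^{p-1}<\infty,$$ the supremum being over all cubes $Q$. For a measurable function $g$ on $\mathbb{R}^n$ let $Mg(x)=\sup_{Q\ni x}\frac1{|Q|}\int_Q|g(y)|\,dy$ be the Hardy--Littlewood maximal function, and for a sequence $f=\{f_j\}_{j=1}^\infty$ of measurable (real- or complex-valued) functions on $\mathbb{R}^n$ put $$\overline{M}_qf(x)=\Big(\sum_{j=1}^\infty (Mf_j(x))^q\Big)^{1/q},\qquad \overline{f}_q(x)=\Big(\sum_{j=1}^\infty|f_j(x)|^q\Big)^{1/q}.$$ Write $\|g\|_{L^p(w)}=\big(\int_{\mathbb{R}^n}|g|^p\,w\,dx\big)^{1/p}$. Then there is a constant $c=c(n,p,q)<\infty$ such that for every $w\in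 A_p$ and every such $f$ $$\|\overline{M}_qf\|_{L^p(w)}\le c\,[w]_{A_p}^{\max\{\frac1q,\frac1{p-1}\}}\,\|\overline{f}_q\|_{L^p(w)},$$ and the exponent is sharp: for every real $\beta<\max\{\frac1q,\frac1{p-1}\}$ and every constant $c\ge 0$ there are $w\in A_p$ and such a sequence $f$ with $$\|\overline{M}_qf\|_{L^p(w)}>c\,[w]_{A_p}^{\beta}\,\|\overline{f}_q\|_{L^p(w)}.$$ -/

import Mathlib

open MeasureTheory
open scoped ENNReal NNReal

noncomputable section

namespace VectorMaximal

/-- The closed cube in `ℝⁿ` with sides parallel to the axes, lower corner `a` and side length `ℓ`. -/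
def cube {n : ℕ} (a : Fin n → ℝ) (ℓ : ℝ) : Set (Fin n → ℝ) :=
  Set.Icc a (fun i => a i + ℓ)

/-- The `A_p` constant
`[w]_{A_p} = sup_Q (⨍_Q w) (⨍_Q w^{1-p'})^{p-1}`, `p' = p / (p - 1)`, with values in `[0, ∞]`;
where `w` vanishes, the negative power `w^{1-p'}` is `∞`. -/
def apConst {n : ℕ} (p : ℝ) (w : (Fin n → ℝ) → ℝ) : ℝ≥0∞ :=
  ⨆ (a : Fin n → ℝ) (ℓ : ℝ) (_ : 0 < ℓ),
    (⨍⁻ y in cube a ℓ, ENNReal.ofReal (w y) ∂volume) *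
      (⨍⁻ y in cube a ℓ, ENNReal.ofReal (w y) ^ (1 - Real.conjExponent p) ∂volume) ^ (p - 1)

/-- `w ∈ A_p`: `w` is a locally integrable weight with finite `A_p` constant. A nonnegative `w`
with `[w]_{A_p} < ∞` is positive almost everywhere unless it vanishes almost everywhere; requiring
positivity excludes exactly the zero weight (for which `0 * ∞ = 0` would give `[w]_{A_p} = 0`). -/
structure IsAp {n : ℕ} (p : ℝ) (w : (Fin n → ℝ) → ℝ) : Prop where
  locallyIntegrable : LocallyIntegrable w volume
  pos : ∀ᵐ x ∂(volume : Measure (Fin n → ℝ)), 0 < w x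
  apConst_lt_top : apConst p w < ∞

/-- The (uncentered) Hardy-Littlewood maximal function `Mf(x) = sup_{Q ∋ x} ⨍_Q |f|`, the supremum
being over the cubes `Q` with sides parallel to the axes that contain `x`. -/
def maximal {n : ℕ} {𝕜 : Type*} [RCLike 𝕜] (f : (Fin n → ℝ) → 𝕜) (x : Fin n → ℝ) : ℝ≥0∞ :=
  ⨆ (a : Fin n → ℝ) (ℓ : ℝ) (_ : 0 < ℓ) (_ : x ∈ cube a ℓ), ⨍⁻ y in cube a ℓ, ‖f y‖ₑ ∂volume

/-- The vector-valued maximal operator `M̄_q f(x) = (∑_j (M f_j(x))^q)^{1/q}`. -/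
def vectorMaximal {n : ℕ} {𝕜 : Type*} [RCLike 𝕜] (q : ℝ) (f : ℕ → (Fin n → ℝ) → 𝕜)
    (x : Fin n → ℝ) : ℝ≥0∞ :=
  (∑' j, maximal (f j) x ^ q) ^ (1 / q)

/-- The pointwise `ℓ^q` norm `f̄_q(x) = (∑_j |f_j(x)|^q)^{1/q}`. -/
def lqNorm {n : ℕ} {𝕜 : Type*} [RCLike 𝕜] (q : ℝ) (f : ℕ → (Fin n → ℝ) → 𝕜)
    (x : Fin n → ℝ) : ℝ≥0∞ :=
  (∑' j, ‖f j x‖ₑ ^ q) ^ (1 / q)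

/-- The norm `‖g‖_{L^p(w)} = (∫ g^p w dx)^{1/p}` of a function `g ≥ 0`. -/
def weightedNorm {n : ℕ} (p : ℝ) (w : (Fin n → ℝ) → ℝ) (g : (Fin n → ℝ) → ℝ≥0∞) : ℝ≥0∞ :=
  eLpNorm g (ENNReal.ofReal p) (volume.withDensity fun x => ENNReal.ofReal (w x))

end VectorMaximal

end

/-! ### Nested partitions: averages, stopping sets and the scalar weak type inequality. -/

open MeasureTheory
open scoped ENNReal NNReal

/-! Upper bound. By the one-third trick every cube lies in a cell of comparable measure of one of
`2^n` shifted dyadic grids (`setLAverage_cube_le`), so it suffices to treat maximal functions of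
nested partitions, with constants independent of the grid and of its coarsest mesh. Write `F` for
the pointwise `ℓ^q` norm of the sequence. Stopping the averages of all `f_l` simultaneously, at the
first level where the average of `F` exceeds `t`, gives the vector-valued weak type inequality
`mul_meas_tsum_maxFn_le`. Localized to a cell `Q`, it says that for a suitable `K` the vector-valued
maximal function over the levels from `Q` on exceeds `K ⟨F⟩_Q` on at most half of `Q`. Iterating
this selection gives sparse domination (`exists_isSparse`): `∑_l (M f_l)^q ≤ K^q ∑_Q ⟨F⟩_Q^q 1_Q`,
where each selected `Q` has a part `E_Q` of at least half its measure and the `E_Q` are disjoint.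
The power `q` inside the sum is the source of the exponent `1/q`.

With `σ = w^{1-p'}` and `F = φσ`, the average `⟨F⟩_Q` is the `σ`-average of `φ` times `σ(Q)/|Q|`.
The local estimate `rpow_mul_le_of_major_subset` trades `(σ(Q)/|Q|)^s w(Q)` for `[w]^{max(1,
s/(p-1))} ∫_{E_Q} σ^{s/p} w^{1-s/p}`. Summing over the disjoint `E_Q` leaves one integral of maximal
functions taken with respect to `σ` and `w`, and these are bounded, by Doob's inequality, with
constants that do not see the weight. For `p ≤ q` one takes `s = p`, since `(∑ a)^{p/q} ≤ ∑
a^{p/q}`; for `p > q` one takes `s = q` and dualizes in `L^{p/q}(w)`. Extracting the `p`-th root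
gives the exponent `max(1/q, 1/(p-1))` in both cases.

Sharpness. Let `γ = 1/m` and `u = ‖x‖^{γ-n}`, an `A_1` weight with constant of order at most `m`.
For `1/(p-1)`, take `w = u^{-(p-1)}`, with `[w]_{A_p} ≲ m^{p-1}`, and the single function `u
1_{B(0,1)}`, which the maximal operator enlarges by a factor `nm` on the ball. For `1/q`, take `w =
u` and the indicators of the dyadic annuli: their `ℓ^q` norm is at most `1`, while each of the first
`m` maximal functions is at least `1/2` on `B(0,2^{-m})`, a ball that still carries half of the mass
of the unit ball. -/

/-- A sequence of nested countable measurable partitions of `X`; the cell of level `j` containing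
`x` is labelled by `idx j x`. -/
structure NestedPartition (X : Type*) [MeasurableSpace X] (ι : Type*) where
  idx : ℕ → X → ι
  measurableSet_fiber : ∀ j m, MeasurableSet (idx j ⁻¹' {m})
  idx_eq_of_succ : ∀ j x y, idx (j + 1) x = idx (j + 1) y → idx j x = idx j y

namespace NestedPartition

variable {X : Type*} [MeasurableSpace X] {ι : Type*} (P : NestedPartition X ι)

/-- The cell of level `j` containing `x`. -/
def cell (j : ℕ) (x : X) : Set X := {y | P.idx j y = P.idx j x}

/-- The average of `f` over the cell of level `j` containing `x`. -/
noncomputable def avg (ν : Measure X) (j : ℕ) (f : X → ℝ≥0∞) (x : X) : ℝ≥0∞ :=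
  (∫⁻ y in P.cell j x, f y ∂ν) / ν (P.cell j x)

/-- The maximal function of the partition. -/
noncomputable def maxFn (ν : Measure X) (f : X → ℝ≥0∞) (x : X) : ℝ≥0∞ := ⨆ j, P.avg ν j f x

/-- `h` is constant on the cells of level `j`. -/
def Adapted {β : Type*} (j : ℕ) (h : X → β) : Prop := ∀ x y, P.idx j x = P.idx j y → h x = h y

/-- `A` is a union of cells of level `j`. -/
def AdaptedSet (j : ℕ) (A : Set X) : Prop := ∀ x y, P.idx j x = P.idx j y → x ∈ A → y ∈ A

/-- The partition with the first `i` levels removed. -/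
def shift (i : ℕ) : NestedPartition X ι where
  idx j := P.idx (i + j)
  measurableSet_fiber j := P.measurableSet_fiber (i + j)
  idx_eq_of_succ j := P.idx_eq_of_succ (i + j)

variable {P} {ν : Measure X}

lemma cell_eq {j : ℕ} {x y : X} (h : P.idx j x = P.idx j y) : P.cell j x = P.cell j y := by
  simp [cell, h]

lemma cell_eq_of_mem {j : ℕ} {x y : X} (h : y ∈ P.cell j x) : P.cell j y = P.cell j x :=
  cell_eq h

lemma measurableSet_cell (j : ℕ) (x : X) : MeasurableSet (P.cell j x) :=
  P.measurableSet_fiber j (P.idx j x)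

lemma idx_eq_of_le {j k : ℕ} (h : j ≤ k) {x y : X} (hxy : P.idx k x = P.idx k y) :
    P.idx j x = P.idx j y := by
  induction k, h using Nat.le_induction with
  | base => exact hxy
  | succ k _ ih => exact ih (P.idx_eq_of_succ _ _ _ hxy)

lemma cell_subset_of_le {j k : ℕ} (h : j ≤ k) (x : X) : P.cell k x ⊆ P.cell j x :=
  fun _ hy => idx_eq_of_le h hy

lemma Adapted.mono {β : Type*} {j k : ℕ} (hjk : j ≤ k) {h : X → β} (hh : P.Adapted j h) :
    P.Adapted k h := fun x y hxy => hh x y (idx_eq_of_le hjk hxy)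

lemma AdaptedSet.mono {j k : ℕ} (hjk : j ≤ k) {A : Set X} (hA : P.AdaptedSet j A) :
    P.AdaptedSet k A := fun x y hxy => hA x y (idx_eq_of_le hjk hxy)

lemma AdaptedSet.inter {j : ℕ} {A B : Set X} (hA : P.AdaptedSet j A) (hB : P.AdaptedSet j B) :
    P.AdaptedSet j (A ∩ B) := fun x y h hx => ⟨hA x y h hx.1, hB x y h hx.2⟩

lemma AdaptedSet.compl {j : ℕ} {A : Set X} (hA : P.AdaptedSet j A) :
    P.AdaptedSet j Aᶜ := fun x y h hx hy => hx (hA y x h.symm hy)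

lemma AdaptedSet.cell_subset {j : ℕ} {A : Set X} (hA : P.AdaptedSet j A) {x : X} (hx : x ∈ A) :
    P.cell j x ⊆ A := fun y hy => hA x y (Eq.symm hy) hx

lemma adaptedSet_univ (j : ℕ) : P.AdaptedSet j Set.univ := fun _ _ _ _ => trivial

lemma adaptedSet_cell (j : ℕ) (x : X) : P.AdaptedSet j (P.cell j x) :=
  fun _ _ h hx => (Eq.symm h).trans hx

lemma Adapted.setOf {β : Type*} {j : ℕ} {h : X → β} (hh : P.Adapted j h) (p : β → Prop) :
    P.AdaptedSet j {x | p (h x)} := fun x y hxy (hx : p (h x)) => by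
  simpa [hh x y hxy] using hx

lemma adapted_avg (j : ℕ) (f : X → ℝ≥0∞) : P.Adapted j (P.avg ν j f) := fun x y h => by
  simp [avg, cell_eq h]

/-- A level has countably many cells, all measurable. Hence stopping sets, averages and stopped
averages are measurable whatever the function averaged. -/
lemma AdaptedSet.measurableSet [Countable ι] {j : ℕ} {A : Set X} (hA : P.AdaptedSet j A) :
    MeasurableSet A := by
  have : A = ⋃ m : (P.idx j '' A), P.idx j ⁻¹' {m.1} := by
    ext x
    simp only [Set.mem_iUnion, Set.mem_preimage, Set.mem_singleton_iff]
    constructor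
    · intro hx; exact ⟨⟨_, x, hx, rfl⟩, rfl⟩
    · rintro ⟨⟨_, y, hy, rfl⟩, hxy⟩; exact hA y x hxy.symm hy
  rw [this]
  exact MeasurableSet.iUnion fun m => P.measurableSet_fiber _ _

lemma Adapted.measurable [Countable ι] {β : Type*} [MeasurableSpace β] {j : ℕ} {h : X → β}
    (hh : P.Adapted j h) : Measurable h :=
  fun s _ => AdaptedSet.measurableSet (P := P) (j := j) (hh.setOf (· ∈ s))

lemma measurable_avg [Countable ι] (j : ℕ) (f : X → ℝ≥0∞) : Measurable (P.avg ν j f) :=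
  (adapted_avg j f).measurable

lemma measurable_maxFn [Countable ι] (f : X → ℝ≥0∞) : Measurable (P.maxFn ν f) :=
  Measurable.iSup fun j => measurable_avg j f

lemma avg_le_maxFn (j : ℕ) (f : X → ℝ≥0∞) (x : X) : P.avg ν j f x ≤ P.maxFn ν f x :=
  le_iSup (fun j => P.avg ν j f x) j

lemma lintegral_eq_tsum_fiber [Countable ι] (j : ℕ) (f : X → ℝ≥0∞) :
    ∫⁻ x, f x ∂ν = ∑' m, ∫⁻ x in P.idx j ⁻¹' {m}, f x ∂ν := by
  rw [← lintegral_iUnion (P.measurableSet_fiber j) ?_ f, ← Set.preimage_iUnion,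
    Set.iUnion_of_singleton, Set.preimage_univ, setLIntegral_univ]
  · intro a b hab
    exact Disjoint.preimage _ (by simpa using hab)

lemma lintegral_le_of_cell [Countable ι] (j : ℕ) {u v : X → ℝ≥0∞} {μ ν : Measure X}
    (h : ∀ x, ∫⁻ y in P.cell j x, u y ∂μ ≤ ∫⁻ y in P.cell j x, v y ∂ν) :
    ∫⁻ x, u x ∂μ ≤ ∫⁻ x, v x ∂ν := by
  rw [P.lintegral_eq_tsum_fiber j u, P.lintegral_eq_tsum_fiber j v]
  refine ENNReal.tsum_le_tsum fun m => ?_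
  rcases (P.idx j ⁻¹' {m}).eq_empty_or_nonempty with h0 | ⟨x, hx⟩
  · simp [h0]
  · have hx' : P.idx j x = m := hx
    have : P.idx j ⁻¹' {m} = P.cell j x := by ext y; simp [cell, hx']
    rw [this]; exact h x

lemma lintegral_cell_avg (hν : ∀ j x, ν (P.cell j x) ≠ ∞) (j : ℕ) (f : X → ℝ≥0∞) (x : X) :
    ∫⁻ y in P.cell j x, P.avg ν j f y ∂ν = ∫⁻ y in P.cell j x, f y ∂ν := by
  have : ∫⁻ y in P.cell j x, P.avg ν j f y ∂ν = ∫⁻ _ in P.cell j x, P.avg ν j f x ∂ν :=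
    setLIntegral_congr_fun (measurableSet_cell j x) fun y hy => adapted_avg j f y x hy
  rw [this, setLIntegral_const, avg]
  rcases eq_or_ne (ν (P.cell j x)) 0 with h0 | h0
  · rw [setLIntegral_measure_zero _ _ h0]; simp [h0]
  · exact ENNReal.div_mul_cancel h0 (hν j x)

lemma setLIntegral_le_of_cell [Countable ι] (j : ℕ) {u v : X → ℝ≥0∞} {μ ν : Measure X}
    {A : Set X} (hA : P.AdaptedSet j A)
    (h : ∀ x ∈ A, ∫⁻ y in P.cell j x, u y ∂μ ≤ ∫⁻ y in P.cell j x, v y ∂ν) :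
    ∫⁻ x in A, u x ∂μ ≤ ∫⁻ x in A, v x ∂ν := by
  refine lintegral_le_of_cell (P := P) j fun x => ?_
  rw [Measure.restrict_restrict (measurableSet_cell j x),
    Measure.restrict_restrict (measurableSet_cell j x)]
  by_cases hx : x ∈ A
  · rw [Set.inter_eq_left.2 (hA.cell_subset hx)]
    exact h x hx
  · have : P.cell j x ∩ A = ∅ := by
      ext y
      simp only [Set.mem_inter_iff, Set.mem_empty_iff_false, iff_false, not_and]
      exact fun hy hyA => hx (hA y x hy hyA)
    simp [this]

lemma setLIntegral_eq_of_cell [Countable ι] (j : ℕ) {u v : X → ℝ≥0∞} {μ ν : Measure X}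
    {A : Set X} (hA : P.AdaptedSet j A)
    (h : ∀ x ∈ A, ∫⁻ y in P.cell j x, u y ∂μ = ∫⁻ y in P.cell j x, v y ∂ν) :
    ∫⁻ x in A, u x ∂μ = ∫⁻ x in A, v x ∂ν :=
  le_antisymm (setLIntegral_le_of_cell j hA fun x hx => (h x hx).le)
    (setLIntegral_le_of_cell j hA fun x hx => (h x hx).ge)

lemma setLIntegral_avg [Countable ι] (hν : ∀ j x, ν (P.cell j x) ≠ ∞) (j : ℕ) (f : X → ℝ≥0∞)
    {A : Set X} (hA : P.AdaptedSet j A) :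
    ∫⁻ y in A, P.avg ν j f y ∂ν = ∫⁻ y in A, f y ∂ν :=
  setLIntegral_eq_of_cell j hA fun x _ => lintegral_cell_avg hν j f x

lemma avg_mono {j : ℕ} {f g : X → ℝ≥0∞} (h : ∀ x, f x ≤ g x) (x : X) :
    P.avg ν j f x ≤ P.avg ν j g x :=
  ENNReal.div_le_div_right (lintegral_mono h) _

lemma avg_const_le (j : ℕ) (c : ℝ≥0∞) (x : X) : P.avg ν j (fun _ => c) x ≤ c := by
  rw [avg, setLIntegral_const]
  exact ENNReal.div_le_of_le_mul le_rfl

lemma avg_add_le {j : ℕ} {f g : X → ℝ≥0∞} (hf : Measurable f) (x : X) :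
    P.avg ν j (fun y => f y + g y) x ≤ P.avg ν j f x + P.avg ν j g x := by
  rw [avg, avg, avg, lintegral_add_left hf, ENNReal.add_div]

/-- The set of points where level `j` is the first at which the average of `f` exceeds `t`. -/
def firstSet (P : NestedPartition X ι) (ν : Measure X) (f : X → ℝ≥0∞) (t : ℝ≥0∞) (j : ℕ) : Set X :=
  {x | t < P.avg ν j f x ∧ ∀ i < j, P.avg ν i f x ≤ t}

lemma adaptedSet_firstSet (f : X → ℝ≥0∞) (t : ℝ≥0∞) (j : ℕ) :
    P.AdaptedSet j (P.firstSet ν f t j) := by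
  rintro x y hxy ⟨h1, h2⟩
  refine ⟨(adapted_avg j f x y hxy) ▸ h1, fun i hi => ?_⟩
  rw [← (adapted_avg i f).mono hi.le x y hxy]
  exact h2 i hi

lemma iUnion_firstSet (f : X → ℝ≥0∞) (t : ℝ≥0∞) :
    ⋃ j, P.firstSet ν f t j = {x | t < P.maxFn ν f x} := by
  classical
  ext x
  simp only [Set.mem_iUnion, Set.mem_ofPred_eq, maxFn, lt_iSup_iff]
  constructor
  · rintro ⟨j, h, _⟩; exact ⟨j, h⟩
  · intro h
    refine ⟨Nat.find h, Nat.find_spec h, fun i hi => not_lt.1 (Nat.find_min h hi)⟩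

lemma disjoint_firstSet (f : X → ℝ≥0∞) (t : ℝ≥0∞) :
    Pairwise (Function.onFun Disjoint (P.firstSet ν f t)) := by
  intro i j hij
  refine Set.disjoint_left.2 fun x hi hj => ?_
  rcases lt_or_gt_of_ne hij with h | h
  · exact absurd hi.1 (not_lt.2 (hj.2 i h))
  · exact absurd hj.1 (not_lt.2 (hi.2 j h))

/-- The weak type inequality for the maximal function of a nested partition. -/
theorem mul_meas_maxFn_le [Countable ι] (hν : ∀ j x, ν (P.cell j x) ≠ ∞) (f : X → ℝ≥0∞)
    (t : ℝ≥0∞) :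
    t * ν {x | t < P.maxFn ν f x} ≤ ∫⁻ x in {x | t < P.maxFn ν f x}, f x ∂ν := by
  have hm : ∀ j, MeasurableSet (P.firstSet ν f t j) :=
    fun j => (adaptedSet_firstSet f t j).measurableSet
  rw [← iUnion_firstSet, lintegral_iUnion hm (disjoint_firstSet f t),
    measure_iUnion (disjoint_firstSet f t) hm, ← ENNReal.tsum_mul_left]
  refine ENNReal.tsum_le_tsum fun j => ?_
  -- On the first-passage set of level `j`, a union of cells of that level, `f` may be replaced by
  -- its averages, which exceed `t` there.
  rw [← setLIntegral_avg hν j f (adaptedSet_firstSet f t j), ← setLIntegral_const]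
  exact setLIntegral_mono' (hm j) fun x hx => hx.1.le

end NestedPartition

/-! ### Layer cake formulas and Doob's `L^p` inequality. -/

/-- The layer cake formula for powers of a function that is finite almost everywhere. -/
lemma lintegral_rpow_eq_layer {X : Type*} [MeasurableSpace X] {ν : Measure X} {g : X → ℝ≥0∞}
    (hg : Measurable g) (hfin : ∀ᵐ x ∂ν, g x < ∞) {p : ℝ} (hp : 0 < p) :
    ∫⁻ x, g x ^ p ∂ν = ENNReal.ofReal p *
      ∫⁻ t in Set.Ioi (0 : ℝ), ν {x | ENNReal.ofReal t < g x} * ENNReal.ofReal (t ^ (p - 1)) := by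
  have h := lintegral_rpow_eq_lintegral_meas_lt_mul ν (f := fun x => (g x).toReal)
    (Filter.Eventually.of_forall fun x => ENNReal.toReal_nonneg) hg.ennreal_toReal.aemeasurable hp
  have h1 : ∫⁻ x, g x ^ p ∂ν = ∫⁻ x, ENNReal.ofReal ((g x).toReal ^ p) ∂ν := by
    refine lintegral_congr_ae ?_
    filter_upwards [hfin] with x hx
    rw [← ENNReal.ofReal_rpow_of_nonneg ENNReal.toReal_nonneg hp.le, ENNReal.ofReal_toReal hx.ne]
  rw [h1, h]
  congr 1
  refine setLIntegral_congr_fun measurableSet_Ioi fun t ht => ?_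
  congr 1
  refine measure_congr ?_
  filter_upwards [hfin] with x hx
  exact propext (ENNReal.ofReal_lt_iff_lt_toReal (le_of_lt ht) hx.ne).symm

lemma lintegral_rpow_le_layer {X : Type*} [MeasurableSpace X] {ν : Measure X} {g : X → ℝ≥0∞}
    (hg : Measurable g) {p : ℝ} (hp : 0 < p) :
    ∫⁻ x, g x ^ p ∂ν ≤ ENNReal.ofReal p *
      ∫⁻ t in Set.Ioi (0 : ℝ), ν {x | ENNReal.ofReal t < g x} * ENNReal.ofReal (t ^ (p - 1)) := by
  -- Truncating at `n` supplies the finiteness that the layer cake identity needs; monotone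
  -- convergence removes the truncation.
  have hsup : ∀ x, g x ^ p = ⨆ n : ℕ, (min (g x) n) ^ p := by
    intro x
    have h1 : g x = ⨆ n : ℕ, min (g x) n := by
      rw [← inf_iSup_eq, ENNReal.iSup_natCast, inf_top_eq]
    have h2 := (ENNReal.orderIsoRpow p hp).map_iSup (fun n : ℕ => min (g x) n)
    rw [← h1] at h2
    simpa only [ENNReal.orderIsoRpow_apply] using h2
  simp_rw [hsup]
  rw [lintegral_iSup]
  · refine iSup_le fun n => ?_
    rw [lintegral_rpow_eq_layer (hg.min measurable_const)
      (Filter.Eventually.of_forall fun x => (min_le_right _ _).trans_lt (by simp)) hp]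
    gcongr
    exact min_le_left _ _
  · exact fun n => (hg.min measurable_const).pow_const p
  · intro m n hmn x
    simp only
    gcongr

namespace NestedPartition

variable {X : Type*} [MeasurableSpace X] {ι : Type*} {P : NestedPartition X ι} {ν : Measure X}

/-- The maximal function of a nested partition is bounded on `L^p`, `1 < p`. -/
theorem lintegral_maxFn_rpow_le [Countable ι] (hν : ∀ j x, ν (P.cell j x) ≠ ∞) {f : X → ℝ≥0∞}
    (hf : Measurable f) {p : ℝ} (hp : 1 < p) :
    ∫⁻ x, P.maxFn ν f x ^ p ∂ν ≤ ENNReal.ofReal (2 ^ p * p / (p - 1)) * ∫⁻ x, f x ^ p ∂ν := by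
  have hp0 : 0 < p - 1 := by linarith
  rcases eq_or_ne (∫⁻ x, f x ^ p ∂ν) ∞ with htop | htop
  · rw [htop, ENNReal.mul_top]
    · exact le_top
    · simp only [ne_eq, ENNReal.ofReal_eq_zero, not_le]; positivity
  have hfin : ∀ᵐ x ∂ν, f x < ∞ := by
    filter_upwards [ae_lt_top (hf.pow_const p) htop] with x hx
    exact (ENNReal.rpow_lt_top_iff_of_pos (by linarith)).1 hx
  -- The weak type inequality is applied to the part of `f` above `t/2`, since the rest raises
  -- averages by at most `t/2`. Its right-hand side is the `f dν`-measure of `{2f > t}`, so a second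
  -- layer cake, for the exponent `p - 1` and the measure `f dν`, finishes the proof.
  have key : ∀ t : ℝ, 0 < t → ν {x | ENNReal.ofReal t < P.maxFn ν f x} *
      ENNReal.ofReal (t ^ (p - 1)) ≤
      2 * ((ν.withDensity f) {x | ENNReal.ofReal t < 2 * f x} *
        ENNReal.ofReal (t ^ (p - 1 - 1))) := by
    intro t ht
    set s : ℝ≥0∞ := ENNReal.ofReal (t / 2) with hs
    have hts : ENNReal.ofReal t = s + s := by
      rw [hs, ← ENNReal.ofReal_add (by positivity) (by positivity)]; congr 1; ring
    have hs0 : s ≠ 0 := by simp [hs, ht]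
    have hst : s ≠ ∞ := by simp [hs]
    set B : Set X := {x | s < f x} with hB
    have hBm : MeasurableSet B := measurableSet_lt measurable_const hf
    have hsub : {x | ENNReal.ofReal t < P.maxFn ν f x} ⊆
        {x | s < P.maxFn ν (B.indicator f) x} := by
      intro x hx
      simp only [Set.mem_ofPred_eq] at hx ⊢
      by_contra hcon
      refine absurd hx (not_lt.2 (iSup_le fun j => ?_))
      calc P.avg ν j f x ≤ P.avg ν j (fun y => B.indicator f y + s) x := by
            refine avg_mono (fun y => ?_) x
            by_cases hy : y ∈ B
            · simp [hy]
            · have : f y ≤ s := not_lt.1 hy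
              simpa [hy] using this
        _ ≤ P.avg ν j (B.indicator f) x + P.avg ν j (fun _ => s) x :=
            avg_add_le (hf.indicator hBm) x
        _ ≤ s + s := add_le_add ((avg_le_maxFn j _ x).trans (not_lt.1 hcon)) (avg_const_le j s x)
        _ = ENNReal.ofReal t := hts.symm
    have hB2 : {x | ENNReal.ofReal t < 2 * f x} = B := by
      ext x
      simp only [Set.mem_ofPred_eq, hB, hts, ← two_mul]
      exact ENNReal.mul_lt_mul_iff_right (by simp) (by simp)
    have hw : s * ν {x | ENNReal.ofReal t < P.maxFn ν f x} ≤ (ν.withDensity f) B := by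
      calc s * ν {x | ENNReal.ofReal t < P.maxFn ν f x}
          ≤ s * ν {x | s < P.maxFn ν (B.indicator f) x} := by gcongr
        _ ≤ ∫⁻ x in {x | s < P.maxFn ν (B.indicator f) x}, B.indicator f x ∂ν :=
            mul_meas_maxFn_le hν _ _
        _ ≤ ∫⁻ x, B.indicator f x ∂ν := setLIntegral_le_lintegral _ _
        _ = (ν.withDensity f) B := by rw [lintegral_indicator hBm, withDensity_apply _ hBm]
    rw [hB2]
    have hpow : ENNReal.ofReal (t ^ (p - 1)) = 2 * (s * ENNReal.ofReal (t ^ (p - 1 - 1))) := by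
      rw [← mul_assoc, two_mul, ← hts, ← ENNReal.ofReal_mul ht.le]
      congr 1
      rw [Real.rpow_sub_one ht.ne' (p - 1)]
      field_simp
    calc ν {x | ENNReal.ofReal t < P.maxFn ν f x} * ENNReal.ofReal (t ^ (p - 1))
        = 2 * ((s * ν {x | ENNReal.ofReal t < P.maxFn ν f x}) *
            ENNReal.ofReal (t ^ (p - 1 - 1))) := by rw [hpow]; ring
      _ ≤ _ := by gcongr
  have hlay := lintegral_rpow_eq_layer (ν := ν.withDensity f) (g := fun x => 2 * f x)
    (hf.const_mul 2) ((withDensity_absolutelyContinuous ν f).ae_le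
      (hfin.mono fun x hx => ENNReal.mul_lt_top (by simp) hx)) hp0
  have hwd : ∫⁻ x, (2 * f x) ^ (p - 1) ∂(ν.withDensity f) =
      ENNReal.ofReal (2 ^ (p - 1)) * ∫⁻ x, f x ^ p ∂ν := by
    rw [lintegral_withDensity_eq_lintegral_mul _ hf ((hf.const_mul 2).pow_const _),
      ← lintegral_const_mul _ (hf.pow_const p)]
    refine lintegral_congr fun x => ?_
    simp only [Pi.mul_apply]
    rw [ENNReal.mul_rpow_of_nonneg _ _ hp0.le, ← ENNReal.ofReal_rpow_of_pos (by norm_num)]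
    have : f x ^ p = f x * f x ^ (p - 1) := by
      conv_lhs => rw [show p = 1 + (p - 1) by ring]
      rw [ENNReal.rpow_add_of_nonneg _ _ (by norm_num) hp0.le, ENNReal.rpow_one]
    rw [this]; simp; ring
  calc ∫⁻ x, P.maxFn ν f x ^ p ∂ν
      ≤ ENNReal.ofReal p * ∫⁻ t in Set.Ioi (0 : ℝ), ν {x | ENNReal.ofReal t < P.maxFn ν f x} *
          ENNReal.ofReal (t ^ (p - 1)) :=
        lintegral_rpow_le_layer (measurable_maxFn f) (by linarith)
    _ ≤ ENNReal.ofReal p * ∫⁻ t in Set.Ioi (0 : ℝ), 2 *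
          ((ν.withDensity f) {x | ENNReal.ofReal t < 2 * f x} *
          ENNReal.ofReal (t ^ (p - 1 - 1))) := by
        gcongr ENNReal.ofReal p * ?_
        exact setLIntegral_mono' measurableSet_Ioi fun t ht => key t ht
    _ = ENNReal.ofReal (2 ^ p * p / (p - 1)) * ∫⁻ x, f x ^ p ∂ν := by
        rw [lintegral_const_mul' _ _ (by simp)]
        have h2 : ENNReal.ofReal (2 ^ p * p / (p - 1)) = ENNReal.ofReal p * (2 *
            ((ENNReal.ofReal (p - 1))⁻¹ * ENNReal.ofReal (2 ^ (p - 1)))) := by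
          rw [show (2 : ℝ≥0∞) = ENNReal.ofReal 2 by simp, ← ENNReal.ofReal_inv_of_pos hp0,
            ← ENNReal.ofReal_mul (by positivity), ← ENNReal.ofReal_mul (by positivity),
            ← ENNReal.ofReal_mul (by positivity)]
          congr 1
          rw [Real.rpow_sub_one (by norm_num)]
          field_simp
        have h3 : ∫⁻ t in Set.Ioi (0 : ℝ), (ν.withDensity f) {x | ENNReal.ofReal t < 2 * f x} *
            ENNReal.ofReal (t ^ (p - 1 - 1)) =
            (ENNReal.ofReal (p - 1))⁻¹ * (ENNReal.ofReal (2 ^ (p - 1)) * ∫⁻ x, f x ^ p ∂ν) := by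
          rw [← hwd, hlay, ← mul_assoc, ENNReal.inv_mul_cancel (by simpa using hp0) (by simp),
            one_mul]
        rw [h3, h2]
        ring

end NestedPartition

/-! ### Self-improving inequalities, `ℓ^q` norms and Minkowski's inequality. -/

/-- Self-improvement: `T ≤ T^{1-1/r} K` with `T` finite gives `T ≤ K^r`. -/
lemma ENNReal.le_rpow_of_le_rpow_mul {T K : ℝ≥0∞} {r : ℝ} (hr : 1 ≤ r) (hT : T ≠ ∞)
    (h : T ≤ T ^ (1 - 1 / r) * K) : T ≤ K ^ r := by
  rcases eq_or_ne T 0 with h0 | h0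
  · simp [h0]
  have hr0 : r ≠ 0 := by positivity
  have h1 : T ^ (1 / r) ≤ K := by
    have h2 : T ^ (1 - 1 / r) * T ^ (1 / r) ≤ T ^ (1 - 1 / r) * K := by
      rw [← ENNReal.rpow_add _ _ h0 hT]
      simpa using h
    exact (ENNReal.mul_le_mul_iff_right (by simp [ENNReal.rpow_eq_zero_iff, h0, hT])
      (by simp [ENNReal.rpow_eq_top_iff, h0, hT])).1 h2
  calc T = (T ^ (1 / r)) ^ r := by rw [← ENNReal.rpow_mul, one_div_mul_cancel hr0, ENNReal.rpow_one]
    _ ≤ K ^ r := ENNReal.rpow_le_rpow h1 (by linarith)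

lemma ENNReal.iSup_rpow {κ : Sort*} (u : κ → ℝ≥0∞) {p : ℝ} (hp : 0 < p) :
    (⨆ i, u i) ^ p = ⨆ i, u i ^ p := by
  simpa only [ENNReal.orderIsoRpow_apply] using (ENNReal.orderIsoRpow p hp).map_iSup u

/-- Monotone convergence for counting measure. -/
lemma ENNReal.tsum_iSup_of_monotone {κ : Type*} (u : ℕ → κ → ℝ≥0∞)
    (hu : ∀ l, Monotone fun L => u L l) : ∑' l, ⨆ L, u L l = ⨆ L, ∑' l, u L l := by
  let _ : MeasurableSpace κ := ⊤
  simp_rw [← lintegral_count]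
  exact lintegral_iSup (fun L => measurable_from_top) (fun a b hab l => hu l hab)

/-- The pointwise `ℓ^q` norm of a sequence of functions. -/
noncomputable def seqNorm {X : Type*} (q : ℝ) (f : ℕ → X → ℝ≥0∞) (x : X) : ℝ≥0∞ :=
  (∑' l, f l x ^ q) ^ (1 / q)

lemma seqNorm_rpow {X : Type*} {q : ℝ} (hq : 0 < q) (f : ℕ → X → ℝ≥0∞) (x : X) :
    seqNorm q f x ^ q = ∑' l, f l x ^ q := by
  rw [seqNorm, ← ENNReal.rpow_mul, one_div_mul_cancel hq.ne', ENNReal.rpow_one]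

lemma le_seqNorm {X : Type*} {q : ℝ} (hq : 0 < q) (f : ℕ → X → ℝ≥0∞) (l : ℕ) (x : X) :
    f l x ≤ seqNorm q f x := by
  rw [← ENNReal.rpow_le_rpow_iff hq, seqNorm_rpow hq]
  exact ENNReal.le_tsum (f := fun l => f l x ^ q) l

lemma measurable_seqNorm {X : Type*} [MeasurableSpace X] {q : ℝ} {f : ℕ → X → ℝ≥0∞}
    (hf : ∀ l, Measurable (f l)) : Measurable (seqNorm q f) :=
  (Measurable.tsum fun l => (hf l).pow_const q).pow_const _

/-- Minkowski's integral inequality for sequences. -/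
lemma tsum_lintegral_rpow_le {X : Type*} [MeasurableSpace X] {ν : Measure X} {q : ℝ} (hq : 1 < q)
    {f : ℕ → X → ℝ≥0∞} (hf : ∀ l, Measurable (f l)) :
    ∑' l, (∫⁻ x, f l x ∂ν) ^ q ≤ (∫⁻ x, seqNorm q f x ∂ν) ^ q := by
  have hq0 : 0 < q := by linarith
  have hqc : q.HolderConjugate (q / (q - 1)) := .conjExponent hq
  have hle : ∀ l, ∫⁻ x, f l x ∂ν ≤ ∫⁻ x, seqNorm q f x ∂ν :=
    fun l => lintegral_mono fun x => le_seqNorm hq0 f l x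
  by_cases htop : ∫⁻ x, seqNorm q f x ∂ν = ∞
  · simp [htop, hq0]
  have ha : ∀ l, ∫⁻ x, f l x ∂ν ≠ ∞ := fun l => ne_top_of_le_ne_top htop (hle l)
  rw [ENNReal.tsum_eq_iSup_sum]
  refine iSup_le fun s => ?_
  set a : ℕ → ℝ≥0∞ := fun l => ∫⁻ x, f l x ∂ν with hadef
  -- For a finite sum `T = ∑ a_l^q`, linearizing as `∑ a_l^{q-1} f_l(x)` and applying Hölder for
  -- sums at each point gives `T ≤ T^{1-1/q} ∫ F`, which self-improves because `T` is finite.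
  refine ENNReal.le_rpow_of_le_rpow_mul hq.le ?_ ?_
  · exact (ENNReal.sum_lt_top.2 fun l _ => (ENNReal.rpow_lt_top_of_nonneg hq0.le (ha l))).ne
  have hpow : ∀ l, a l ^ q = a l ^ (q - 1) * a l := by
    intro l
    conv_lhs => rw [show q = (q - 1) + 1 by ring]
    rw [ENNReal.rpow_add_of_nonneg _ _ (by linarith) (by norm_num), ENNReal.rpow_one]
  calc ∑ l ∈ s, a l ^ q = ∑ l ∈ s, ∫⁻ x, a l ^ (q - 1) * f l x ∂ν := by
        refine Finset.sum_congr rfl fun l _ => ?_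
        rw [hpow, lintegral_const_mul _ (hf l)]
    _ = ∫⁻ x, ∑ l ∈ s, a l ^ (q - 1) * f l x ∂ν :=
        (lintegral_finsetSum _ fun l _ => (hf l).const_mul _).symm
    _ ≤ ∫⁻ x, (∑ l ∈ s, a l ^ q) ^ (1 - 1 / q) * seqNorm q f x ∂ν := by
        refine lintegral_mono fun x => ?_
        refine (ENNReal.inner_le_Lp_mul_Lq s _ _ hqc.symm).trans ?_
        have h1 : ∀ l, (a l ^ (q - 1)) ^ (q / (q - 1)) = a l ^ q := by
          intro l
          rw [← ENNReal.rpow_mul]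
          congr 1
          field_simp [(show q - 1 ≠ 0 by linarith)]
        have h2 : 1 / (q / (q - 1)) = 1 - 1 / q := by field_simp
        simp only [h1, h2]
        gcongr
        rw [seqNorm]
        gcongr
        exact ENNReal.sum_le_tsum s
    _ = _ := lintegral_const_mul _ (measurable_seqNorm hf)

/-! ### Stopped averages and the vector-valued weak type inequality. -/

namespace NestedPartition

variable {X : Type*} [MeasurableSpace X] {ι : Type*} {P : NestedPartition X ι} {μ : Measure X}

lemma tsum_avg_rpow_le {q : ℝ} (hq : 1 < q) {f : ℕ → X → ℝ≥0∞} (hf : ∀ l, Measurable (f l))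
    (j : ℕ) (x : X) : ∑' l, P.avg μ j (f l) x ^ q ≤ P.avg μ j (seqNorm q f) x ^ q := by
  have hq0 : 0 ≤ q := by linarith
  simp only [avg, ENNReal.div_eq_inv_mul, ENNReal.mul_rpow_of_nonneg _ _ hq0]
  rw [ENNReal.tsum_mul_left]
  gcongr
  exact tsum_lintegral_rpow_le hq hf

/-- The maximal function restricted to the levels in `s`. -/
noncomputable def maxOn (P : NestedPartition X ι) (ν : Measure X) (s : Set ℕ) (f : X → ℝ≥0∞)
    (x : X) : ℝ≥0∞ := ⨆ k ∈ s, P.avg ν k f x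

lemma avg_le_maxOn {s : Set ℕ} {k : ℕ} (hk : k ∈ s) (f : X → ℝ≥0∞) (x : X) :
    P.avg μ k f x ≤ P.maxOn μ s f x := le_iSup₂ (f := fun k _ => P.avg μ k f x) k hk

lemma maxOn_mono {s t : Set ℕ} (h : s ⊆ t) (f : X → ℝ≥0∞) (x : X) :
    P.maxOn μ s f x ≤ P.maxOn μ t f x := biSup_mono fun _ hk => h hk

lemma maxOn_le_maxFn (s : Set ℕ) (f : X → ℝ≥0∞) (x : X) :
    P.maxOn μ s f x ≤ P.maxFn μ f x := iSup₂_le fun k _ => avg_le_maxFn k f x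

lemma adapted_maxOn {s : Set ℕ} {L : ℕ} (hs : ∀ k ∈ s, k ≤ L) (f : X → ℝ≥0∞) :
    P.Adapted L (P.maxOn μ s f) := fun x y h => by
  simp only [maxOn]
  exact iSup_congr fun k => iSup_congr fun hk => (adapted_avg k f).mono (hs k hk) x y h

lemma maxFn_eq_iSup_maxOn (f : X → ℝ≥0∞) (x : X) :
    P.maxFn μ f x = ⨆ L : ℕ, P.maxOn μ (Set.Iic L) f x :=
  le_antisymm (iSup_le fun j => le_iSup_of_le j (avg_le_maxOn Set.self_mem_Iic f x))
    (iSup_le fun _ => maxOn_le_maxFn _ f x)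

lemma tsum_maxFn_rpow_eq_iSup {q : ℝ} (hq : 0 < q) (f : ℕ → X → ℝ≥0∞) (x : X) :
    ∑' l, P.maxFn μ (f l) x ^ q = ⨆ L : ℕ, ∑' l, P.maxOn μ (Set.Iic L) (f l) x ^ q := by
  rw [← ENNReal.tsum_iSup_of_monotone]
  · refine tsum_congr fun l => ?_
    rw [maxFn_eq_iSup_maxOn, ENNReal.iSup_rpow _ hq]
  · intro l L L' h
    exact ENNReal.rpow_le_rpow (maxOn_mono (Set.Iic_subset_Iic.2 h) _ _) hq.le

/-- The points at which some average of `F` of level at most `j` exceeds `t`. -/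
def stopSet (P : NestedPartition X ι) (μ : Measure X) (F : X → ℝ≥0∞) (t : ℝ≥0∞) (j : ℕ) : Set X :=
  {x | ∃ i ≤ j, t < P.avg μ i F x}

lemma adaptedSet_stopSet (F : X → ℝ≥0∞) (t : ℝ≥0∞) (j : ℕ) :
    P.AdaptedSet j (P.stopSet μ F t j) := by
  rintro x y hxy ⟨i, hi, h⟩
  exact ⟨i, hi, (adapted_avg i F).mono hi x y hxy ▸ h⟩

lemma stopSet_mono (F : X → ℝ≥0∞) (t : ℝ≥0∞) {i j : ℕ} (h : i ≤ j) :
    P.stopSet μ F t i ⊆ P.stopSet μ F t j := fun _ ⟨k, hk, hx⟩ => ⟨k, hk.trans h, hx⟩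

open Classical in
/-- The averages of `f` stopped at the first level at which the average of `F` exceeds `t`. -/
noncomputable def stopped (P : NestedPartition X ι) (μ : Measure X) (F : X → ℝ≥0∞) (t : ℝ≥0∞)
    (f : X → ℝ≥0∞) : ℕ → X → ℝ≥0∞
  | 0 => P.avg μ 0 f
  | j + 1 => fun x => if x ∈ P.stopSet μ F t j then P.stopped μ F t f j x else P.avg μ (j + 1) f x

variable {F : X → ℝ≥0∞} {t : ℝ≥0∞}

lemma stopped_succ_of_mem (f : X → ℝ≥0∞) {j : ℕ} {x : X} (hx : x ∈ P.stopSet μ F t j) :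
    P.stopped μ F t f (j + 1) x = P.stopped μ F t f j x := by simp [stopped, hx]

lemma stopped_succ_of_notMem (f : X → ℝ≥0∞) {j : ℕ} {x : X} (hx : x ∉ P.stopSet μ F t j) :
    P.stopped μ F t f (j + 1) x = P.avg μ (j + 1) f x := by simp [stopped, hx]

lemma stopped_eq_avg (f : X → ℝ≥0∞) {j : ℕ} {x : X} (hx : x ∉ P.stopSet μ F t j) :
    P.stopped μ F t f j x = P.avg μ j f x := by
  cases j with
  | zero => rfl
  | succ j => exact stopped_succ_of_notMem f fun h => hx (stopSet_mono F t j.le_succ h)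

lemma adapted_stopped (f : X → ℝ≥0∞) (j : ℕ) : P.Adapted j (P.stopped μ F t f j) := by
  induction j with
  | zero => exact adapted_avg 0 f
  | succ j ih =>
    intro x y hxy
    have hxy' := P.idx_eq_of_succ j x y hxy
    by_cases hx : x ∈ P.stopSet μ F t j
    · rw [stopped_succ_of_mem f hx,
        stopped_succ_of_mem f (adaptedSet_stopSet F t j x y hxy' hx), ih x y hxy']
    · rw [stopped_succ_of_notMem f hx,
        stopped_succ_of_notMem f (fun hy => hx (adaptedSet_stopSet F t j y x hxy'.symm hy)),
        adapted_avg _ f x y hxy]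

lemma measurable_stopped [Countable ι] (f : X → ℝ≥0∞) (j : ℕ) :
    Measurable (P.stopped μ F t f j) := (adapted_stopped f j).measurable

/-- The stopped averages are a martingale: on stopped cells nothing changes, and elsewhere two
consecutive averages of `f` have the same integral over unions of cells of the coarser level. -/
lemma setLIntegral_stopped_succ [Countable ι] (hμ : ∀ j x, μ (P.cell j x) ≠ ∞) (f : X → ℝ≥0∞)
    {j : ℕ} {A : Set X} (hA : P.AdaptedSet j A) :
    ∫⁻ x in A, P.stopped μ F t f (j + 1) x ∂μ = ∫⁻ x in A, P.stopped μ F t f j x ∂μ := by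
  have hS := adaptedSet_stopSet (P := P) (μ := μ) F t j
  have hSm := hS.measurableSet
  rw [← lintegral_inter_add_sdiff _ A hSm, ← lintegral_inter_add_sdiff (μ := μ)
    (P.stopped μ F t f j) A hSm]
  have hd : P.AdaptedSet j (A \ P.stopSet μ F t j) := hA.inter hS.compl
  congr 1
  · exact setLIntegral_congr_fun (hA.measurableSet.inter hSm) fun x hx =>
      stopped_succ_of_mem f hx.2
  · rw [setLIntegral_congr_fun hd.measurableSet fun x hx => stopped_succ_of_notMem f hx.2,
      setLIntegral_congr_fun hd.measurableSet fun x hx => stopped_eq_avg f hx.2,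
      setLIntegral_avg hμ _ f hd, setLIntegral_avg hμ _ f (hd.mono j.le_succ)]

lemma lintegral_stopped [Countable ι] (hμ : ∀ j x, μ (P.cell j x) ≠ ∞) (f : X → ℝ≥0∞) (j : ℕ) :
    ∫⁻ x, P.stopped μ F t f j x ∂μ = ∫⁻ x, f x ∂μ := by
  induction j with
  | zero =>
    have := setLIntegral_avg hμ 0 f (adaptedSet_univ (P := P) 0)
    rw [setLIntegral_univ, setLIntegral_univ] at this
    exact this
  | succ j ih =>
    have := setLIntegral_stopped_succ (F := F) (t := t) hμ f (adaptedSet_univ (P := P) j)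
    rw [← ih]
    simpa only [setLIntegral_univ] using this

/-- A point not stopped by level `L` has a cell of level `k` on which stopping has not yet occurred.
There the stopped process starts at the average of `f`, and the martingale property preserves its
integral, even if parts of the cell are stopped later. -/
lemma avg_stopped [Countable ι] (hμ : ∀ j x, μ (P.cell j x) ≠ ∞) (f : X → ℝ≥0∞) {k L : ℕ}
    (hkL : k ≤ L) {x : X} (hx : x ∉ P.stopSet μ F t L) :
    P.avg μ k (P.stopped μ F t f L) x = P.avg μ k f x := by
  have hxk : x ∉ P.stopSet μ F t k := fun h => hx (stopSet_mono F t hkL h)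
  simp only [avg]
  congr 1
  clear hx
  induction L, hkL using Nat.le_induction with
  | base =>
    rw [← setLIntegral_avg hμ k f (adaptedSet_cell k x)]
    refine setLIntegral_congr_fun (measurableSet_cell k x) fun y hy => stopped_eq_avg f fun h => ?_
    exact hxk (adaptedSet_stopSet F t k y x hy h)
  | succ L hL ih =>
    rw [setLIntegral_stopped_succ hμ f ((adaptedSet_cell k x).mono hL), ih]

/-- The stopping rule depends on `F` alone, so every `f_l` and their `ℓ^q` norm stop at the same
level, and at that level Minkowski's inequality applies. -/
lemma tsum_stopped_rpow_le {q : ℝ} (hq : 1 < q) {f : ℕ → X → ℝ≥0∞} (hf : ∀ l, Measurable (f l))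
    (j : ℕ) (x : X) :
    ∑' l, P.stopped μ F t (f l) j x ^ q ≤ P.stopped μ F t (seqNorm q f) j x ^ q := by
  induction j with
  | zero => exact tsum_avg_rpow_le hq hf 0 x
  | succ j ih =>
    by_cases hx : x ∈ P.stopSet μ F t j
    · simpa only [stopped_succ_of_mem _ hx] using ih
    · simpa only [stopped_succ_of_notMem _ hx] using tsum_avg_rpow_le hq hf (j + 1) x

/-- Doubling passes to averages of consecutive levels. -/
lemma avg_succ_le {D : ℝ≥0} (hμ : ∀ j x, μ (P.cell j x) ≠ ∞) (hμ0 : ∀ j x, μ (P.cell j x) ≠ 0)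
    (hD : ∀ j x, μ (P.cell j x) ≤ D * μ (P.cell (j + 1) x)) (f : X → ℝ≥0∞) (j : ℕ) (x : X) :
    P.avg μ (j + 1) f x ≤ D * P.avg μ j f x := by
  rw [avg, ENNReal.div_le_iff (hμ0 _ _) (hμ _ _)]
  calc ∫⁻ y in P.cell (j + 1) x, f y ∂μ ≤ ∫⁻ y in P.cell j x, f y ∂μ :=
        lintegral_mono_set (cell_subset_of_le j.le_succ x)
    _ = P.avg μ j f x * μ (P.cell j x) := by rw [avg, ENNReal.div_mul_cancel (hμ0 _ _) (hμ _ _)]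
    _ ≤ P.avg μ j f x * (D * μ (P.cell (j + 1) x)) := by gcongr; exact hD j x
    _ = _ := by ring

/-- When the average first exceeds `t`, that of the parent cell is still at most `t`, and passing to
the child costs the doubling constant. Level `0` has no parent, which is why the bound `h0` is
assumed. -/
lemma stopped_self_le {D : ℝ≥0} (hμ : ∀ j x, μ (P.cell j x) ≠ ∞)
    (hμ0 : ∀ j x, μ (P.cell j x) ≠ 0) (hD1 : 1 ≤ D)
    (hD : ∀ j x, μ (P.cell j x) ≤ D * μ (P.cell (j + 1) x)) (h0 : ∀ x, P.avg μ 0 F x ≤ t)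
    (j : ℕ) (x : X) : P.stopped μ F t F j x ≤ D * t := by
  induction j with
  | zero => exact (h0 x).trans (le_mul_of_one_le_left zero_le (by exact_mod_cast hD1))
  | succ j ih =>
    by_cases hx : x ∈ P.stopSet μ F t j
    · simpa only [stopped_succ_of_mem _ hx] using ih
    · rw [stopped_succ_of_notMem _ hx]
      have : P.avg μ j F x ≤ t := not_lt.1 fun h => hx ⟨j, le_rfl, h⟩
      exact (avg_succ_le hμ hμ0 hD F j x).trans (by gcongr)

/-- The constant in the weak type inequality for the vector-valued maximal function. -/
noncomputable def weakConst (D : ℝ≥0) (q : ℝ) : ℝ≥0 :=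
  1 + (2 ^ q * q / (q - 1)).toNNReal * D ^ (q - 1)

/-- The weak type inequality for the vector-valued maximal function. -/
theorem mul_meas_tsum_maxFn_le [Countable ι] {D : ℝ≥0} (hμ : ∀ j x, μ (P.cell j x) ≠ ∞)
    (hμ0 : ∀ j x, μ (P.cell j x) ≠ 0) (hD1 : 1 ≤ D)
    (hD : ∀ j x, μ (P.cell j x) ≤ D * μ (P.cell (j + 1) x)) {q : ℝ} (hq : 1 < q)
    {f : ℕ → X → ℝ≥0∞} (hf : ∀ l, Measurable (f l)) {t : ℝ≥0∞} (ht0 : t ≠ 0) (htop : t ≠ ∞)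
    (h0 : ∀ x, P.avg μ 0 (seqNorm q f) x ≤ t) :
    t * μ {x | t ^ q < ∑' l, P.maxFn μ (f l) x ^ q} ≤
      weakConst D q * ∫⁻ x, seqNorm q f x ∂μ := by
  have hq0 : 0 < q := by linarith
  set F := seqNorm q f with hF
  -- Only levels up to `L` are used, so that stopping at level `L` defines the functions `G l`. Off
  -- `{MF > t}` they have the same averages as the `f l` at these levels; the exceptional set is
  -- handled by the scalar weak type bound for `F`.
  have hL : ∀ L : ℕ, t * μ {x | t ^ q < ∑' l, P.maxOn μ (Set.Iic L) (f l) x ^ q} ≤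
      weakConst D q * ∫⁻ x, F x ∂μ := by
    intro L
    set G : ℕ → X → ℝ≥0∞ := fun l => P.stopped μ F t (f l) L with hG
    set GF : X → ℝ≥0∞ := P.stopped μ F t F L with hGF
    set B : Set X := {x | t ^ q ≤ ∑' l, P.maxFn μ (G l) x ^ q} with hB
    have hsub : {x | t ^ q < ∑' l, P.maxOn μ (Set.Iic L) (f l) x ^ q} ⊆
        {x | t < P.maxFn μ F x} ∪ B := by
      intro x hx
      by_cases hs : x ∈ P.stopSet μ F t L
      · obtain ⟨i, _, hi⟩ := hs
        exact Or.inl (hi.trans_le (avg_le_maxFn i F x))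
      · refine Or.inr ((le_of_lt hx).trans (ENNReal.tsum_le_tsum fun l => ?_))
        refine ENNReal.rpow_le_rpow (iSup₂_le fun k hk => ?_) hq0.le
        rw [← avg_stopped hμ (f l) hk hs]
        exact avg_le_maxFn k _ x
    have h1 : t * μ {x | t < P.maxFn μ F x} ≤ ∫⁻ x, F x ∂μ :=
      (mul_meas_maxFn_le hμ F t).trans (setLIntegral_le_lintegral _ _)
    have htq0 : t ^ (q - 1) ≠ 0 := by simp [ENNReal.rpow_eq_zero_iff, ht0, htop]
    have htqt : t ^ (q - 1) ≠ ∞ := by simp [ENNReal.rpow_eq_top_iff, ht0, htop]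
    have hsplit : ∀ a : ℝ≥0∞, a ^ q = a ^ (q - 1) * a := fun a => by
      conv_lhs => rw [show q = (q - 1) + 1 by ring]
      rw [ENNReal.rpow_add_of_nonneg _ _ (by linarith) (by norm_num), ENNReal.rpow_one]
    -- Chebyshev and the scalar `L^q` bound for each `G l`. Since the stopped `F` is at most `Dt`,
    -- its `q`-th power is at most `(Dt)^{q-1}` times itself, and its integral is that of `F`; the
    -- factor `t^{q-1}` then cancels.
    have h2 : t ^ (q - 1) * (t * μ B) ≤ t ^ (q - 1) *
        (ENNReal.ofReal (2 ^ q * q / (q - 1)) * (D : ℝ≥0∞) ^ (q - 1) * ∫⁻ x, F x ∂μ) := by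
      calc t ^ (q - 1) * (t * μ B) = t ^ q * μ B := by rw [hsplit t, mul_assoc]
        _ ≤ ∫⁻ x, ∑' l, P.maxFn μ (G l) x ^ q ∂μ :=
            mul_meas_ge_le_lintegral
              (Measurable.tsum fun l => (measurable_maxFn (G l)).pow_const q) _
        _ = ∑' l, ∫⁻ x, P.maxFn μ (G l) x ^ q ∂μ :=
            lintegral_tsum fun l => ((measurable_maxFn (G l)).pow_const q).aemeasurable
        _ ≤ ∑' l, ENNReal.ofReal (2 ^ q * q / (q - 1)) * ∫⁻ x, G l x ^ q ∂μ :=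
            ENNReal.tsum_le_tsum fun l =>
              lintegral_maxFn_rpow_le hμ (measurable_stopped (f l) L) hq
        _ = ENNReal.ofReal (2 ^ q * q / (q - 1)) * ∫⁻ x, ∑' l, G l x ^ q ∂μ := by
            rw [ENNReal.tsum_mul_left, lintegral_tsum fun l =>
              ((measurable_stopped (f l) L).pow_const q).aemeasurable]
        _ ≤ ENNReal.ofReal (2 ^ q * q / (q - 1)) * ∫⁻ x, (D * t) ^ (q - 1) * GF x ∂μ := by
            gcongr with x
            refine (tsum_stopped_rpow_le hq hf L x).trans ?_
            rw [← hF, hsplit]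
            gcongr
            exact stopped_self_le hμ hμ0 hD1 hD h0 L x
        _ = ENNReal.ofReal (2 ^ q * q / (q - 1)) * ((D * t) ^ (q - 1) * ∫⁻ x, F x ∂μ) := by
            rw [lintegral_const_mul _ (measurable_stopped F L), lintegral_stopped hμ]
        _ = _ := by
            rw [ENNReal.mul_rpow_of_nonneg _ _ (by linarith)]; ring
    have h3 := (ENNReal.mul_le_mul_iff_right htq0 htqt).1 h2
    calc t * μ {x | t ^ q < ∑' l, P.maxOn μ (Set.Iic L) (f l) x ^ q}
        ≤ t * (μ {x | t < P.maxFn μ F x} + μ B) := by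
          gcongr; exact (measure_mono hsub).trans (measure_union_le _ _)
      _ = t * μ {x | t < P.maxFn μ F x} + t * μ B := mul_add _ _ _
      _ ≤ _ := add_le_add h1 h3
      _ = weakConst D q * ∫⁻ x, F x ∂μ := by
          rw [weakConst, ENNReal.coe_add, ENNReal.coe_mul, ENNReal.coe_one, add_mul, one_mul,
            ENNReal.coe_rpow_of_nonneg _ (by linarith), ENNReal.ofReal]
  have hU : {x | t ^ q < ∑' l, P.maxFn μ (f l) x ^ q} =
      ⋃ L : ℕ, {x | t ^ q < ∑' l, P.maxOn μ (Set.Iic L) (f l) x ^ q} := by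
    ext x
    simp only [Set.mem_ofPred_eq, Set.mem_iUnion, tsum_maxFn_rpow_eq_iSup hq0, lt_iSup_iff]
  rw [hU, Monotone.measure_iUnion, ENNReal.mul_iSup]
  · exact iSup_le hL
  · intro L L' h x hx
    refine lt_of_lt_of_le hx (ENNReal.tsum_le_tsum fun l => ?_)
    exact ENNReal.rpow_le_rpow (maxOn_mono (Set.Iic_subset_Iic.2 h) _ _) hq0.le

end NestedPartition

/-! ### Sparse domination of the vector-valued maximal function. -/

lemma seqNorm_indicator {X : Type*} {q : ℝ} (hq : 0 < q) (A : Set X) (f : ℕ → X → ℝ≥0∞) :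
    seqNorm q (fun l => A.indicator (f l)) = A.indicator (seqNorm q f) := by
  ext x
  by_cases hx : x ∈ A <;> simp [seqNorm, hx, hq]

namespace NestedPartition

variable {X : Type*} [MeasurableSpace X] {ι : Type*} {P : NestedPartition X ι} {μ : Measure X}

/-- The levels are cut into blocks between consecutive stopping levels. Bounding the maximum over
blocks by the sum of `q`-th powers is what produces a sparse sum of `q`-th powers of averages. -/
lemma maxOn_union_rpow_le {q : ℝ} (s t : Set ℕ) (f : X → ℝ≥0∞) (x : X) :
    P.maxOn μ (s ∪ t) f x ^ q ≤ P.maxOn μ s f x ^ q + P.maxOn μ t f x ^ q := by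
  rw [maxOn, iSup_union]
  rcases le_total (⨆ k ∈ s, P.avg μ k f x) (⨆ k ∈ t, P.avg μ k f x) with h | h
  · rw [sup_eq_right.2 h]; exact le_add_self
  · rw [sup_eq_left.2 h]; exact le_self_add

lemma avg_shift (i j : ℕ) (f : X → ℝ≥0∞) (x : X) :
    (P.shift i).avg μ j f x = P.avg μ (i + j) f x := rfl

lemma avg_indicator_of_subset {j : ℕ} {x : X} {A : Set X} (hA : MeasurableSet A)
    (h : P.cell j x ⊆ A) (f : X → ℝ≥0∞) : P.avg μ j (A.indicator f) x = P.avg μ j f x := by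
  simp only [avg]
  rw [lintegral_indicator hA, Measure.restrict_restrict hA, Set.inter_eq_right.2 h]

lemma one_le_weakConst {D : ℝ≥0} {q : ℝ} : 1 ≤ weakConst D q := le_self_add

/-- The weak type inequality on a single cell: the vector-valued maximal function of the levels
beyond `i` is controlled by the average of the `ℓ^q` norm, except on at most half the cell. -/
lemma meas_cell_inter_le [Countable ι] {D : ℝ≥0} (hμ : ∀ j x, μ (P.cell j x) ≠ ∞)
    (hμ0 : ∀ j x, μ (P.cell j x) ≠ 0) (hD1 : 1 ≤ D)
    (hD : ∀ j x, μ (P.cell j x) ≤ D * μ (P.cell (j + 1) x)) {q : ℝ} (hq : 1 < q)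
    {f : ℕ → X → ℝ≥0∞} (hf : ∀ l, Measurable (f l)) (i : ℕ) (x : X) :
    2 * μ {y ∈ P.cell i x | (2 * weakConst D q * P.avg μ i (seqNorm q f) x) ^ q <
      ∑' l, P.maxOn μ (Set.Ici i) (f l) y ^ q} ≤ μ (P.cell i x) := by
  have hq0 : 0 < q := by linarith
  set a := P.avg μ i (seqNorm q f) x with ha
  set W : ℝ≥0∞ := (weakConst D q : ℝ≥0∞) with hW
  have hW1 : 1 ≤ W := ENNReal.coe_le_coe.2 one_le_weakConst
  have hW0 : W ≠ 0 := (zero_lt_one.trans_le hW1).ne'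
  have hWt : W ≠ ∞ := ENNReal.coe_ne_top
  set Q := P.cell i x with hQ
  have hQm : MeasurableSet Q := measurableSet_cell i x
  -- The weak type inequality needs a threshold in `(0, ∞)`. Infinite and zero averages are
  -- therefore separated: in the first case the threshold is never exceeded, in the second all
  -- relevant averages vanish.
  rcases eq_or_ne a ∞ with hat | hat
  · have : 2 * W * a = ∞ := by rw [hat, ENNReal.mul_top (by simp [hW0])]
    simp [this, hq0]
  have hint : ∫⁻ y in Q, seqNorm q f y ∂μ = a * μ Q := by
    rw [ha, avg, ENNReal.div_mul_cancel (hμ0 _ _) (hμ _ _)]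
  have hcell : ∀ y ∈ Q, ∀ k, i ≤ k → P.cell k y ⊆ Q := fun y hy k hk =>
    (cell_subset_of_le hk y).trans (cell_eq_of_mem hy).le
  rcases eq_or_ne a 0 with ha0 | ha0
  · have hz : ∀ y ∈ Q, ∀ l, ∀ k, i ≤ k → P.avg μ k (f l) y = 0 := by
      intro y hy l k hk
      have : ∫⁻ z in P.cell k y, f l z ∂μ ≤ 0 := by
        calc ∫⁻ z in P.cell k y, f l z ∂μ ≤ ∫⁻ z in Q, f l z ∂μ :=
              lintegral_mono_set (hcell y hy k hk)
          _ ≤ ∫⁻ z in Q, seqNorm q f z ∂μ := lintegral_mono fun z => le_seqNorm hq0 f l z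
          _ = 0 := by rw [hint, ha0, zero_mul]
      rw [avg, nonpos_iff_eq_zero.1 this, ENNReal.zero_div]
    have hempty : {y ∈ Q | (2 * W * a) ^ q < ∑' l, P.maxOn μ (Set.Ici i) (f l) y ^ q} = ∅ := by
      ext y
      simp only [Set.mem_ofPred_eq, Set.mem_empty_iff_false, iff_false, not_and, not_lt]
      intro hy
      have : ∀ l, P.maxOn μ (Set.Ici i) (f l) y = 0 := fun l => by
        simp only [maxOn, ENNReal.iSup_eq_zero]
        exact fun k hk => hz y hy l k hk
      simp [this, hq0]
    rw [hempty]; simp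
  set g : ℕ → X → ℝ≥0∞ := fun l => Q.indicator (f l) with hg
  have hgn : seqNorm q g = Q.indicator (seqNorm q f) := seqNorm_indicator hq0 Q f
  have h0 : ∀ y, (P.shift i).avg μ 0 (seqNorm q g) y ≤ 2 * W * a := by
    intro y
    rw [avg_shift, hgn]
    by_cases hy : y ∈ Q
    · rw [avg_indicator_of_subset hQm (hcell y hy _ (by simp)), add_zero,
        adapted_avg i _ y x hy]
      refine le_mul_of_one_le_left zero_le ?_
      exact one_le_mul (by norm_num) hW1
    · have : ∫⁻ z in P.cell (i + 0) y, Q.indicator (seqNorm q f) z ∂μ = 0 := by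
        rw [lintegral_indicator hQm, Measure.restrict_restrict hQm]
        have : Q ∩ P.cell (i + 0) y = ∅ := by
          ext z
          simp only [Set.mem_inter_iff, Set.mem_empty_iff_false, iff_false, not_and]
          intro hz hz'
          exact hy ((Eq.symm hz').trans hz)
        rw [this, Measure.restrict_empty, lintegral_zero_measure]
      rw [avg, this, ENNReal.zero_div]
      exact zero_le
  -- The threshold `2Wa`, with `W` the weak type constant and `a` the average on `Q`, makes the
  -- bound `W a μ(Q) / (2Wa) = μ(Q)/2`. It also dominates the initial average because `W ≥ 1`.
  have hweak := mul_meas_tsum_maxFn_le (P := P.shift i) (μ := μ) (fun j y => hμ (i + j) y)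
    (fun j y => hμ0 (i + j) y) hD1 (fun j y => hD (i + j) y) hq
    (fun l => (hf l).indicator hQm) (t := 2 * W * a) (by simp [hW0, ha0])
    (ENNReal.mul_ne_top (ENNReal.mul_ne_top (by simp) hWt) hat) h0
  have hsub : {y ∈ Q | (2 * W * a) ^ q < ∑' l, P.maxOn μ (Set.Ici i) (f l) y ^ q} ⊆
      {y | (2 * W * a) ^ q < ∑' l, (P.shift i).maxFn μ (g l) y ^ q} := by
    rintro y ⟨hy, hlt⟩
    refine hlt.trans_le (ENNReal.tsum_le_tsum fun l => ENNReal.rpow_le_rpow ?_ hq0.le)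
    refine iSup₂_le fun k hk => ?_
    obtain ⟨m, rfl⟩ := Nat.exists_eq_add_of_le (Set.mem_Ici.1 hk)
    rw [← avg_indicator_of_subset hQm (hcell y hy _ hk), ← avg_shift]
    exact avg_le_maxFn m _ y
  have h1 : W * a * (2 * μ {y ∈ Q | (2 * W * a) ^ q <
      ∑' l, P.maxOn μ (Set.Ici i) (f l) y ^ q}) ≤ W * a * μ Q := by
    calc _ = 2 * W * a * μ {y ∈ Q | (2 * W * a) ^ q <
          ∑' l, P.maxOn μ (Set.Ici i) (f l) y ^ q} := by ring
      _ ≤ 2 * W * a * μ {y | (2 * W * a) ^ q < ∑' l, (P.shift i).maxFn μ (g l) y ^ q} := by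
          gcongr
      _ ≤ W * ∫⁻ y, seqNorm q g y ∂μ := hweak
      _ = W * a * μ Q := by rw [hgn, lintegral_indicator hQm, hint, mul_assoc]
  exact (ENNReal.mul_le_mul_iff_right (mul_ne_zero hW0 ha0) (ENNReal.mul_ne_top hWt hat)).1 h1

open Classical in
/-- The last stopping level not exceeding `j`: a new stopping level is declared when the
vector-valued maximal function since the previous one exceeds `K` times the average of the
`ℓ^q` norm. -/
noncomputable def lead (P : NestedPartition X ι) (μ : Measure X) (q : ℝ) (K : ℝ≥0∞)
    (f : ℕ → X → ℝ≥0∞) : ℕ → X → ℕ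
  | 0, _ => 0
  | j + 1, x =>
    if (K * P.avg μ (P.lead μ q K f j x) (seqNorm q f) x) ^ q <
      ∑' l, P.maxOn μ (Set.Icc (P.lead μ q K f j x) (j + 1)) (f l) x ^ q
    then j + 1 else P.lead μ q K f j x

variable {q : ℝ} {K : ℝ≥0∞} {f : ℕ → X → ℝ≥0∞}

lemma lead_succ_or (j : ℕ) (x : X) :
    (P.lead μ q K f (j + 1) x = j + 1 ∧
      (K * P.avg μ (P.lead μ q K f j x) (seqNorm q f) x) ^ q <
        ∑' l, P.maxOn μ (Set.Icc (P.lead μ q K f j x) (j + 1)) (f l) x ^ q) ∨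
    (P.lead μ q K f (j + 1) x = P.lead μ q K f j x ∧
      ∑' l, P.maxOn μ (Set.Icc (P.lead μ q K f j x) (j + 1)) (f l) x ^ q ≤
        (K * P.avg μ (P.lead μ q K f j x) (seqNorm q f) x) ^ q) := by
  rw [lead]
  split_ifs with h
  · exact Or.inl ⟨rfl, h⟩
  · exact Or.inr ⟨rfl, not_lt.1 h⟩

lemma lead_le (j : ℕ) (x : X) : P.lead μ q K f j x ≤ j := by
  induction j with
  | zero => exact le_rfl
  | succ j ih =>
    rcases lead_succ_or (P := P) (μ := μ) (q := q) (K := K) (f := f) j x with h | h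
    · exact h.1.le
    · rw [h.1]; exact ih.trans j.le_succ

lemma adapted_lead (j : ℕ) : P.Adapted j (P.lead μ q K f j) := by
  induction j with
  | zero => exact fun _ _ _ => rfl
  | succ j ih =>
    intro x y hxy
    have h1 := ih x y (P.idx_eq_of_succ _ _ _ hxy)
    have h2 : P.avg μ (P.lead μ q K f j y) (seqNorm q f) x =
        P.avg μ (P.lead μ q K f j y) (seqNorm q f) y :=
      (adapted_avg _ _).mono ((lead_le j y).trans j.le_succ) x y hxy
    have h3 : ∀ l, P.maxOn μ (Set.Icc (P.lead μ q K f j y) (j + 1)) (f l) x =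
        P.maxOn μ (Set.Icc (P.lead μ q K f j y) (j + 1)) (f l) y :=
      fun l => adapted_maxOn (fun k hk => hk.2) (f l) x y hxy
    simp only [lead, h1, h2, h3]

/-- The union of the stopping cells of level `j`. -/
def leadSet (P : NestedPartition X ι) (μ : Measure X) (q : ℝ) (K : ℝ≥0∞) (f : ℕ → X → ℝ≥0∞)
    (j : ℕ) : Set X := {x | P.lead μ q K f j x = j}

lemma adaptedSet_leadSet (j : ℕ) : P.AdaptedSet j (P.leadSet μ q K f j) :=
  (adapted_lead j).setOf (· = j)

lemma mem_leadSet_lead (j : ℕ) (x : X) : x ∈ P.leadSet μ q K f (P.lead μ q K f j x) := by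
  induction j with
  | zero => rfl
  | succ j ih =>
    rcases lead_succ_or (P := P) (μ := μ) (q := q) (K := K) (f := f) j x with h | h
    · rw [h.1]; exact h.1
    · rw [h.1]; exact ih

lemma maxOn_singleton (j : ℕ) (g : X → ℝ≥0∞) (x : X) : P.maxOn μ {j} g x = P.avg μ j g x := by
  simp [maxOn]

/-- Either no stop was declared at the last level, and this is the negation of the stopping
criterion, or one was, and the block is a single level, where Minkowski's inequality and `K ≥ 1`
suffice. -/
lemma tsum_maxOn_lead_le (hq : 1 < q) (hK : 1 ≤ K) (hf : ∀ l, Measurable (f l)) (j : ℕ) (x : X) :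
    ∑' l, P.maxOn μ (Set.Icc (P.lead μ q K f j x) j) (f l) x ^ q ≤
      (K * P.avg μ (P.lead μ q K f j x) (seqNorm q f) x) ^ q := by
  have hself : ∀ i, ∑' l, P.maxOn μ (Set.Icc i i) (f l) x ^ q ≤
      (K * P.avg μ i (seqNorm q f) x) ^ q := by
    intro i
    simp only [Set.Icc_self, maxOn_singleton]
    refine (tsum_avg_rpow_le hq hf i x).trans (ENNReal.rpow_le_rpow ?_ (by linarith))
    exact le_mul_of_one_le_left zero_le hK
  cases j with
  | zero => exact hself 0
  | succ j =>
    rcases lead_succ_or (P := P) (μ := μ) (q := q) (K := K) (f := f) j x with h | h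
    · rw [h.1]; exact hself _
    · rw [h.1]; exact h.2

/-- Each new stop closes the block opened by the previous one. That block ends one level before the
criterion was met, so it contributes at most the term of the stopping cell that opened it. -/
lemma tsum_maxOn_Iio_lead_le (hq : 1 < q) (hK : 1 ≤ K) (hf : ∀ l, Measurable (f l)) (j : ℕ)
    (x : X) :
    ∑' l, P.maxOn μ (Set.Iio (P.lead μ q K f j x)) (f l) x ^ q ≤
      K ^ q * ∑ i ∈ Finset.range (P.lead μ q K f j x), (P.leadSet μ q K f i).indicator
        (fun y => P.avg μ i (seqNorm q f) y ^ q) x := by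
  have hq0 : 0 < q := by linarith
  induction j with
  | zero => simp [lead, maxOn, hq0]
  | succ j ih =>
    rcases lead_succ_or (P := P) (μ := μ) (q := q) (K := K) (f := f) j x with h | h
    · rw [h.1]
      set m := P.lead μ q K f j x with hm
      have hmj : m ≤ j := lead_le j x
      have hU : Set.Iio (j + 1) = Set.Iio m ∪ Set.Icc m j := by
        ext k; simp only [Set.mem_Iio, Set.mem_union, Set.mem_Icc]; omega
      calc ∑' l, P.maxOn μ (Set.Iio (j + 1)) (f l) x ^ q
          ≤ ∑' l, (P.maxOn μ (Set.Iio m) (f l) x ^ q + P.maxOn μ (Set.Icc m j) (f l) x ^ q) := by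
            rw [hU]; exact ENNReal.tsum_le_tsum fun l => maxOn_union_rpow_le _ _ _ _
        _ = ∑' l, P.maxOn μ (Set.Iio m) (f l) x ^ q +
              ∑' l, P.maxOn μ (Set.Icc m j) (f l) x ^ q := ENNReal.tsum_add
        _ ≤ _ := add_le_add ih (tsum_maxOn_lead_le hq hK hf j x)
        _ = K ^ q * ∑ i ∈ Finset.range (m + 1), (P.leadSet μ q K f i).indicator
              (fun y => P.avg μ i (seqNorm q f) y ^ q) x := by
            rw [Finset.sum_range_succ, mul_add, Set.indicator_of_mem (mem_leadSet_lead j x),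
              ENNReal.mul_rpow_of_nonneg _ _ hq0.le]
        _ ≤ _ := by
            gcongr
    · rw [h.1]; exact ih

/-- Pointwise domination of the vector-valued maximal function by the sum over the stopping
cells. -/
lemma tsum_maxFn_le_tsum_leadSet (hq : 1 < q) (hK : 1 ≤ K) (hf : ∀ l, Measurable (f l)) (x : X) :
    ∑' l, P.maxFn μ (f l) x ^ q ≤ K ^ q * ∑' i, (P.leadSet μ q K f i).indicator
      (fun y => P.avg μ i (seqNorm q f) y ^ q) x := by
  have hq0 : 0 < q := by linarith
  rw [tsum_maxFn_rpow_eq_iSup hq0]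
  refine iSup_le fun j => ?_
  set m := P.lead μ q K f j x with hm
  have hmj : m ≤ j := lead_le j x
  have hU : Set.Iic j = Set.Iio m ∪ Set.Icc m j := by
    ext k; simp only [Set.mem_Iio, Set.mem_union, Set.mem_Icc, Set.mem_Iic]; omega
  calc ∑' l, P.maxOn μ (Set.Iic j) (f l) x ^ q
      ≤ ∑' l, (P.maxOn μ (Set.Iio m) (f l) x ^ q + P.maxOn μ (Set.Icc m j) (f l) x ^ q) := by
        rw [hU]; exact ENNReal.tsum_le_tsum fun l => maxOn_union_rpow_le _ _ _ _
    _ = ∑' l, P.maxOn μ (Set.Iio m) (f l) x ^ q +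
          ∑' l, P.maxOn μ (Set.Icc m j) (f l) x ^ q := ENNReal.tsum_add
    _ ≤ _ := add_le_add (tsum_maxOn_Iio_lead_le hq hK hf j x) (tsum_maxOn_lead_le hq hK hf j x)
    _ = K ^ q * ∑ i ∈ Finset.range (m + 1), (P.leadSet μ q K f i).indicator
          (fun y => P.avg μ i (seqNorm q f) y ^ q) x := by
        rw [Finset.sum_range_succ, mul_add, Set.indicator_of_mem (mem_leadSet_lead j x),
          ENNReal.mul_rpow_of_nonneg _ _ hq0.le]
    _ ≤ _ := by
        gcongr
        exact ENNReal.sum_le_tsum _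

/-- This carries sparsity: a later stop inside a stopping cell forces the point into the exceptional
set of that cell, which `meas_cell_inter_le` bounds by half the cell. -/
lemma lead_eq_or_lt (hq : 0 < q) {j : ℕ} {x : X} (hx : x ∈ P.leadSet μ q K f j) {k : ℕ}
    (hk : j ≤ k) :
    P.lead μ q K f k x = j ∨ (K * P.avg μ j (seqNorm q f) x) ^ q <
      ∑' l, P.maxOn μ (Set.Ici j) (f l) x ^ q := by
  induction k, hk using Nat.le_induction with
  | base => exact Or.inl hx
  | succ k _ ih =>
    rcases ih with ih | ih
    · rcases lead_succ_or (P := P) (μ := μ) (q := q) (K := K) (f := f) k x with h | h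
      · rw [ih] at h
        refine Or.inr (h.2.trans_le (ENNReal.tsum_le_tsum fun l => ?_))
        exact ENNReal.rpow_le_rpow (maxOn_mono (fun m hm => hm.1) _ _) hq.le
      · exact Or.inl (h.1.trans ih)
    · exact Or.inr ih

/-- A family of cells, given by the unions `S j` of its cells of level `j`, is sparse if each
of its cells is at most half covered by the smaller ones. -/
structure IsSparse (P : NestedPartition X ι) (μ : Measure X) (S : ℕ → Set X) : Prop where
  adapted : ∀ j, P.AdaptedSet j (S j)
  le_two_mul : ∀ j, ∀ x ∈ S j, μ (P.cell j x) ≤ 2 * μ (P.cell j x \ ⋃ k > j, S k)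

/-- The vector-valued maximal function is dominated by a sparse operator. -/
theorem exists_isSparse [Countable ι] {D : ℝ≥0} (hμ : ∀ j x, μ (P.cell j x) ≠ ∞)
    (hμ0 : ∀ j x, μ (P.cell j x) ≠ 0) (hD1 : 1 ≤ D)
    (hD : ∀ j x, μ (P.cell j x) ≤ D * μ (P.cell (j + 1) x)) (hq : 1 < q)
    (hf : ∀ l, Measurable (f l)) :
    ∃ S : ℕ → Set X, P.IsSparse μ S ∧ ∀ x, ∑' l, P.maxFn μ (f l) x ^ q ≤
      (2 * weakConst D q) ^ q * ∑' i, (S i).indicator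
        (fun y => P.avg μ i (seqNorm q f) y ^ q) x := by
  set K : ℝ≥0∞ := 2 * weakConst D q with hKdef
  have hK : 1 ≤ K := one_le_mul (by norm_num) (by exact_mod_cast one_le_weakConst)
  refine ⟨P.leadSet μ q K f, ⟨adaptedSet_leadSet, fun j x hx => ?_⟩,
    fun x => tsum_maxFn_le_tsum_leadSet hq hK hf x⟩
  set Q := P.cell j x with hQ
  set U := ⋃ k > j, P.leadSet μ q K f k with hU
  have hUm : MeasurableSet U := MeasurableSet.iUnion fun k => MeasurableSet.iUnion fun _ =>
    (adaptedSet_leadSet k).measurableSet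
  have hbad : Q ∩ U ⊆ {y ∈ Q | (K * P.avg μ j (seqNorm q f) x) ^ q <
      ∑' l, P.maxOn μ (Set.Ici j) (f l) y ^ q} := by
    rintro y ⟨hy, hyU⟩
    refine ⟨hy, ?_⟩
    simp only [hU, Set.mem_iUnion] at hyU
    obtain ⟨k, hk, hyk⟩ := hyU
    have hyj : y ∈ P.leadSet μ q K f j := adaptedSet_leadSet j x y (Eq.symm hy) hx
    rcases lead_eq_or_lt (by linarith) hyj (le_of_lt hk) with h | h
    · have : P.lead μ q K f k y = k := hyk
      omega
    · rwa [adapted_avg j _ y x hy] at h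
  have h2 : 2 * μ (Q ∩ U) ≤ μ Q :=
    le_trans (by gcongr) (meas_cell_inter_le hμ hμ0 hD1 hD hq hf j x)
  have h3 : μ (Q ∩ U) + μ (Q \ U) = μ Q := measure_inter_add_sdiff Q hUm
  have h4 : μ Q + μ Q ≤ μ Q + 2 * μ (Q \ U) := by
    calc μ Q + μ Q = 2 * μ (Q ∩ U) + 2 * μ (Q \ U) := by rw [← two_mul, ← mul_add, h3]
      _ ≤ _ := by gcongr
  exact (ENNReal.add_le_add_iff_left (hμ j x)).1 h4

end NestedPartition

/-! ### Hölder inequalities for weights, duality and the local `A_p` estimate. -/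

/-- Hölder's inequality for `1 = (u v^κ)^{1/(1+κ)}`. -/
lemma measure_univ_rpow_le {X : Type*} [MeasurableSpace X] {ν : Measure X} {u v : X → ℝ≥0∞}
    (hu : Measurable u) (hv : Measurable v) {κ : ℝ} (hκ : 0 ≤ κ)
    (huv : ∀ᵐ x ∂ν, u x * v x ^ κ = 1) :
    ν Set.univ ^ (1 + κ) ≤ (∫⁻ x, u x ∂ν) * (∫⁻ x, v x ∂ν) ^ κ := by
  have h1 : (0 : ℝ) < 1 + κ := by linarith
  have h2 : ν Set.univ ≤ (∫⁻ x, u x ∂ν) ^ (1 / (1 + κ)) * (∫⁻ x, v x ∂ν) ^ (κ / (1 + κ)) := by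
    calc ν Set.univ = ∫⁻ _, 1 ∂ν := by simp
      _ = ∫⁻ x, u x ^ (1 / (1 + κ)) * v x ^ (κ / (1 + κ)) ∂ν := by
          refine lintegral_congr_ae ?_
          filter_upwards [huv] with x hx
          rw [div_eq_mul_one_div κ, ENNReal.rpow_mul,
            ← ENNReal.mul_rpow_of_nonneg _ _ (by positivity), hx, ENNReal.one_rpow]
      _ ≤ _ := ENNReal.lintegral_mul_norm_pow_le hu.aemeasurable hv.aemeasurable
          (by positivity) (by positivity) (by field_simp)
  calc ν Set.univ ^ (1 + κ)
      ≤ ((∫⁻ x, u x ∂ν) ^ (1 / (1 + κ)) * (∫⁻ x, v x ∂ν) ^ (κ / (1 + κ))) ^ (1 + κ) :=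
        ENNReal.rpow_le_rpow h2 h1.le
    _ = _ := by
        rw [ENNReal.mul_rpow_of_nonneg _ _ h1.le, ← ENNReal.rpow_mul, ← ENNReal.rpow_mul,
          one_div_mul_cancel h1.ne', div_mul_cancel₀ _ h1.ne', ENNReal.rpow_one]

/-- Duality: a bound for all pairings against `L^{r'}` bounds the `L^r` norm. -/
lemma lintegral_rpow_le_of_forall_mul {X : Type*} [MeasurableSpace X] {ν : Measure X}
    [SigmaFinite ν] {h : X → ℝ≥0∞} (hh : Measurable h) {r : ℝ} (hr : 1 < r) {B : ℝ≥0∞}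
    (H : ∀ g : X → ℝ≥0∞, Measurable g →
      ∫⁻ x, h x * g x ∂ν ≤ B * (∫⁻ x, g x ^ (r / (r - 1)) ∂ν) ^ (1 - 1 / r)) :
    ∫⁻ x, h x ^ r ∂ν ≤ B ^ r := by
  have hr0 : 0 < r := by linarith
  have hr1 : 0 < r - 1 := by linarith
  -- Testing against `h^{r-1}` itself could involve infinite integrals. Bounded truncations on sets
  -- of finite measure have finite norm, so the self-improvement applies to each of them.
  set g : ℕ → X → ℝ≥0∞ := fun n => (spanningSets ν n).indicator fun x => min (h x) n with hg
  have hS : ∀ n, MeasurableSet (spanningSets ν n) := measurableSet_spanningSets ν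
  have hgm : ∀ n, Measurable (g n) := fun n => (hh.min measurable_const).indicator (hS n)
  have hgle : ∀ n x, g n x ≤ h x := fun n x =>
    Set.indicator_le' (fun x _ => min_le_left _ _) (fun _ _ => zero_le) x
  have hgsup : ∀ x, ⨆ n, g n x = h x := by
    intro x
    refine le_antisymm (iSup_le fun n => hgle n x) ?_
    have hx : x ∈ ⋃ n, spanningSets ν n := by rw [iUnion_spanningSets]; trivial
    obtain ⟨N, hN⟩ := Set.mem_iUnion.1 hx
    have : h x = ⨆ n : ℕ, min (h x) n := by rw [← inf_iSup_eq, ENNReal.iSup_natCast, inf_top_eq]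
    rw [this]
    refine iSup_le fun n => ?_
    refine le_iSup_of_le (max n N) ?_
    have hmem : x ∈ spanningSets ν (max n N) := monotone_spanningSets ν (le_max_right n N) hN
    simp only [hg, Set.indicator_of_mem hmem]
    gcongr
    exact_mod_cast le_max_left n N
  have hgmono : Monotone g := by
    intro m n hmn x
    simp only [hg]
    by_cases hx : x ∈ spanningSets ν m
    · rw [Set.indicator_of_mem hx, Set.indicator_of_mem (monotone_spanningSets ν hmn hx)]
      gcongr
    · rw [Set.indicator_of_notMem hx]; exact zero_le
  have hfin : ∀ n, ∫⁻ x, g n x ^ r ∂ν ≠ ∞ := by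
    intro n
    have h1 : ∀ x, g n x ^ r ≤ (spanningSets ν n).indicator (fun _ => (n : ℝ≥0∞) ^ r) x := by
      intro x
      by_cases hx : x ∈ spanningSets ν n
      · simp only [hg, Set.indicator_of_mem hx]
        exact ENNReal.rpow_le_rpow (min_le_right _ _) hr0.le
      · simp [hg, hx, hr0]
    refine ne_top_of_le_ne_top ?_ (lintegral_mono h1)
    rw [lintegral_indicator (hS n), setLIntegral_const]
    exact ENNReal.mul_ne_top (ENNReal.rpow_ne_top_of_nonneg hr0.le (by simp))
      (measure_spanningSets_lt_top ν n).ne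
  have hmain : ∀ n, ∫⁻ x, g n x ^ r ∂ν ≤ B ^ r := by
    intro n
    refine ENNReal.le_rpow_of_le_rpow_mul hr.le (hfin n) ?_
    calc ∫⁻ x, g n x ^ r ∂ν ≤ ∫⁻ x, h x * g n x ^ (r - 1) ∂ν := by
          refine lintegral_mono fun x => ?_
          conv_lhs => rw [show r = 1 + (r - 1) by ring]
          rw [ENNReal.rpow_add_of_nonneg _ _ (by norm_num) hr1.le, ENNReal.rpow_one]
          gcongr
          exact hgle n x
      _ ≤ _ := H _ ((hgm n).pow_const _)
      _ = _ := by
          rw [mul_comm]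
          congr 3
          ext x
          rw [← ENNReal.rpow_mul]
          congr 1
          field_simp
  calc ∫⁻ x, h x ^ r ∂ν = ∫⁻ x, ⨆ n, g n x ^ r ∂ν := by
        simp_rw [← ENNReal.iSup_rpow _ hr0, hgsup]
    _ = ⨆ n, ∫⁻ x, g n x ^ r ∂ν := lintegral_iSup (fun n => (hgm n).pow_const r)
        fun m n hmn x => ENNReal.rpow_le_rpow (hgmono hmn x) hr0.le
    _ ≤ B ^ r := iSup_le hmain

lemma ENNReal.rpow_ne_zero_of_ne {a : ℝ≥0∞} (h0 : a ≠ 0) (ht : a ≠ ∞) (r : ℝ) : a ^ r ≠ 0 := by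
  simp [ENNReal.rpow_eq_zero_iff, h0, ht]

lemma ENNReal.rpow_ne_top_of_ne {a : ℝ≥0∞} (h0 : a ≠ 0) (ht : a ≠ ∞) (r : ℝ) : a ^ r ≠ ∞ := by
  simp [ENNReal.rpow_eq_top_iff, h0, ht]

/-- If `w = σ^{-(p-1)}`, powers of `w` and `σ` with cancelling exponents multiply to `1`. -/
lemma rpow_mul_rpow_mul_eq_one {a b : ℝ≥0∞} {p : ℝ} (h : a * b ^ (p - 1) = 1) {x y : ℝ}
    (hxy : x = (p - 1) * y) : b ^ x * a ^ y = 1 := by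
  have ha0 : a ≠ 0 := by rintro rfl; simp at h
  have hb0 : b ^ (p - 1) ≠ 0 := by intro h'; simp [h'] at h
  have hat : a ≠ ∞ := by rintro rfl; simp [ENNReal.top_mul hb0] at h
  have : b ^ (p - 1) = a⁻¹ := by
    rw [← one_div, ENNReal.eq_div_iff ha0 hat]; exact h
  rw [hxy, ENNReal.rpow_mul, this, ENNReal.inv_rpow, ENNReal.inv_mul_cancel
    (ENNReal.rpow_ne_zero_of_ne ha0 hat _) (ENNReal.rpow_ne_top_of_ne ha0 hat _)]

lemma ne_zero_top_of_mul_rpow_eq_one {a b : ℝ≥0∞} {r : ℝ} (hr : 0 < r) (h : a * b ^ r = 1) :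
    a ≠ 0 ∧ a ≠ ∞ ∧ b ≠ 0 ∧ b ≠ ∞ := by
  have ha0 : a ≠ 0 := by rintro rfl; simp at h
  have hb0 : b ≠ 0 := by rintro rfl; simp [hr] at h
  have hat : a ≠ ∞ := by
    rintro rfl
    rw [ENNReal.top_mul (by simp [ENNReal.rpow_eq_zero_iff, hb0, hr.not_gt])] at h
    simp at h
  refine ⟨ha0, hat, hb0, ?_⟩
  rintro rfl
  simp [hr, ENNReal.mul_top ha0] at h

/-- The local estimate behind the sharp dependence on the `A_p` constant: for a set `Q` and a
major subset `E`, the `A_p` condition on `Q` bounds `σ(Q)^s w(Q)` by an integral over `E`. -/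
lemma rpow_mul_le_of_major_subset {X : Type*} [MeasurableSpace X] {μ : Measure X}
    {w σ : X → ℝ≥0∞} (hw : Measurable w) (hσ : Measurable σ) {p s : ℝ} (hp : 1 < p) (hs : 0 < s)
    (hsp : s ≤ p) (hwσ : ∀ᵐ x ∂μ, w x * σ x ^ (p - 1) = 1) {A : ℝ≥0∞} {Q E : Set X}
    (hEQ : E ⊆ Q) (hQE : μ Q ≤ 2 * μ E) (hQ0 : μ Q ≠ 0) (hQt : μ Q ≠ ∞)
    (hwQ : ∫⁻ x in Q, w x ∂μ ≠ ∞) (hσQ : ∫⁻ x in Q, σ x ∂μ ≠ ∞)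
    (hA : (∫⁻ x in Q, w x ∂μ) * (∫⁻ x in Q, σ x ∂μ) ^ (p - 1) ≤ A * μ Q ^ p) :
    (∫⁻ x in Q, σ x ∂μ) ^ s * ∫⁻ x in Q, w x ∂μ ≤
      2 ^ (p + s / (p - 1)) * A ^ max 1 (s / (p - 1)) * μ Q ^ s *
        ∫⁻ x in E, σ x ^ (s / p) * w x ^ (1 - s / p) ∂μ := by
  have hp1 : 0 < p - 1 := by linarith
  have hp0 : 0 < p := by linarith
  set S := ∫⁻ x in Q, σ x ∂μ with hS
  set W := ∫⁻ x in Q, w x ∂μ with hW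
  set u : X → ℝ≥0∞ := fun x => σ x ^ (s / p) * w x ^ (1 - s / p) with hu
  have hum : Measurable u := (hσ.pow_const _).mul (hw.pow_const _)
  have hS0 : S ≠ 0 := by
    intro h0
    rw [hS, lintegral_eq_zero_iff hσ] at h0
    refine hQ0 (Measure.restrict_eq_zero.1 (ae_eq_bot.1 ?_))
    rw [← Filter.eventually_false_iff_eq_bot]
    filter_upwards [h0, ae_restrict_of_ae hwσ] with x hx hx'
    exact (ne_zero_top_of_mul_rpow_eq_one hp1 hx').2.2.1 hx
  have hW0 : W ≠ 0 := by
    intro h0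
    rw [hW, lintegral_eq_zero_iff hw] at h0
    refine hQ0 (Measure.restrict_eq_zero.1 (ae_eq_bot.1 ?_))
    rw [← Filter.eventually_false_iff_eq_bot]
    filter_upwards [h0, ae_restrict_of_ae hwσ] with x hx hx'
    exact (ne_zero_top_of_mul_rpow_eq_one hp1 hx').1 hx
  have huniv : ∀ T : Set X, (μ.restrict T) Set.univ = μ T := fun T => by simp
  -- For `s ≤ p - 1` the density `u` is paired with `σ`: since `u σ^{p-1-s} = 1`, Hölder gives
  -- `μ(E)^{p-s} ≤ (∫_E u) σ(Q)^{p-1-s}`, and the `A_p` condition enters to the first power. The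
  -- factor `2^{p + s/(p-1)}` is large enough for both cases.
  rcases le_total s (p - 1) with hcase | hcase
  · set κ := p - 1 - s with hκ
    have hκ0 : 0 ≤ κ := by linarith
    have hH := measure_univ_rpow_le (ν := μ.restrict E) hum hσ hκ0 (by
      filter_upwards [ae_restrict_of_ae hwσ] with x hx
      obtain ⟨_, _, hb0, hbt⟩ := ne_zero_top_of_mul_rpow_eq_one hp1 hx
      rw [hu]
      simp only
      rw [mul_right_comm, ← ENNReal.rpow_add _ _ hb0 hbt]
      refine rpow_mul_rpow_mul_eq_one hx ?_
      rw [hκ]; field_simp; ring)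
    rw [huniv] at hH
    have hH' : μ E ^ (p - s) ≤ (∫⁻ x in E, u x ∂μ) * S ^ κ := by
      calc μ E ^ (p - s) = μ E ^ (1 + κ) := by congr 1; rw [hκ]; ring
        _ ≤ (∫⁻ x in E, u x ∂μ) * (∫⁻ x in E, σ x ∂μ) ^ κ := hH
        _ ≤ _ := by gcongr; exact lintegral_mono_set hEQ
    have hmax : max 1 (s / (p - 1)) = 1 := max_eq_left ((div_le_one hp1).2 hcase)
    rw [hmax, ENNReal.rpow_one]
    refine (ENNReal.mul_le_mul_iff_right (ENNReal.rpow_ne_zero_of_ne hS0 hσQ κ)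
      (ENNReal.rpow_ne_top_of_ne hS0 hσQ κ)).1 ?_
    calc S ^ κ * (S ^ s * W) = W * S ^ (p - 1) := by
          rw [← mul_assoc, ← ENNReal.rpow_add _ _ hS0 hσQ, mul_comm, hκ]
          congr 2; ring
      _ ≤ A * μ Q ^ p := hA
      _ = A * (μ Q ^ s * μ Q ^ (p - s)) := by
          rw [← ENNReal.rpow_add _ _ hQ0 hQt]; congr 2; ring
      _ ≤ A * (μ Q ^ s * (2 * μ E) ^ (p - s)) := by gcongr
      _ = A * (μ Q ^ s * (2 ^ (p - s) * μ E ^ (p - s))) := by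
          rw [ENNReal.mul_rpow_of_nonneg _ _ (by linarith)]
      _ ≤ A * (μ Q ^ s * (2 ^ (p + s / (p - 1)) * ((∫⁻ x in E, u x ∂μ) * S ^ κ))) := by
          gcongr
          · norm_num
          · have : 0 < s / (p - 1) := by positivity
            linarith
      _ = _ := by ring
  -- For `s ≥ p - 1` the density `u` is paired with `w`, with `κ` chosen so that `u w^κ = 1`. The
  -- `A_p` condition is now raised to the power `s/(p-1)` to produce `σ(Q)^s`, which leaves a
  -- surplus `w(Q)^κ` to be divided out.
  · set κ := (s + 1 - p) / (p - 1) with hκ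
    have hκ0 : 0 ≤ κ := div_nonneg (by linarith) hp1.le
    have hH := measure_univ_rpow_le (ν := μ.restrict E) hum hw hκ0 (by
      filter_upwards [ae_restrict_of_ae hwσ] with x hx
      obtain ⟨ha0, hat, _, _⟩ := ne_zero_top_of_mul_rpow_eq_one hp1 hx
      rw [hu]
      simp only
      rw [mul_assoc, ← ENNReal.rpow_add _ _ ha0 hat]
      refine rpow_mul_rpow_mul_eq_one hx ?_
      rw [hκ]; field_simp; ring)
    rw [huniv] at hH
    have h1κ : 1 + κ = s / (p - 1) := by rw [hκ]; field_simp; ring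
    have hH' : μ E ^ (s / (p - 1)) ≤ (∫⁻ x in E, u x ∂μ) * W ^ κ := by
      rw [← h1κ]
      refine hH.trans ?_
      gcongr
      exact lintegral_mono_set hEQ
    have hmax : max 1 (s / (p - 1)) = s / (p - 1) := max_eq_right ((one_le_div hp1).2 hcase)
    have hsp0 : 0 < s / (p - 1) := by positivity
    rw [hmax]
    refine (ENNReal.mul_le_mul_iff_right (ENNReal.rpow_ne_zero_of_ne hW0 hwQ κ)
      (ENNReal.rpow_ne_top_of_ne hW0 hwQ κ)).1 ?_
    calc W ^ κ * (S ^ s * W) = (W * S ^ (p - 1)) ^ (s / (p - 1)) := by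
          rw [ENNReal.mul_rpow_of_nonneg _ _ hsp0.le, ← ENNReal.rpow_mul, ← h1κ,
            ENNReal.rpow_add _ _ hW0 hwQ, ENNReal.rpow_one, h1κ, mul_div_cancel₀ _ hp1.ne']
          ring
      _ ≤ (A * μ Q ^ p) ^ (s / (p - 1)) := ENNReal.rpow_le_rpow hA hsp0.le
      _ = A ^ (s / (p - 1)) * (μ Q ^ s * μ Q ^ (s / (p - 1))) := by
          rw [ENNReal.mul_rpow_of_nonneg _ _ hsp0.le, ← ENNReal.rpow_mul,
            ← ENNReal.rpow_add _ _ hQ0 hQt]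
          congr 2
          field_simp
          ring
      _ ≤ A ^ (s / (p - 1)) * (μ Q ^ s * (2 * μ E) ^ (s / (p - 1))) := by gcongr
      _ = A ^ (s / (p - 1)) * (μ Q ^ s * (2 ^ (s / (p - 1)) * μ E ^ (s / (p - 1)))) := by
          rw [ENNReal.mul_rpow_of_nonneg _ _ hsp0.le]
      _ ≤ A ^ (s / (p - 1)) * (μ Q ^ s * (2 ^ (p + s / (p - 1)) *
            ((∫⁻ x in E, u x ∂μ) * W ^ κ))) := by
          gcongr
          · norm_num
          · linarith
      _ = _ := by ring

/-! ### Sharp weighted bounds for sparse operators. -/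

namespace NestedPartition

variable {X : Type*} [MeasurableSpace X] {ι : Type*} {P : NestedPartition X ι} {μ : Measure X}

/-- A weight `w` with dual weight `σ = w^{1-p'}` satisfying the `A_p` condition with constant `A`
on all cells. -/
structure ApPair (P : NestedPartition X ι) (μ : Measure X) (p : ℝ) (A : ℝ≥0∞)
    (w σ : X → ℝ≥0∞) : Prop where
  measurable_weight : Measurable w
  measurable_dual : Measurable σ
  mul_rpow_eq_one : ∀ᵐ x ∂μ, w x * σ x ^ (p - 1) = 1
  weight_ne_top : ∀ j x, ∫⁻ y in P.cell j x, w y ∂μ ≠ ∞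
  dual_ne_top : ∀ j x, ∫⁻ y in P.cell j x, σ y ∂μ ≠ ∞
  le : ∀ j x, (∫⁻ y in P.cell j x, w y ∂μ) * (∫⁻ y in P.cell j x, σ y ∂μ) ^ (p - 1) ≤
    A * μ (P.cell j x) ^ p

lemma withDensity_cell (u : X → ℝ≥0∞) (j : ℕ) (x : X) :
    (μ.withDensity u) (P.cell j x) = ∫⁻ y in P.cell j x, u y ∂μ :=
  withDensity_apply _ (measurableSet_cell j x)

lemma setLIntegral_mul_le_avg {u g : X → ℝ≥0∞} (hu : Measurable u) (hg : Measurable g)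
    (hfin : ∀ j x, ∫⁻ y in P.cell j x, u y ∂μ ≠ ∞) (j : ℕ) (x : X) :
    ∫⁻ y in P.cell j x, g y * u y ∂μ =
      P.avg (μ.withDensity u) j g x * ∫⁻ y in P.cell j x, u y ∂μ := by
  have h1 : ∫⁻ y in P.cell j x, g y * u y ∂μ = ∫⁻ y in P.cell j x, g y ∂(μ.withDensity u) := by
    rw [setLIntegral_withDensity_eq_setLIntegral_mul _ hu hg (measurableSet_cell j x)]
    simp only [Pi.mul_apply, mul_comm]
  rw [avg, withDensity_cell, h1]
  rcases eq_or_ne (∫⁻ y in P.cell j x, u y ∂μ) 0 with h0 | h0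
  · rw [h0, mul_zero]
    refine setLIntegral_measure_zero _ _ ?_
    rw [withDensity_cell, h0]
  · rw [ENNReal.div_mul_cancel h0 (hfin j x)]

/-- The bilinear form estimate for a sparse operator in terms of maximal functions. -/
lemma tsum_sparse_le [Countable ι] {p s : ℝ} (hp : 1 < p) (hs : 0 < s) (hsp : s ≤ p)
    (hμ : ∀ j x, μ (P.cell j x) ≠ ∞) (hμ0 : ∀ j x, μ (P.cell j x) ≠ 0)
    {A : ℝ≥0∞} {w σ : X → ℝ≥0∞} (hA : P.ApPair μ p A w σ) {S : ℕ → Set X} (hS : P.IsSparse μ S)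
    {φ g : X → ℝ≥0∞} (hφ : Measurable φ) (hg : Measurable g) :
    ∑' j, ∫⁻ x in S j, P.avg μ j (fun y => φ y * σ y) x ^ s * (g x * w x) ∂μ ≤
      2 ^ (p + s / (p - 1)) * A ^ max 1 (s / (p - 1)) *
        ∫⁻ x, P.maxFn (μ.withDensity σ) φ x ^ s * P.maxFn (μ.withDensity w) g x *
          (σ x ^ (s / p) * w x ^ (1 - s / p)) ∂μ := by
  have hw := hA.measurable_weight
  have hσ := hA.measurable_dual
  set K : ℝ≥0∞ := 2 ^ (p + s / (p - 1)) * A ^ max 1 (s / (p - 1)) with hK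
  set u : X → ℝ≥0∞ := fun x => σ x ^ (s / p) * w x ^ (1 - s / p) with hu
  have hum : Measurable u := (hσ.pow_const _).mul (hw.pow_const _)
  set V : X → ℝ≥0∞ := fun x => P.maxFn (μ.withDensity σ) φ x ^ s *
    P.maxFn (μ.withDensity w) g x * u x with hV
  have hVm : Measurable V := (((measurable_maxFn φ).pow_const s).mul (measurable_maxFn g)).mul hum
  -- Removing from each level all later selected cells makes the sets disjoint, while sparseness
  -- leaves at least half of every selected cell.
  set E : ℕ → Set X := fun j => S j \ ⋃ k > j, S k with hE
  have hSm : ∀ j, MeasurableSet (S j) := fun j => (hS.adapted j).measurableSet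
  have hUm : ∀ j, MeasurableSet (⋃ k > j, S k) := fun j =>
    MeasurableSet.iUnion fun k => MeasurableSet.iUnion fun _ => hSm k
  have hEm : ∀ j, MeasurableSet (E j) := fun j => (hSm j).diff (hUm j)
  have hEd : Pairwise (Function.onFun Disjoint E) := by
    intro i j hij
    refine Set.disjoint_left.2 fun x hi hj => ?_
    rcases lt_or_gt_of_ne hij with h | h
    · exact hi.2 (Set.mem_iUnion₂.2 ⟨j, h, hj.1⟩)
    · exact hj.2 (Set.mem_iUnion₂.2 ⟨i, h, hi.1⟩)
  have hlevel : ∀ j, ∫⁻ x in S j, P.avg μ j (fun y => φ y * σ y) x ^ s * (g x * w x) ∂μ ≤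
      ∫⁻ x in E j, K * V x ∂μ := by
    intro j
    have h1 : ∫⁻ x in E j, K * V x ∂μ =
        ∫⁻ x in S j, (⋃ k > j, S k)ᶜ.indicator (fun x => K * V x) x ∂μ := by
      rw [lintegral_indicator (hUm j).compl, Measure.restrict_restrict (hUm j).compl,
        Set.inter_comm]
      rfl
    rw [h1]
    refine setLIntegral_le_of_cell j (hS.adapted j) fun x hx => ?_
    set Q := P.cell j x with hQ
    have hQm : MeasurableSet Q := measurableSet_cell j x
    rw [lintegral_indicator (hUm j).compl, Measure.restrict_restrict (hUm j).compl,
      Set.inter_comm, ← Set.sdiff_eq]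
    set F := Q \ ⋃ k > j, S k with hF
    have hFm : MeasurableSet F := hQm.diff (hUm j)
    set a := P.avg (μ.withDensity σ) j φ x with ha
    set b := P.avg (μ.withDensity w) j g x with hb
    have hloc := rpow_mul_le_of_major_subset hw hσ hp hs hsp hA.mul_rpow_eq_one
      (Q := Q) (E := F) Set.sdiff_subset (hS.le_two_mul j x hx) (hμ0 j x) (hμ j x)
      (hA.weight_ne_top j x) (hA.dual_ne_top j x) (hA.le j x)
    have hmQ0 : μ Q ^ s ≠ 0 := ENNReal.rpow_ne_zero_of_ne (hμ0 j x) (hμ j x) s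
    have hmQt : μ Q ^ s ≠ ∞ := ENNReal.rpow_ne_top_of_ne (hμ0 j x) (hμ j x) s
    have hloc' : ((∫⁻ y in Q, σ y ∂μ) / μ Q) ^ s * ∫⁻ y in Q, w y ∂μ ≤ K * ∫⁻ y in F, u y ∂μ := by
      refine (ENNReal.mul_le_mul_iff_right hmQ0 hmQt).1 ?_
      rw [← mul_assoc, ENNReal.div_rpow_of_nonneg _ _ hs.le, ENNReal.mul_div_cancel hmQ0 hmQt]
      refine hloc.trans (le_of_eq ?_)
      rw [hK]; ring
    calc ∫⁻ y in Q, P.avg μ j (fun y => φ y * σ y) y ^ s * (g y * w y) ∂μ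
        = ∫⁻ y in Q, P.avg μ j (fun y => φ y * σ y) x ^ s * (g y * w y) ∂μ :=
          setLIntegral_congr_fun hQm fun y hy => by
            simp only [adapted_avg j (fun y => φ y * σ y) y x hy]
      _ = P.avg μ j (fun y => φ y * σ y) x ^ s * (b * ∫⁻ y in Q, w y ∂μ) := by
          rw [lintegral_const_mul _ (hg.fun_mul hw), setLIntegral_mul_le_avg hw hg hA.weight_ne_top]
      _ = a ^ s * b * (((∫⁻ y in Q, σ y ∂μ) / μ Q) ^ s * ∫⁻ y in Q, w y ∂μ) := by
          rw [avg, setLIntegral_mul_le_avg hσ hφ hA.dual_ne_top, mul_div_assoc,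
            ENNReal.mul_rpow_of_nonneg _ _ hs.le]
          ring
      _ ≤ a ^ s * b * (K * ∫⁻ y in F, u y ∂μ) := by gcongr
      _ = ∫⁻ y in F, K * (a ^ s * b * u y) ∂μ := by
          rw [lintegral_const_mul _ (hum.const_mul _), lintegral_const_mul _ hum]
          ring
      _ ≤ ∫⁻ y in F, K * V y ∂μ := by
          -- The averages are constant on the cell, so they are dominated by the maximal functions
          -- at each point of the major subset.
          refine setLIntegral_mono' hFm fun y hy => ?_
          have hyx : P.idx j y = P.idx j x := hy.1
          simp only [hV]
          rw [ha, hb, ← adapted_avg j φ y x hyx, ← adapted_avg j g y x hyx]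
          gcongr
          · exact avg_le_maxFn j φ y
          · exact avg_le_maxFn j g y
  calc ∑' j, ∫⁻ x in S j, P.avg μ j (fun y => φ y * σ y) x ^ s * (g x * w x) ∂μ
      ≤ ∑' j, ∫⁻ x in E j, K * V x ∂μ := ENNReal.tsum_le_tsum hlevel
    _ = ∫⁻ x in ⋃ j, E j, K * V x ∂μ := (lintegral_iUnion hEm hEd _).symm
    _ ≤ ∫⁻ x, K * V x ∂μ := setLIntegral_le_lintegral _ _
    _ = K * ∫⁻ x, V x ∂μ := lintegral_const_mul _ hVm

/-- Doob's inequality for a weighted measure, written as an integral against `μ`. -/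
lemma lintegral_maxFn_rpow_mul_le [Countable ι] {u φ : X → ℝ≥0∞} (hu : Measurable u)
    (hφ : Measurable φ) (hfin : ∀ j x, ∫⁻ y in P.cell j x, u y ∂μ ≠ ∞) {p : ℝ} (hp : 1 < p) :
    ∫⁻ x, P.maxFn (μ.withDensity u) φ x ^ p * u x ∂μ ≤
      ENNReal.ofReal (2 ^ p * p / (p - 1)) * ∫⁻ x, φ x ^ p * u x ∂μ := by
  have h := lintegral_maxFn_rpow_le (P := P) (ν := μ.withDensity u)
    (fun j x => by rw [withDensity_cell]; exact hfin j x) hφ hp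
  rw [lintegral_withDensity_eq_lintegral_mul _ hu ((measurable_maxFn φ).pow_const p),
    lintegral_withDensity_eq_lintegral_mul _ hu (hφ.pow_const p)] at h
  simpa only [Pi.mul_apply, mul_comm] using h

lemma rpow_tsum_le_tsum_rpow {r : ℝ} (hr0 : 0 < r) (hr1 : r ≤ 1) (a : ℕ → ℝ≥0∞) :
    (∑' j, a j) ^ r ≤ ∑' j, a j ^ r := by
  rw [ENNReal.tsum_eq_iSup_sum, ENNReal.iSup_rpow _ hr0]
  refine iSup_le fun s => le_trans ?_ (ENNReal.sum_le_tsum s)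
  induction s using Finset.cons_induction with
  | empty => simp [hr0]
  | cons i s hi ih =>
    rw [Finset.sum_cons, Finset.sum_cons]
    exact (ENNReal.rpow_add_le_add_rpow _ _ hr0.le hr1).trans (by gcongr)

/-- The weighted bound for sparse operators with the sharp power of the `A_p` constant. -/
theorem lintegral_sparse_rpow_le [Countable ι] [SigmaFinite μ] {p q : ℝ} (hp : 1 < p)
    (hq : 1 < q) :
    ∃ C : ℝ≥0, ∀ (P : NestedPartition X ι), (∀ j x, μ (P.cell j x) ≠ ∞) →
      (∀ j x, μ (P.cell j x) ≠ 0) → ∀ (A : ℝ≥0∞) (w σ : X → ℝ≥0∞), P.ApPair μ p A w σ →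
      ∀ S : ℕ → Set X, P.IsSparse μ S → ∀ F : X → ℝ≥0∞, Measurable F →
        ∫⁻ x, (∑' j, (S j).indicator (fun y => P.avg μ j F y ^ q) x) ^ (p / q) * w x ∂μ ≤
          C * A ^ (p * max (1 / q) (1 / (p - 1))) * ∫⁻ x, F x ^ p * w x ∂μ := by
  have hp0 : 0 < p := by linarith
  have hq0 : 0 < q := by linarith
  have hp1 : 0 < p - 1 := by linarith
  -- The witness is `φ = F/σ`. Because `w = σ^{-(p-1)}`, the norm of `φ` in `L^p(σ)` equals that of
  -- `F` in `L^p(w)`.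
  have hφ : ∀ (P : NestedPartition X ι) (A : ℝ≥0∞) (w σ : X → ℝ≥0∞), P.ApPair μ p A w σ →
      ∀ F : X → ℝ≥0∞, Measurable F → ∃ φ : X → ℝ≥0∞, Measurable φ ∧
        (∀ᵐ x ∂μ, φ x * σ x = F x) ∧ ∫⁻ x, φ x ^ p * σ x ∂μ = ∫⁻ x, F x ^ p * w x ∂μ := by
    intro P A w σ hA F hF
    refine ⟨fun x => F x / σ x, hF.div hA.measurable_dual, ?_, ?_⟩
    · filter_upwards [hA.mul_rpow_eq_one] with x hx
      obtain ⟨_, _, h0, ht⟩ := ne_zero_top_of_mul_rpow_eq_one hp1 hx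
      exact ENNReal.div_mul_cancel h0 ht
    · refine lintegral_congr_ae ?_
      filter_upwards [hA.mul_rpow_eq_one] with x hx
      obtain ⟨_, _, h0, ht⟩ := ne_zero_top_of_mul_rpow_eq_one hp1 hx
      have hwx : w x = σ x ^ (-(p - 1)) := by
        rw [ENNReal.rpow_neg, ← one_div, ENNReal.eq_div_iff
          (ENNReal.rpow_ne_zero_of_ne h0 ht _) (ENNReal.rpow_ne_top_of_ne h0 ht _), mul_comm, hx]
      rw [ENNReal.div_rpow_of_nonneg _ _ hp0.le, hwx, div_eq_mul_inv, ← ENNReal.rpow_neg, mul_assoc]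
      congr 1
      conv_lhs => rw [← ENNReal.rpow_one (σ x), ← ENNReal.rpow_mul, one_mul]
      rw [← ENNReal.rpow_add _ _ h0 ht]
      congr 1
      ring
  rcases le_or_gt p q with hpq | hpq
  · refine ⟨((2 : ℝ≥0) ^ (p + p / (p - 1))) * (2 ^ p * p / (p - 1)).toNNReal, ?_⟩
    intro P hμ hμ0 A w σ hA S hS F hF
    obtain ⟨φ, hφm, hφF, hφint⟩ := hφ P A w σ hA F hF
    have havg : ∀ j x, P.avg μ j (fun y => φ y * σ y) x = P.avg μ j F x := fun j x => by
      rw [avg, avg, lintegral_congr_ae (ae_restrict_of_ae hφF)]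
    have hSm : ∀ j, MeasurableSet (S j) := fun j => (hS.adapted j).measurableSet
    have hmax : max (1 / q) (1 / (p - 1)) = 1 / (p - 1) :=
      max_eq_right (one_div_le_one_div_of_le hp1 (by linarith))
    have hmax' : max 1 (p / (p - 1)) = p / (p - 1) :=
      max_eq_right ((one_le_div hp1).2 (by linarith))
    -- With `s = p` and `g = 1` the mixed density reduces to `σ`, so no Hölder inequality or duality
    -- is needed.
    have hmain := tsum_sparse_le hp hp0 le_rfl hμ hμ0 hA hS hφm
      (measurable_const (a := (1 : ℝ≥0∞)))
    simp only [havg, one_mul, div_self hp0.ne', sub_self, ENNReal.rpow_zero, mul_one,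
      ENNReal.rpow_one] at hmain
    rw [hmax'] at hmain
    calc ∫⁻ x, (∑' j, (S j).indicator (fun y => P.avg μ j F y ^ q) x) ^ (p / q) * w x ∂μ
        ≤ ∫⁻ x, ∑' j, (S j).indicator (fun y => P.avg μ j F y ^ p * w y) x ∂μ := by
          refine lintegral_mono fun x => ?_
          refine (mul_le_mul_left (rpow_tsum_le_tsum_rpow (by positivity)
            ((div_le_one hq0).2 hpq) _) _).trans (le_of_eq ?_)
          rw [← ENNReal.tsum_mul_right]
          refine tsum_congr fun j => ?_
          by_cases hx : x ∈ S j
          · simp only [Set.indicator_of_mem hx]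
            rw [← ENNReal.rpow_mul, mul_div_cancel₀ _ hq0.ne']
          · simp only [Set.indicator_of_notMem hx]
            rw [ENNReal.zero_rpow_of_pos (by positivity), zero_mul]
      _ = ∑' j, ∫⁻ x in S j, P.avg μ j F x ^ p * w x ∂μ := by
          rw [lintegral_tsum fun j => ((((measurable_avg j F).pow_const p).fun_mul
            hA.measurable_weight).indicator (hSm j)).aemeasurable]
          exact tsum_congr fun j => lintegral_indicator (hSm j) _
      _ ≤ _ := hmain
      _ ≤ 2 ^ (p + p / (p - 1)) * A ^ (p / (p - 1)) *
            ∫⁻ x, P.maxFn (μ.withDensity σ) φ x ^ p * σ x ∂μ := by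
          gcongr with x
          have h1 : P.maxFn (μ.withDensity w) (fun _ => 1) x ≤ 1 :=
            iSup_le fun j => avg_const_le j 1 x
          exact mul_le_of_le_one_right zero_le h1
      _ ≤ 2 ^ (p + p / (p - 1)) * A ^ (p / (p - 1)) *
            (ENNReal.ofReal (2 ^ p * p / (p - 1)) * ∫⁻ x, φ x ^ p * σ x ∂μ) := by
          gcongr
          exact lintegral_maxFn_rpow_mul_le hA.measurable_dual hφm hA.dual_ne_top hp
      _ = _ := by
          rw [hφint, hmax, ENNReal.coe_mul, ENNReal.coe_rpow_of_nonneg _ (by positivity),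
            mul_one_div, ENNReal.ofReal]
          push_cast
          ring
  · set r := p / q with hr
    have hr1 : 1 < r := (one_lt_div hq0).2 hpq
    have hr0 : 0 < r - 1 := by linarith
    set r' := r / (r - 1) with hr'
    have hr'1 : 1 < r' := (one_lt_div hr0).2 (by linarith)
    have hqp : 1 / r = q / p := by rw [hr]; field_simp
    have hqp1 : q / p ≤ 1 := (div_le_one hp0).2 hpq.le
    have hr'inv : r' * (1 - q / p) = 1 := by
      rw [← hqp, hr']; field_simp
    refine ⟨((2 : ℝ≥0) ^ (p + q / (p - 1)) * (2 ^ p * p / (p - 1)).toNNReal ^ (q / p) *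
      (2 ^ r' * r' / (r' - 1)).toNNReal ^ (1 - q / p)) ^ r, ?_⟩
    intro P hμ hμ0 A w σ hA S hS F hF
    obtain ⟨φ, hφm, hφF, hφint⟩ := hφ P A w σ hA F hF
    have hw := hA.measurable_weight
    have havg : ∀ j x, P.avg μ j (fun y => φ y * σ y) x = P.avg μ j F x := fun j x => by
      rw [avg, avg, lintegral_congr_ae (ae_restrict_of_ae hφF)]
    have hSm : ∀ j, MeasurableSet (S j) := fun j => (hS.adapted j).measurableSet
    set h : X → ℝ≥0∞ := fun x => ∑' j, (S j).indicator (fun y => P.avg μ j F y ^ q) x with hh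
    have hhm : Measurable h :=
      Measurable.tsum fun j => ((measurable_avg j F).pow_const q).indicator (hSm j)
    have : SigmaFinite (μ.withDensity w) := SigmaFinite.withDensity_of_ne_top (by
      filter_upwards [hA.mul_rpow_eq_one] with x hx
      exact (ne_zero_top_of_mul_rpow_eq_one hp1 hx).2.1)
    -- For `r = p/q > 1` the sparse sum is tested against `g` in the dual space, with `s = q`. The
    -- density `σ^{q/p} w^{1-q/p}` then splits under Hölder with exponents `p/q` and `r'`, so that
    -- each maximal function meets its own measure.
    have hdual := lintegral_rpow_le_of_forall_mul (ν := μ.withDensity w) hhm hr1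
      (B := 2 ^ (p + q / (p - 1)) * A ^ max 1 (q / (p - 1)) *
        ((ENNReal.ofReal (2 ^ p * p / (p - 1)) * ∫⁻ x, F x ^ p * w x ∂μ) ^ (q / p) *
          ENNReal.ofReal (2 ^ r' * r' / (r' - 1)) ^ (1 - q / p))) (by
      intro g hg
      rw [lintegral_withDensity_eq_lintegral_mul _ hw (hhm.fun_mul hg),
        lintegral_withDensity_eq_lintegral_mul _ hw (hg.pow_const _)]
      have hmain := tsum_sparse_le hp hq0 hpq.le hμ hμ0 hA hS hφm hg
      simp only [havg] at hmain
      calc ∫⁻ x, (w * fun x => h x * g x) x ∂μ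
          = ∫⁻ x, ∑' j, (S j).indicator (fun y => P.avg μ j F y ^ q * (g y * w y)) x ∂μ := by
            refine lintegral_congr fun x => ?_
            simp only [Pi.mul_apply]
            rw [mul_comm, mul_assoc, hh]
            simp only
            rw [← ENNReal.tsum_mul_right]
            refine tsum_congr fun j => ?_
            by_cases hx : x ∈ S j <;> simp [hx]
        _ = ∑' j, ∫⁻ x in S j, P.avg μ j F x ^ q * (g x * w x) ∂μ := by
            rw [lintegral_tsum fun j => ((((measurable_avg j F).pow_const q).fun_mul
              (hg.fun_mul hw)).indicator (hSm j)).aemeasurable]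
            exact tsum_congr fun j => lintegral_indicator (hSm j) _
        _ ≤ _ := hmain
        _ = 2 ^ (p + q / (p - 1)) * A ^ max 1 (q / (p - 1)) *
            ∫⁻ x, (P.maxFn (μ.withDensity σ) φ x ^ p * σ x) ^ (q / p) *
              (P.maxFn (μ.withDensity w) g x ^ r' * w x) ^ (1 - q / p) ∂μ := by
            congr 1
            refine lintegral_congr fun x => ?_
            rw [ENNReal.mul_rpow_of_nonneg _ _ (by positivity),
              ENNReal.mul_rpow_of_nonneg _ _ (by linarith), ← ENNReal.rpow_mul,
              ← ENNReal.rpow_mul, mul_div_cancel₀ _ hp0.ne', hr'inv, ENNReal.rpow_one]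
            ring
        _ ≤ 2 ^ (p + q / (p - 1)) * A ^ max 1 (q / (p - 1)) *
            ((∫⁻ x, P.maxFn (μ.withDensity σ) φ x ^ p * σ x ∂μ) ^ (q / p) *
              (∫⁻ x, P.maxFn (μ.withDensity w) g x ^ r' * w x ∂μ) ^ (1 - q / p)) := by
            gcongr
            exact ENNReal.lintegral_mul_norm_pow_le
              (((measurable_maxFn φ).pow_const p).mul hA.measurable_dual).aemeasurable
              (((measurable_maxFn g).pow_const r').mul hw).aemeasurable (by positivity)
              (by linarith) (by ring)
        _ ≤ 2 ^ (p + q / (p - 1)) * A ^ max 1 (q / (p - 1)) *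
            ((ENNReal.ofReal (2 ^ p * p / (p - 1)) * ∫⁻ x, F x ^ p * w x ∂μ) ^ (q / p) *
              (ENNReal.ofReal (2 ^ r' * r' / (r' - 1)) *
                ∫⁻ x, g x ^ r' * w x ∂μ) ^ (1 - q / p)) := by
            have h1q : 0 ≤ 1 - q / p := by linarith
            gcongr
            · rw [← hφint]
              exact lintegral_maxFn_rpow_mul_le hA.measurable_dual hφm hA.dual_ne_top hp
            · exact lintegral_maxFn_rpow_mul_le hw hg hA.weight_ne_top hr'1
        _ = _ := by
            rw [ENNReal.mul_rpow_of_nonneg (ENNReal.ofReal (2 ^ r' * r' / (r' - 1))) _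
              (by linarith), hqp]
            simp only [Pi.mul_apply, mul_comm (w _)]
            ring)
    rw [lintegral_withDensity_eq_lintegral_mul _ hw (hhm.pow_const _)] at hdual
    calc ∫⁻ x, h x ^ r * w x ∂μ = ∫⁻ x, (w * fun x => h x ^ r) x ∂μ :=
          lintegral_congr fun x => mul_comm _ _
      _ ≤ _ := hdual
      _ = _ := by
          have h1q : 0 ≤ 1 - q / p := by linarith
          have hr00 : 0 ≤ r := by linarith
          -- Multiplying by `r = p/q` turns `max(1, q/(p-1))` into `p` times the sharp exponent.
          have hmaxr : max 1 (q / (p - 1)) * r = p * max (1 / q) (1 / (p - 1)) := by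
            rw [max_mul_of_nonneg _ _ hr00, mul_max_of_nonneg _ _ hp0.le, hr]
            congr 1 <;> field_simp
          have hqr : q / p * r = 1 := by rw [hr]; field_simp
          simp only [ENNReal.mul_rpow_of_nonneg _ _ hr00, ENNReal.coe_mul,
            ENNReal.mul_rpow_of_nonneg _ _ (show 0 ≤ q / p by positivity), ENNReal.ofReal,
            ENNReal.coe_rpow_of_nonneg _ hr00, ENNReal.coe_rpow_of_nonneg _ h1q,
            ENNReal.coe_rpow_of_nonneg _ (show 0 ≤ q / p by positivity),
            ENNReal.coe_rpow_of_nonneg _ (show 0 ≤ p + q / (p - 1) by positivity)]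
          rw [← ENNReal.rpow_mul A, hmaxr, ← ENNReal.rpow_mul (∫⁻ x, F x ^ p * w x ∂μ), hqr,
            ENNReal.rpow_one]
          push_cast
          ring

/-- The weighted bound for the vector-valued maximal function of a nested partition. -/
theorem lintegral_tsum_maxFn_rpow_le [Countable ι] [SigmaFinite μ] {p q : ℝ} (hp : 1 < p)
    (hq : 1 < q) {D : ℝ≥0} (hD1 : 1 ≤ D) :
    ∃ C : ℝ≥0, ∀ (P : NestedPartition X ι), (∀ j x, μ (P.cell j x) ≠ ∞) →
      (∀ j x, μ (P.cell j x) ≠ 0) → (∀ j x, μ (P.cell j x) ≤ D * μ (P.cell (j + 1) x)) →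
      ∀ (A : ℝ≥0∞) (w σ : X → ℝ≥0∞), P.ApPair μ p A w σ →
      ∀ f : ℕ → X → ℝ≥0∞, (∀ l, Measurable (f l)) →
        ∫⁻ x, (∑' l, P.maxFn μ (f l) x ^ q) ^ (p / q) * w x ∂μ ≤
          C * A ^ (p * max (1 / q) (1 / (p - 1))) * ∫⁻ x, seqNorm q f x ^ p * w x ∂μ := by
  have hp0 : 0 < p := by linarith
  have hq0 : 0 < q := by linarith
  obtain ⟨C, hC⟩ := lintegral_sparse_rpow_le (X := X) (ι := ι) (μ := μ) hp hq
  refine ⟨(2 * weakConst D q) ^ p * C, fun P hμ hμ0 hD A w σ hA f hf => ?_⟩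
  obtain ⟨S, hS, hdom⟩ := exists_isSparse hμ hμ0 hD1 hD hq hf
  have hSm : ∀ j, MeasurableSet (S j) := fun j => (hS.adapted j).measurableSet
  set h : X → ℝ≥0∞ :=
    fun x => ∑' j, (S j).indicator (fun y => P.avg μ j (seqNorm q f) y ^ q) x with hh
  have hhm : Measurable h :=
    Measurable.tsum fun j => ((measurable_avg j _).pow_const q).indicator (hSm j)
  calc ∫⁻ x, (∑' l, P.maxFn μ (f l) x ^ q) ^ (p / q) * w x ∂μ
      ≤ ∫⁻ x, (2 * weakConst D q) ^ p * (h x ^ (p / q) * w x) ∂μ := by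
        refine lintegral_mono fun x => ?_
        calc _ ≤ ((2 * weakConst D q) ^ q * h x) ^ (p / q) * w x := by
              gcongr
              exact hdom x
          _ = _ := by
              rw [ENNReal.mul_rpow_of_nonneg _ _ (by positivity), ← ENNReal.rpow_mul,
                mul_div_cancel₀ _ hq0.ne', mul_assoc]
    _ = (2 * weakConst D q) ^ p * ∫⁻ x, h x ^ (p / q) * w x ∂μ :=
        lintegral_const_mul _ ((hhm.pow_const _).mul hA.measurable_weight)
    _ ≤ (2 * weakConst D q) ^ p * (C * A ^ (p * max (1 / q) (1 / (p - 1))) *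
          ∫⁻ x, seqNorm q f x ^ p * w x ∂μ) := by
        gcongr
        exact hC P hμ hμ0 A w σ hA S hS _ (measurable_seqNorm hf)
    _ = _ := by
        rw [ENNReal.coe_mul, ENNReal.coe_rpow_of_nonneg _ hp0.le]
        push_cast
        ring

end NestedPartition

/-! ### Shifted dyadic grids and the one-third trick. -/

namespace VectorMaximal

/-- The offset of the grid of mesh `2^k`, for the standard grid (`b = false`) and for the grid
shifted by one third of the mesh (`b = true`). -/
noncomputable def gridShift (b : Bool) (k : ℤ) : ℝ := if b then (-2) ^ k / 3 else 0

/-- The index of the half-open interval of length `2^k` containing `x`. -/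
noncomputable def gridIdx (b : Bool) (k : ℤ) (x : ℝ) : ℤ := ⌊(x - gridShift b k) / 2 ^ k⌋

lemma neg_two_zpow (k : ℤ) : ∃ ε : ℤ, (ε = 1 ∨ ε = -1) ∧ ((-2 : ℝ) ^ k) = ε * 2 ^ k := by
  rcases Int.even_or_odd k with h | h
  · exact ⟨1, Or.inl rfl, by rw [h.neg_zpow]; simp⟩
  · exact ⟨-1, Or.inr rfl, by rw [h.neg_zpow]; simp⟩

/-- The alternating sign in `(-2)^k / 3` makes consecutive offsets differ by exactly `(-2)^k`, an
integer multiple of the finer mesh. This keeps the shifted grid nested. -/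
lemma gridIdx_succ (b : Bool) (k : ℤ) : ∃ m : ℤ, ∀ x,
    gridIdx b (k + 1) x = (gridIdx b k x + m) / 2 := by
  have h2 : (2 : ℝ) ^ k ≠ 0 := by positivity
  have key : ∃ m : ℤ, gridShift b k - gridShift b (k + 1) = m * 2 ^ k := by
    cases b with
    | false => exact ⟨0, by simp [gridShift]⟩
    | true =>
      obtain ⟨ε, -, hε⟩ := neg_two_zpow k
      refine ⟨ε, ?_⟩
      simp only [gridShift, if_true]
      rw [zpow_add_one₀ (by norm_num : (-2 : ℝ) ≠ 0), hε]
      ring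
  obtain ⟨m, hm⟩ := key
  refine ⟨m, fun x => ?_⟩
  have h : (x - gridShift b (k + 1)) / 2 ^ (k + 1) =
      ((x - gridShift b k) / 2 ^ k + m) / ((2 : ℕ) : ℝ) := by
    rw [zpow_add_one₀ (by norm_num : (2 : ℝ) ≠ 0), show x - gridShift b (k + 1) =
      (x - gridShift b k) + m * 2 ^ k by rw [← hm]; ring]
    field_simp
    push_cast
    ring
  rw [gridIdx, h, Int.floor_div_natCast, Int.floor_add_intCast, gridIdx]
  rfl

lemma gridIdx_mono (b : Bool) (k : ℤ) : Monotone (gridIdx b k) := fun x y h => by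
  unfold gridIdx
  gcongr

lemma measurable_gridIdx (b : Bool) (k : ℤ) : Measurable (gridIdx b k) :=
  Int.measurable_floor.comp ((measurable_id.sub_const _).div_const _)

lemma gridIdx_eq_iff (b : Bool) (k m : ℤ) (x : ℝ) : gridIdx b k x = m ↔
    x ∈ Set.Ico (gridShift b k + m * 2 ^ k) (gridShift b k + m * 2 ^ k + 2 ^ k) := by
  have h2 : (0 : ℝ) < 2 ^ k := by positivity
  rw [gridIdx, Int.floor_eq_iff, le_div_iff₀ h2, div_lt_iff₀ h2, Set.mem_Ico]
  constructor <;> rintro ⟨h1, h3⟩ <;> constructor <;> nlinarith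

/-- The one-third trick: an interval of length at most `2^k/3` lies in a cell of one of the two
grids of mesh `2^k`. -/
lemma exists_gridIdx_eq {a l : ℝ} {k : ℤ} (hl0 : 0 ≤ l) (hl : 3 * l ≤ 2 ^ k) :
    ∃ b, gridIdx b k a = gridIdx b k (a + l) := by
  by_contra! hne
  have h2 : (0 : ℝ) < 2 ^ k := by positivity
  have aux : ∀ u v : ℝ, ⌊u⌋ ≠ ⌊u + v⌋ → 0 ≤ v → ∃ m : ℤ, u < m ∧ (m : ℝ) ≤ u + v := by
    intro u v huv hv
    refine ⟨⌊u + v⌋, ?_, Int.floor_le _⟩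
    have : ⌊u⌋ < ⌊u + v⌋ := lt_of_le_of_ne (Int.floor_mono (by linarith)) huv
    exact Int.floor_lt.1 this
  obtain ⟨ε, hε, hk⟩ := neg_two_zpow k
  have hf := hne false
  have ht := hne true
  have e1 : (a + l - gridShift false k) / 2 ^ k = a / 2 ^ k + l / 2 ^ k := by
    simp [gridShift]; ring
  have e2 : (a + l - gridShift true k) / 2 ^ k =
      (a / 2 ^ k - ε / 3) + l / 2 ^ k := by
    simp only [gridShift, if_true, hk]; field_simp; ring
  have e3 : (a - gridShift true k) / 2 ^ k = a / 2 ^ k - ε / 3 := by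
    simp only [gridShift, if_true, hk]; field_simp
  have e4 : (a - gridShift false k) / 2 ^ k = a / 2 ^ k := by simp [gridShift]
  rw [gridIdx, gridIdx, e1, e4] at hf
  rw [gridIdx, gridIdx, e2, e3] at ht
  have hv0 : 0 ≤ l / 2 ^ k := by positivity
  have hv : l / 2 ^ k ≤ 1 / 3 := by rw [div_le_iff₀ h2]; linarith
  obtain ⟨m, hm1, hm2⟩ := aux _ _ hf hv0
  obtain ⟨m', hm1', hm2'⟩ := aux _ _ ht hv0
  -- If both grids separate the endpoints, the interval, half-open on the left, contains a point of
  -- each. In units of `2^k` these differ by less than `1/3`, whereas `m - m' - ε/3` has absolute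
  -- value at least `1/3`.
  have i1 : (3 * (m - m') - ε : ℝ) < 1 := by linarith
  have i2 : (-1 : ℝ) < 3 * (m - m') - ε := by linarith
  have i1' : 3 * (m - m') - ε < 1 := by exact_mod_cast i1
  have i2' : -1 < 3 * (m - m') - ε := by exact_mod_cast i2
  omega

/-- The dyadic partitions of `ℝⁿ` into cubes of side lengths `2^N, 2^(N-1), …`, offset in the
coordinates selected by `t`. -/
noncomputable def dyadicGrid {n : ℕ} (t : Fin n → Bool) (N : ℤ) :
    NestedPartition (Fin n → ℝ) (Fin n → ℤ) where
  idx j x i := gridIdx (t i) (N - j) (x i)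
  measurableSet_fiber j m := by
    refine measurableSet_preimage ?_ (measurableSet_singleton m)
    exact measurable_pi_lambda _ fun i => (measurable_gridIdx _ _).comp (measurable_pi_apply i)
  idx_eq_of_succ j x y h := by
    ext i
    obtain ⟨m, hm⟩ := gridIdx_succ (t i) (N - (j + 1 : ℕ))
    have hi : gridIdx (t i) (N - (j + 1 : ℕ)) (x i) = gridIdx (t i) (N - (j + 1 : ℕ)) (y i) :=
      congrFun h i
    have hk : (N - (j + 1 : ℕ) + 1 : ℤ) = N - j := by push_cast; ring
    rw [← hk, hm, hm, hi]

variable {n : ℕ}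

lemma mem_dyadicGrid_cell {t : Fin n → Bool} {N : ℤ} {j : ℕ} {x y : Fin n → ℝ} :
    y ∈ (dyadicGrid t N).cell j x ↔
      ∀ i, gridIdx (t i) (N - j) (y i) = gridIdx (t i) (N - j) (x i) := funext_iff

lemma dyadicGrid_cell_eq_pi (t : Fin n → Bool) (N : ℤ) (j : ℕ) (x : Fin n → ℝ) :
    ∃ a : Fin n → ℝ, (dyadicGrid t N).cell j x =
      Set.univ.pi fun i => Set.Ico (a i) (a i + 2 ^ (N - j : ℤ)) := by
  refine ⟨fun i => gridShift (t i) (N - j) + gridIdx (t i) (N - j) (x i) * 2 ^ (N - j : ℤ), ?_⟩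
  ext y
  simp only [mem_dyadicGrid_cell, gridIdx_eq_iff, Set.mem_pi, Set.mem_univ, true_imp_iff]

lemma exists_cube_ae_eq_cell (t : Fin n → Bool) (N : ℤ) (j : ℕ) (x : Fin n → ℝ) :
    ∃ a : Fin n → ℝ, (dyadicGrid t N).cell j x =ᵐ[volume] cube a (2 ^ (N - j : ℤ)) := by
  obtain ⟨a, ha⟩ := dyadicGrid_cell_eq_pi t N j x
  refine ⟨a, ?_⟩
  rw [ha]
  exact Measure.univ_pi_Ico_ae_eq_Icc

lemma volume_cube (a : Fin n → ℝ) (l : ℝ) : volume (cube a l) = ENNReal.ofReal l ^ n := by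
  simp [cube, Real.volume_Icc_pi]

lemma volume_dyadicGrid_cell (t : Fin n → Bool) (N : ℤ) (j : ℕ) (x : Fin n → ℝ) :
    volume ((dyadicGrid t N).cell j x) = ENNReal.ofReal (2 ^ (N - j : ℤ)) ^ n := by
  obtain ⟨a, ha⟩ := exists_cube_ae_eq_cell t N j x
  rw [measure_congr ha, volume_cube]

lemma volume_cell_ne_top (t : Fin n → Bool) (N : ℤ) (j : ℕ) (x : Fin n → ℝ) :
    volume ((dyadicGrid t N).cell j x) ≠ ∞ := by
  rw [volume_dyadicGrid_cell]; simp

lemma volume_cell_ne_zero (t : Fin n → Bool) (N : ℤ) (j : ℕ) (x : Fin n → ℝ) :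
    volume ((dyadicGrid t N).cell j x) ≠ 0 := by
  rw [volume_dyadicGrid_cell]
  refine pow_ne_zero _ ?_
  simp only [ne_eq, ENNReal.ofReal_eq_zero, not_le]
  positivity

lemma volume_cell_le (t : Fin n → Bool) (N : ℤ) (j : ℕ) (x : Fin n → ℝ) :
    volume ((dyadicGrid t N).cell j x) ≤
      ((2 : ℝ≥0) ^ n : ℝ≥0) * volume ((dyadicGrid t N).cell (j + 1) x) := by
  rw [volume_dyadicGrid_cell, volume_dyadicGrid_cell]
  have h : (2 : ℝ) ^ (N - j : ℤ) = 2 * 2 ^ (N - (j + 1 : ℕ) : ℤ) := by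
    rw [← zpow_one_add₀ (by norm_num : (2 : ℝ) ≠ 0)]
    congr 1
    push_cast
    ring
  rw [h, ENNReal.ofReal_mul (by norm_num), mul_pow]
  simp

/-- Raising `N` by one only adds a coarser level in front. The maximal functions hence increase with
`N`, and letting `N → ∞` reaches cubes of every size. -/
lemma dyadicGrid_avg_succ (t : Fin n → Bool) (N : ℤ) (j : ℕ) (g : (Fin n → ℝ) → ℝ≥0∞)
    (x : Fin n → ℝ) :
    (dyadicGrid t N).avg volume j g x = (dyadicGrid t (N + 1)).avg volume (j + 1) g x := by
  have : (dyadicGrid t N).cell j x = (dyadicGrid t (N + 1)).cell (j + 1) x := by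
    ext y
    have hk : (N + 1 - (j + 1 : ℕ) : ℤ) = N - j := by push_cast; ring
    simp only [mem_dyadicGrid_cell, hk]
  simp only [NestedPartition.avg, this]

lemma dyadicGrid_maxFn_mono (t : Fin n → Bool) (g : (Fin n → ℝ) → ℝ≥0∞) (x : Fin n → ℝ) :
    Monotone fun N : ℕ => (dyadicGrid t N).maxFn volume g x := by
  refine monotone_nat_of_le_succ fun N => iSup_le fun j => ?_
  rw [dyadicGrid_avg_succ]
  push_cast
  exact NestedPartition.avg_le_maxFn _ _ _

/-- The average over a cube is controlled by a dyadic maximal function at each of its points. -/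
lemma setLAverage_cube_le (g : (Fin n → ℝ) → ℝ≥0∞) {a : Fin n → ℝ} {l : ℝ} (hl : 0 < l)
    {x : Fin n → ℝ} (hx : x ∈ cube a l) :
    ⨍⁻ y in cube a l, g y ∂volume ≤
      6 ^ n * ⨆ (t : Fin n → Bool) (N : ℕ), (dyadicGrid t N).maxFn volume g x := by
  -- The mesh is chosen with `3l ≤ 2^k < 6l`: the left inequality is what the one-third trick
  -- requires in each coordinate, and the right one gives the constant `6^n`.
  obtain ⟨k', hk1, hk2⟩ := exists_mem_Ioc_zpow (show (0 : ℝ) < 3 * l by positivity)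
    (one_lt_two : (1 : ℝ) < 2)
  set k := k' + 1 with hk
  have hk3 : (2 : ℝ) ^ k < 6 * l := by
    rw [hk, zpow_add_one₀ (by norm_num : (2 : ℝ) ≠ 0)]; linarith
  choose t ht using fun i => exists_gridIdx_eq (a := a i) hl.le hk2
  set N : ℕ := k.toNat with hN
  set j : ℕ := (N - k).toNat with hj
  have hNj : (N - j : ℤ) = k := by omega
  have hsub : cube a l ⊆ (dyadicGrid t N).cell j x := by
    intro y hy
    rw [mem_dyadicGrid_cell, hNj]
    intro i
    have aux : ∀ z ∈ cube a l, gridIdx (t i) k (z i) = gridIdx (t i) k (a i) := fun z hz =>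
      le_antisymm ((gridIdx_mono _ _ (hz.2 i)).trans (ht i).ge) (gridIdx_mono _ _ (hz.1 i))
    rw [aux y hy, aux x hx]
  have hle : (dyadicGrid t N).avg volume j g x ≤
      ⨆ (t : Fin n → Bool) (N : ℕ), (dyadicGrid t N).maxFn volume g x :=
    (NestedPartition.avg_le_maxFn j g x).trans
      (le_iSup₂ (f := fun t (N : ℕ) => (dyadicGrid t N).maxFn volume g x) t N)
  refine le_trans ?_ (mul_le_mul_right hle _)
  have hl0 : ENNReal.ofReal l ^ n ≠ 0 := pow_ne_zero _ (by simpa using hl)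
  rw [setLAverage_eq, volume_cube, ENNReal.div_le_iff hl0 (by simp)]
  calc ∫⁻ y in cube a l, g y ≤ ∫⁻ y in (dyadicGrid t N).cell j x, g y := lintegral_mono_set hsub
    _ = (dyadicGrid t N).avg volume j g x * volume ((dyadicGrid t N).cell j x) := by
        rw [NestedPartition.avg, ENNReal.div_mul_cancel (volume_cell_ne_zero t N j x)
          (volume_cell_ne_top t N j x)]
    _ ≤ (dyadicGrid t N).avg volume j g x * (6 ^ n * ENNReal.ofReal l ^ n) := by
        gcongr
        rw [volume_dyadicGrid_cell, hNj, ← mul_pow]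
        gcongr
        rw [show (6 : ℝ≥0∞) = ENNReal.ofReal 6 by simp, ← ENNReal.ofReal_mul (by norm_num)]
        exact ENNReal.ofReal_le_ofReal hk3.le
    _ = _ := by ring

lemma maximal_le {𝕜 : Type*} [RCLike 𝕜] (f : (Fin n → ℝ) → 𝕜) (g : (Fin n → ℝ) → ℝ≥0∞)
    (hfg : (fun x => ‖f x‖ₑ) =ᵐ[volume] g) (x : Fin n → ℝ) :
    maximal f x ≤ 6 ^ n * ⨆ (t : Fin n → Bool) (N : ℕ), (dyadicGrid t N).maxFn volume g x := by
  refine iSup_le fun a => iSup_le fun l => iSup_le fun hl => iSup_le fun hx => ?_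
  refine le_trans (le_of_eq ?_) (setLAverage_cube_le g hl hx)
  exact laverage_congr (ae_restrict_of_ae hfg)

end VectorMaximal

/-! ### The weighted inequality on `ℝⁿ`. -/

namespace VectorMaximal

variable {n : ℕ}

lemma weightedNorm_eq {p : ℝ} (hp : 0 < p) (w : (Fin n → ℝ) → ℝ) (g : (Fin n → ℝ) → ℝ≥0∞) :
    weightedNorm p w g =
      (∫⁻ x, g x ^ p ∂(volume.withDensity fun x => ENNReal.ofReal (w x))) ^ (1 / p) := by
  rw [weightedNorm, eLpNorm_eq_lintegral_rpow_enorm_toReal (by simpa using hp) (by simp),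
    ENNReal.toReal_ofReal hp.le]
  simp

lemma one_sub_conjExponent {p : ℝ} (hp : 1 < p) : 1 - Real.conjExponent p = -(p - 1)⁻¹ := by
  have : p - 1 ≠ 0 := by linarith
  rw [Real.conjExponent]; field_simp; ring

lemma lintegral_cube_mul_le {p : ℝ} (hp : 1 < p) (w : (Fin n → ℝ) → ℝ) (a : Fin n → ℝ) {l : ℝ}
    (hl : 0 < l) :
    (∫⁻ y in cube a l, ENNReal.ofReal (w y)) *
        (∫⁻ y in cube a l, ENNReal.ofReal (w y) ^ (1 - Real.conjExponent p)) ^ (p - 1) ≤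
      apConst p w * volume (cube a l) ^ p := by
  have hp1 : 0 < p - 1 := by linarith
  have h0 : volume (cube a l) ≠ 0 := by
    rw [volume_cube]; exact pow_ne_zero _ (by simpa using hl)
  have ht : volume (cube a l) ≠ ∞ := by rw [volume_cube]; simp
  have h : (⨍⁻ y in cube a l, ENNReal.ofReal (w y) ∂volume) *
      (⨍⁻ y in cube a l, ENNReal.ofReal (w y) ^ (1 - Real.conjExponent p) ∂volume) ^ (p - 1) ≤
      apConst p w :=
    le_iSup_of_le a (le_iSup_of_le l (le_iSup_of_le hl le_rfl))
  rw [setLAverage_eq, setLAverage_eq, ENNReal.div_rpow_of_nonneg _ _ hp1.le] at h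
  have hsplit : volume (cube a l) ^ p = volume (cube a l) * volume (cube a l) ^ (p - 1) := by
    conv_lhs => rw [show p = 1 + (p - 1) by ring]
    rw [ENNReal.rpow_add _ _ h0 ht, ENNReal.rpow_one]
  refine le_trans (le_of_eq ?_) (mul_le_mul_left h _)
  have h0' := ENNReal.rpow_ne_zero_of_ne h0 ht (p - 1)
  have ht' := ENNReal.rpow_ne_top_of_ne h0 ht (p - 1)
  rw [hsplit, mul_mul_mul_comm, ENNReal.div_mul_cancel h0 ht, ENNReal.div_mul_cancel h0' ht']

lemma lintegral_cube_lt_top {w : (Fin n → ℝ) → ℝ} (hw : LocallyIntegrable w volume)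
    (a : Fin n → ℝ) (l : ℝ) : ∫⁻ y in cube a l, ENNReal.ofReal (w y) < ∞ := by
  have hi : IntegrableOn w (cube a l) := hw.integrableOn_isCompact isCompact_Icc
  exact (lintegral_mono fun y => Real.ofReal_le_enorm (w y)).trans_lt hi.2

/-- An `A_p` weight gives an `A_p` pair for every dyadic grid. -/
lemma IsAp.apPair {p : ℝ} (hp : 1 < p) {w : (Fin n → ℝ) → ℝ} (hw : IsAp p w)
    {W : (Fin n → ℝ) → ℝ≥0∞} (hW : Measurable W)
    (hWw : (fun x => ENNReal.ofReal (w x)) =ᵐ[volume] W) (t : Fin n → Bool) (N : ℤ) :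
    (dyadicGrid t N).ApPair volume p (apConst p w) W
      (fun x => W x ^ (1 - Real.conjExponent p)) := by
  have hp1 : 0 < p - 1 := by linarith
  have hpos : ∀ᵐ x, W x ≠ 0 ∧ W x ≠ ∞ := by
    filter_upwards [hWw, hw.pos] with x hx hx0
    rw [← hx]
    exact ⟨by simpa using hx0, by simp⟩
  have hcell : ∀ (u v : (Fin n → ℝ) → ℝ≥0∞), u =ᵐ[volume] v → ∀ j x a,
      (dyadicGrid t N).cell j x =ᵐ[volume] cube a (2 ^ (N - j : ℤ)) →
      ∫⁻ y in (dyadicGrid t N).cell j x, u y = ∫⁻ y in cube a (2 ^ (N - j : ℤ)), v y := by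
    intro u v huv j x a ha
    rw [Measure.restrict_congr_set ha]
    exact lintegral_congr_ae (ae_restrict_of_ae huv)
  have hσw : (fun x => W x ^ (1 - Real.conjExponent p)) =ᵐ[volume]
      fun x => ENNReal.ofReal (w x) ^ (1 - Real.conjExponent p) := by
    filter_upwards [hWw] with x hx
    rw [hx]
  have hle : ∀ j x, (∫⁻ y in (dyadicGrid t N).cell j x, W y) *
      (∫⁻ y in (dyadicGrid t N).cell j x, W y ^ (1 - Real.conjExponent p)) ^ (p - 1) ≤
      apConst p w * volume ((dyadicGrid t N).cell j x) ^ p := by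
    intro j x
    obtain ⟨a, ha⟩ := exists_cube_ae_eq_cell t N j x
    rw [hcell _ _ hWw.symm j x a ha, hcell _ _ hσw j x a ha, measure_congr ha]
    exact lintegral_cube_mul_le hp w a (by positivity)
  refine ⟨hW, hW.pow_const _, ?_, ?_, ?_, hle⟩
  · filter_upwards [hpos] with x hx
    rw [← ENNReal.rpow_mul, one_sub_conjExponent hp, neg_mul, inv_mul_cancel₀ hp1.ne',
      ENNReal.rpow_neg, ENNReal.rpow_one, ENNReal.mul_inv_cancel hx.1 hx.2]
  · intro j x
    obtain ⟨a, ha⟩ := exists_cube_ae_eq_cell t N j x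
    rw [hcell _ _ hWw.symm j x a ha]
    exact (lintegral_cube_lt_top hw.locallyIntegrable _ _).ne
  -- The dual weight has finite mass on the cell: the mass of `W` there is positive, so infinite
  -- dual mass would make the left side of the `A_p` condition infinite while its right side is
  -- finite.
  · intro j x htop
    have h := hle j x
    have hW0 : ∫⁻ y in (dyadicGrid t N).cell j x, W y ≠ 0 := by
      intro h0
      rw [lintegral_eq_zero_iff hW] at h0
      refine volume_cell_ne_zero t N j x (Measure.restrict_eq_zero.1 (ae_eq_bot.1 ?_))
      rw [← Filter.eventually_false_iff_eq_bot]
      filter_upwards [h0, ae_restrict_of_ae hpos] with y hy hy'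
      exact hy'.1 hy
    rw [htop, ENNReal.top_rpow_of_pos hp1, ENNReal.mul_top hW0, top_le_iff] at h
    exact ENNReal.mul_ne_top hw.apConst_lt_top.ne
      (ENNReal.rpow_ne_top_of_nonneg (by linarith) (volume_cell_ne_top t N j x)) h

lemma rpow_sum_le_card_rpow_mul {κ : Type*} [Fintype κ] {r : ℝ} (hr : 0 < r) (b : κ → ℝ≥0∞) :
    (∑ t, b t) ^ r ≤ (Fintype.card κ : ℝ≥0∞) ^ r * ∑ t, b t ^ r := by
  rcases isEmpty_or_nonempty κ with hκ | hκ
  · simp [hr]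
  obtain ⟨t₀, ht₀⟩ := Finite.exists_max b
  calc (∑ t, b t) ^ r ≤ (Fintype.card κ * b t₀) ^ r := by
        gcongr
        calc ∑ t, b t ≤ ∑ _t : κ, b t₀ := Finset.sum_le_sum fun t _ => ht₀ t
          _ = _ := by simp
    _ = (Fintype.card κ : ℝ≥0∞) ^ r * b t₀ ^ r := ENNReal.mul_rpow_of_nonneg _ _ hr.le
    _ ≤ _ := by
        gcongr
        exact Finset.single_le_sum (f := fun t => b t ^ r) (fun _ _ => zero_le)
          (Finset.mem_univ t₀)

/-- The weighted vector-valued maximal inequality. -/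
theorem exists_weightedNorm_vectorMaximal_le (𝕜 : Type*) [RCLike 𝕜] (n : ℕ) {p q : ℝ}
    (hp : 1 < p) (hq : 1 < q) :
    ∃ c : ℝ≥0, ∀ w : (Fin n → ℝ) → ℝ, IsAp p w →
      ∀ f : ℕ → (Fin n → ℝ) → 𝕜, (∀ j, AEStronglyMeasurable (f j) volume) →
        weightedNorm p w (vectorMaximal q f) ≤
          c * apConst p w ^ max (1 / q) (1 / (p - 1)) * weightedNorm p w (lqNorm q f) := by
  have hp0 : 0 < p := by linarith
  have hq0 : 0 < q := by linarith
  have hp1 : 0 < p - 1 := by linarith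
  set r := p / q with hr
  have hr0 : 0 < r := by positivity
  set m := max (1 / q) (1 / (p - 1)) with hm
  obtain ⟨C, hC⟩ := NestedPartition.lintegral_tsum_maxFn_rpow_le (X := Fin n → ℝ)
    (ι := Fin n → ℤ) (μ := volume) hp hq (D := 2 ^ n) (one_le_pow₀ (by norm_num))
  set T : ℝ≥0 := (Fintype.card (Fin n → Bool) : ℝ≥0) with hT
  refine ⟨((6 ^ n) ^ p * T ^ r * T * C) ^ (1 / p), fun w hw f hf => ?_⟩
  have hwm : AEMeasurable (fun x => ENNReal.ofReal (w x)) volume :=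
    hw.locallyIntegrable.aestronglyMeasurable.aemeasurable.ennreal_ofReal
  -- The partition estimates ask for genuinely measurable functions, so `w` and the `f l` are
  -- replaced by measurable representatives; averages over cubes and weighted integrals are
  -- unaffected.
  set W := hwm.mk _ with hWdef
  have hW : Measurable W := hwm.measurable_mk
  have hWw : (fun x => ENNReal.ofReal (w x)) =ᵐ[volume] W := hwm.ae_eq_mk
  have hfm : ∀ l, AEMeasurable (fun x => ‖f l x‖ₑ) volume := fun l => (hf l).enorm
  set g : ℕ → (Fin n → ℝ) → ℝ≥0∞ := fun l => (hfm l).mk _ with hgdef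
  have hg : ∀ l, Measurable (g l) := fun l => (hfm l).measurable_mk
  have hfg : ∀ l, (fun x => ‖f l x‖ₑ) =ᵐ[volume] g l := fun l => (hfm l).ae_eq_mk
  have hlq : ∀ᵐ x, lqNorm q f x = seqNorm q g x := by
    filter_upwards [ae_all_iff.2 hfg] with x hx
    simp only [lqNorm, seqNorm, hx]
  rw [weightedNorm_eq hp0, weightedNorm_eq hp0, withDensity_congr_ae hWw]
  set ω := (volume : Measure (Fin n → ℝ)).withDensity W with hω
  have hint : ∀ u : (Fin n → ℝ) → ℝ≥0∞, Measurable u → ∫⁻ x, u x ∂ω = ∫⁻ x, u x * W x := by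
    intro u hu
    rw [hω, lintegral_withDensity_eq_lintegral_mul _ hW hu]
    simp only [Pi.mul_apply, mul_comm]
  have hrhs : ∫⁻ x, lqNorm q f x ^ p ∂ω = ∫⁻ x, seqNorm q g x ^ p * W x := by
    rw [← hint _ ((measurable_seqNorm hg).pow_const p)]
    refine lintegral_congr_ae ((withDensity_absolutelyContinuous _ _).ae_le ?_)
    filter_upwards [hlq] with x hx
    rw [hx]
  set b : (Fin n → Bool) → ℕ → (Fin n → ℝ) → ℝ≥0∞ :=
    fun t N x => ∑' l, (dyadicGrid t N).maxFn volume (g l) x ^ q with hb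
  have hbm : ∀ t N, Measurable (b t N) := fun t N =>
    Measurable.tsum fun l => (NestedPartition.measurable_maxFn (g l)).pow_const q
  have hbmono : ∀ t x, Monotone fun N => b t N x := fun t x N N' h =>
    ENNReal.tsum_le_tsum fun l => ENNReal.rpow_le_rpow (dyadicGrid_maxFn_mono t (g l) x h) hq0.le
  -- The sum over the `2^n` grids replaces their supremum, and the increasing limit in `N` commutes
  -- with the sum over `l`, so that both can be taken outside the integral.
  have hpt : ∀ x, vectorMaximal q f x ^ p ≤
      (6 ^ n) ^ p * (T ^ r * ∑ t, ⨆ N, b t N x ^ r) := by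
    intro x
    have h1 : ∑' l, maximal (f l) x ^ q ≤ (6 ^ n) ^ q * ∑ t, ⨆ N, b t N x := by
      calc ∑' l, maximal (f l) x ^ q
          ≤ ∑' l, (6 ^ n) ^ q * ∑ t, ⨆ N : ℕ, (dyadicGrid t N).maxFn volume (g l) x ^ q := by
            refine ENNReal.tsum_le_tsum fun l => ?_
            refine (ENNReal.rpow_le_rpow (maximal_le (f l) (g l) (hfg l) x) hq0.le).trans ?_
            rw [ENNReal.mul_rpow_of_nonneg _ _ hq0.le, ENNReal.iSup_rpow _ hq0]
            gcongr
            refine iSup_le fun t => ?_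
            rw [ENNReal.iSup_rpow _ hq0]
            exact Finset.single_le_sum (f := fun t =>
              ⨆ N : ℕ, (dyadicGrid t N).maxFn volume (g l) x ^ q) (fun _ _ => zero_le)
              (Finset.mem_univ t)
        _ = (6 ^ n) ^ q * ∑ t, ⨆ N, b t N x := by
            rw [ENNReal.tsum_mul_left, Summable.tsum_finsetSum fun _ _ => ENNReal.summable]
            congr 1
            refine Finset.sum_congr rfl fun t _ => ?_
            exact ENNReal.tsum_iSup_of_monotone _ fun l N N' h =>
              ENNReal.rpow_le_rpow (dyadicGrid_maxFn_mono t (g l) x h) hq0.le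
    calc vectorMaximal q f x ^ p = (∑' l, maximal (f l) x ^ q) ^ r := by
          rw [vectorMaximal, ← ENNReal.rpow_mul, one_div_mul_eq_div]
      _ ≤ ((6 ^ n) ^ q * ∑ t, ⨆ N, b t N x) ^ r := ENNReal.rpow_le_rpow h1 hr0.le
      _ = (6 ^ n) ^ p * (∑ t, ⨆ N, b t N x) ^ r := by
          rw [ENNReal.mul_rpow_of_nonneg _ _ hr0.le, ← ENNReal.rpow_mul, hr,
            mul_div_cancel₀ _ hq0.ne']
      _ ≤ (6 ^ n) ^ p * (T ^ r * ∑ t, (⨆ N, b t N x) ^ r) := by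
          gcongr
          exact rpow_sum_le_card_rpow_mul hr0 _
      _ = _ := by simp_rw [ENNReal.iSup_rpow _ hr0]
  have hB : ∀ t, ∫⁻ x, ⨆ N, b t N x ^ r ∂ω ≤
      C * apConst p w ^ (p * m) * ∫⁻ x, seqNorm q g x ^ p * W x := by
    intro t
    rw [lintegral_iSup (fun N => (hbm t N).pow_const r)
      fun N N' h x => ENNReal.rpow_le_rpow (hbmono t x h) hr0.le]
    refine iSup_le fun N => ?_
    rw [hint _ ((hbm t N).pow_const r)]
    exact hC (dyadicGrid t N) (volume_cell_ne_top t N) (volume_cell_ne_zero t N)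
      (volume_cell_le t N) _ W _ (hw.apPair hp hW hWw t N) g hg
  have hmain : ∫⁻ x, vectorMaximal q f x ^ p ∂ω ≤ ((6 ^ n) ^ p * T ^ r * T * C : ℝ≥0) *
      apConst p w ^ (p * m) * ∫⁻ x, seqNorm q g x ^ p * W x := by
    have hsm : ∀ t, Measurable fun x => ⨆ N, b t N x ^ r := fun t =>
      Measurable.iSup fun N => (hbm t N).pow_const r
    calc ∫⁻ x, vectorMaximal q f x ^ p ∂ω
        ≤ ∫⁻ x, (6 ^ n) ^ p * (T ^ r * ∑ t, ⨆ N, b t N x ^ r) ∂ω := lintegral_mono hpt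
      _ = (6 ^ n) ^ p * (T ^ r * ∑ t, ∫⁻ x, ⨆ N, b t N x ^ r ∂ω) := by
          rw [lintegral_const_mul _ ((Finset.measurable_fun_sum _ fun t _ => hsm t).const_mul _),
            lintegral_const_mul _ (Finset.measurable_fun_sum _ fun t _ => hsm t),
            lintegral_finsetSum _ fun t _ => hsm t]
      _ ≤ (6 ^ n) ^ p * (T ^ r * ∑ _t : Fin n → Bool, (C * apConst p w ^ (p * m) *
            ∫⁻ x, seqNorm q g x ^ p * W x)) := by
          gcongr with t
          exact hB t
      _ = _ := by
          rw [Finset.sum_const, Finset.card_univ, nsmul_eq_mul]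
          simp only [ENNReal.coe_mul, ENNReal.coe_rpow_of_nonneg _ hp0.le,
            ENNReal.coe_rpow_of_nonneg _ hr0.le, hT]
          push_cast
          ring
  rw [hrhs]
  refine (ENNReal.rpow_le_rpow hmain (by positivity : 0 ≤ 1 / p)).trans (le_of_eq ?_)
  have h1p : 0 ≤ 1 / p := by positivity
  rw [ENNReal.mul_rpow_of_nonneg _ _ h1p, ENNReal.mul_rpow_of_nonneg _ _ h1p,
    ← ENNReal.rpow_mul, ENNReal.coe_rpow_of_nonneg _ h1p]
  congr 3
  field_simp

end VectorMaximal

/-! ### Power weights and their `A_p` constants. -/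

namespace VectorMaximal

variable {n : ℕ}

/-- The norm on `Fin n → ℝ` is the sup norm, so centred balls are cubes: radial integration computes
integrals over cubes, and centred balls are admissible in the maximal function. -/
lemma cube_neg_eq_closedBall {r : ℝ} (hr : 0 ≤ r) :
    cube (fun _ : Fin n => -r) (2 * r) = Metric.closedBall 0 r := by
  ext x
  simp only [cube, Set.mem_Icc, Pi.le_def, mem_closedBall_zero_iff, pi_norm_le_iff_of_nonneg hr,
    Real.norm_eq_abs, abs_le, ← forall_and]
  refine forall_congr' fun i => and_congr Iff.rfl ?_
  rw [show -r + 2 * r = r by ring]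

/-- The integral of `‖x‖^{γ-n}` over a ball centred at the origin. -/
lemma lintegral_closedBall_norm_rpow (hn : 0 < n) {γ R : ℝ} (hγ : 0 < γ) (hR : 0 ≤ R) :
    ∫⁻ x in Metric.closedBall (0 : Fin n → ℝ) R, ENNReal.ofReal (‖x‖ ^ (γ - n)) =
      ENNReal.ofReal (n * 2 ^ n * R ^ γ / γ) := by
  have : Nonempty (Fin n) := Fin.pos_iff_nonempty.1 hn
  set h : ℝ → ℝ := (Set.Iic R).indicator fun y => y ^ (γ - n) with hh
  have hdim : Module.finrank ℝ (Fin n → ℝ) = n := Module.finrank_fin_fun ℝ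
  have hprod : ∀ y ∈ Set.Ioi (0 : ℝ), y ^ (n - 1) • h y =
      (Set.Iic R).indicator (fun y => y ^ (γ - 1)) y := by
    intro y hy
    by_cases hyR : y ∈ Set.Iic R
    · simp only [hh, Set.indicator_of_mem hyR, smul_eq_mul]
      rw [← Real.rpow_natCast, ← Real.rpow_add hy, Nat.cast_sub hn]
      congr 1
      push_cast
      ring
    · simp [hh, Set.indicator_of_notMem hyR]
  have hII : IntervalIntegrable (fun y : ℝ => y ^ (γ - 1)) volume 0 R :=
    intervalIntegral.intervalIntegrable_rpow' (by linarith)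
  have hIoc : Set.Iic R ∩ Set.Ioi (0 : ℝ) = Set.Ioc 0 R := by
    ext y; simp only [Set.mem_inter_iff, Set.mem_Iic, Set.mem_Ioi, Set.mem_Ioc]; tauto
  have hint : Integrable (fun x : Fin n → ℝ => h ‖x‖) volume := by
    rw [integrable_fun_norm_addHaar, hdim, integrableOn_congr_fun hprod measurableSet_Ioi,
      IntegrableOn, integrable_indicator_iff measurableSet_Iic, IntegrableOn,
      Measure.restrict_restrict measurableSet_Iic, hIoc]
    exact (intervalIntegrable_iff_integrableOn_Ioc_of_le hR).1 hII
  have hval : ∫ x : Fin n → ℝ, h ‖x‖ = n * 2 ^ n * R ^ γ / γ := by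
    rw [integral_fun_norm_addHaar, hdim, setIntegral_congr_fun measurableSet_Ioi hprod,
      integral_indicator measurableSet_Iic, Measure.restrict_restrict measurableSet_Iic, hIoc,
      ← intervalIntegral.integral_of_le hR, integral_rpow (Or.inl (by linarith)), Measure.real,
      Real.volume_pi_ball _ one_pos]
    simp [hγ.ne']
    ring
  have hnn : ∀ x : Fin n → ℝ, 0 ≤ h ‖x‖ := fun x => by
    by_cases hx : ‖x‖ ∈ Set.Iic R
    · simp only [hh, Set.indicator_of_mem hx]; positivity
    · simp [hh, Set.indicator_of_notMem hx]
  rw [← hval, ofReal_integral_eq_lintegral_ofReal hint (Filter.Eventually.of_forall hnn),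
    ← lintegral_indicator Metric.isClosed_closedBall.measurableSet]
  refine lintegral_congr fun x => ?_
  by_cases hx : ‖x‖ ≤ R
  · rw [Set.indicator_of_mem (by simpa using hx)]
    simp [hh, hx]
  · rw [Set.indicator_of_notMem (by simpa using hx)]
    simp [hh, hx]

/-- The weight `‖x‖^{γ-n}` satisfies the `A_1` condition with constant `n 4^n / γ`. -/
lemma exists_lintegral_cube_norm_rpow_le (hn : 0 < n) {γ : ℝ} (hγ : 0 < γ) (hγ1 : γ ≤ 1)
    (a : Fin n → ℝ) {l : ℝ} (hl : 0 < l) :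
    ∃ R : ℝ, 0 < R ∧ (∀ y ∈ cube a l, ‖y‖ ≤ R) ∧
      ∫⁻ y in cube a l, ENNReal.ofReal (‖y‖ ^ (γ - n)) ≤
        ENNReal.ofReal (n * 4 ^ n / γ * R ^ (γ - n)) * volume (cube a l) := by
  have : Nonempty (Fin n) := Fin.pos_iff_nonempty.1 hn
  have hn1 : (1 : ℝ) ≤ n := by exact_mod_cast hn
  set b : Fin n → ℝ := fun i => a i + l with hb
  set R := max ‖a‖ ‖b‖ with hR
  have hdist : ∀ y ∈ cube a l, R ≤ ‖y‖ + l := by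
    intro y hy
    have h1 : ‖a - y‖ ≤ l := by
      refine (pi_norm_le_iff_of_nonneg hl.le).2 fun i => ?_
      have := hy.1 i; have := hy.2 i
      rw [Pi.sub_apply, Real.norm_eq_abs, abs_le]
      constructor <;> linarith
    have h2 : ‖b - y‖ ≤ l := by
      refine (pi_norm_le_iff_of_nonneg hl.le).2 fun i => ?_
      have := hy.1 i; have := hy.2 i
      rw [Pi.sub_apply, Real.norm_eq_abs, abs_le]
      constructor <;> simp only [hb] <;> linarith
    refine max_le ?_ ?_
    · have := norm_add_le y (a - y); rw [add_sub_cancel] at this; linarith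
    · have := norm_add_le y (b - y); rw [add_sub_cancel] at this; linarith
  have hle : ∀ y ∈ cube a l, ‖y‖ ≤ R := by
    intro y hy
    refine (pi_norm_le_iff_of_nonneg (le_max_of_le_left (norm_nonneg a))).2 fun i => ?_
    have h1 := hy.1 i
    have h2 : y i ≤ b i := hy.2 i
    have h3 : |a i| ≤ R := (norm_le_pi_norm a i).trans (le_max_left _ _)
    have h4 : |b i| ≤ R := (norm_le_pi_norm b i).trans (le_max_right _ _)
    rw [abs_le] at h3 h4
    rw [Real.norm_eq_abs, abs_le]
    constructor <;> linarith
  have hRpos : 0 < R := by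
    have h1 : ‖b - a‖ = l := by
      have : b - a = fun _ => l := by ext i; simp [hb]
      rw [this, pi_norm_const, Real.norm_of_nonneg hl.le]
    have h2 := norm_sub_le b a
    rcases lt_or_ge 0 R with h | h
    · exact h
    · have := (le_max_left ‖a‖ ‖b‖).trans h
      have := (le_max_right ‖a‖ ‖b‖).trans h
      linarith
  refine ⟨R, hRpos, hle, ?_⟩
  have hexp : γ - n ≤ 0 := by linarith
  have hconst : (2 : ℝ) ^ n ≤ n * 4 ^ n / γ := by
    rw [le_div_iff₀ hγ]
    have h24 : (2 : ℝ) ^ n ≤ 4 ^ n := by gcongr; norm_num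
    have : (0 : ℝ) < 2 ^ n := by positivity
    nlinarith
  -- A small cube far from the origin has `‖y‖ ≥ R/2` throughout, so the weight is comparable to
  -- `R^{γ-n}`. Otherwise `R < 2l`, and integrating over the whole ball of radius `R` loses only a
  -- dimensional factor besides the `1/γ`.
  rcases le_or_gt (2 * l) R with hc | hc
  · rw [← setLIntegral_const]
    refine setLIntegral_mono' measurableSet_Icc fun y hy => ENNReal.ofReal_le_ofReal ?_
    have hy2 : R / 2 ≤ ‖y‖ := by have := hdist y hy; linarith
    calc ‖y‖ ^ (γ - n) ≤ (R / 2) ^ (γ - n) :=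
          Real.rpow_le_rpow_of_nonpos (by positivity) hy2 hexp
      _ = 2 ^ (n - γ) * R ^ (γ - n) := by
          rw [div_eq_inv_mul, Real.mul_rpow (by norm_num) hRpos.le,
            Real.inv_rpow (by norm_num), ← Real.rpow_neg (by norm_num), neg_sub]
      _ ≤ n * 4 ^ n / γ * R ^ (γ - n) := by
          gcongr
          refine le_trans ?_ hconst
          rw [← Real.rpow_natCast]
          exact Real.rpow_le_rpow_of_exponent_le (by norm_num) (by linarith)
  · calc ∫⁻ y in cube a l, ENNReal.ofReal (‖y‖ ^ (γ - n))
        ≤ ∫⁻ y in Metric.closedBall (0 : Fin n → ℝ) R, ENNReal.ofReal (‖y‖ ^ (γ - n)) :=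
          lintegral_mono_set fun y hy => by simpa using hle y hy
      _ = ENNReal.ofReal (n * 2 ^ n * R ^ γ / γ) :=
          lintegral_closedBall_norm_rpow hn hγ hRpos.le
      _ ≤ ENNReal.ofReal (n * 4 ^ n / γ * R ^ (γ - n) * l ^ n) := by
          refine ENNReal.ofReal_le_ofReal ?_
          have h1 : R ^ γ = R ^ (γ - n) * R ^ n := by
            rw [← Real.rpow_natCast, ← Real.rpow_add hRpos]; congr 1; ring
          have h2 : R ^ n ≤ (2 * l) ^ n := by gcongr
          have h3 : (4 : ℝ) ^ n = 2 ^ n * 2 ^ n := by rw [← mul_pow]; norm_num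
          calc n * 2 ^ n * R ^ γ / γ = n * 2 ^ n / γ * R ^ (γ - n) * R ^ n := by rw [h1]; ring
            _ ≤ n * 2 ^ n / γ * R ^ (γ - n) * (2 * l) ^ n := by gcongr
            _ = _ := by rw [mul_pow, h3]; ring
      _ = _ := by
          rw [volume_cube, ENNReal.ofReal_mul (by positivity), ENNReal.ofReal_pow hl.le]

lemma ae_norm_pos (hn : 0 < n) : ∀ᵐ x : Fin n → ℝ, 0 < ‖x‖ := by
  have : Nonempty (Fin n) := Fin.pos_iff_nonempty.1 hn
  filter_upwards [Measure.ae_ne volume (0 : Fin n → ℝ)] with x hx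
  exact norm_pos_iff.2 hx

lemma ofReal_rpow_conj {p : ℝ} (hp : 1 < p) {y : ℝ} (hy : 0 < y) :
    ENNReal.ofReal y ^ (1 - Real.conjExponent p) = ENNReal.ofReal (y ^ (-(p - 1)⁻¹)) := by
  rw [one_sub_conjExponent hp, ENNReal.ofReal_rpow_of_pos hy]

lemma setLAverage_le_of_ae_le {s : Set (Fin n → ℝ)} (hs : MeasurableSet s)
    {u : (Fin n → ℝ) → ℝ≥0∞} {c : ℝ≥0∞} (h : ∀ᵐ y, y ∈ s → u y ≤ c) :
    ⨍⁻ y in s, u y ∂volume ≤ c := by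
  rw [setLAverage_eq]
  refine ENNReal.div_le_of_le_mul ?_
  rw [← setLIntegral_const]
  exact lintegral_mono_ae ((ae_restrict_iff' hs).2 h)

lemma setLAverage_cube_norm_rpow_le (hn : 0 < n) {γ : ℝ} (hγ : 0 < γ) (hγ1 : γ ≤ 1)
    (a : Fin n → ℝ) {l : ℝ} (hl : 0 < l) :
    ∃ R : ℝ, 0 < R ∧ (∀ y ∈ cube a l, ‖y‖ ≤ R) ∧
      ⨍⁻ y in cube a l, ENNReal.ofReal (‖y‖ ^ (γ - n)) ∂volume ≤
        ENNReal.ofReal (n * 4 ^ n / γ * R ^ (γ - n)) := by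
  obtain ⟨R, hR, hle, h⟩ := exists_lintegral_cube_norm_rpow_le hn hγ hγ1 a hl
  refine ⟨R, hR, hle, ?_⟩
  rw [setLAverage_eq]
  exact ENNReal.div_le_of_le_mul h

/-- The exponent `γ - n` is nonpositive, so the weight is at least `R^{γ-n}` on the cube. This
bounds the dual factor pointwise, and the powers of `R` cancel against those in the `A_1` bound. -/
lemma apConst_norm_rpow_le (hn : 0 < n) {p γ : ℝ} (hp : 1 < p) (hγ : 0 < γ) (hγ1 : γ ≤ 1) :
    apConst p (fun x : Fin n → ℝ => ‖x‖ ^ (γ - n)) ≤ ENNReal.ofReal (n * 4 ^ n / γ) := by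
  have hp1 : 0 < p - 1 := by linarith
  have hn1 : (1 : ℝ) ≤ n := by exact_mod_cast hn
  refine iSup_le fun a => iSup_le fun l => iSup_le fun hl => ?_
  obtain ⟨R, hR, hle, h⟩ := setLAverage_cube_norm_rpow_le hn hγ hγ1 a hl
  have hdual : ⨍⁻ y in cube a l, ENNReal.ofReal (‖y‖ ^ (γ - n)) ^ (1 - Real.conjExponent p)
      ∂volume ≤ ENNReal.ofReal ((R ^ (γ - n)) ^ (-(p - 1)⁻¹)) := by
    refine setLAverage_le_of_ae_le measurableSet_Icc ?_
    filter_upwards [ae_norm_pos hn] with y hy hyQ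
    rw [ofReal_rpow_conj hp (by positivity)]
    refine ENNReal.ofReal_le_ofReal ?_
    refine Real.rpow_le_rpow_of_nonpos (by positivity)
      (Real.rpow_le_rpow_of_nonpos hy (hle y hyQ) (by linarith)) ?_
    rw [neg_nonpos]; positivity
  calc _ ≤ ENNReal.ofReal (n * 4 ^ n / γ * R ^ (γ - n)) *
        ENNReal.ofReal ((R ^ (γ - n)) ^ (-(p - 1)⁻¹)) ^ (p - 1) := by gcongr
    _ = ENNReal.ofReal (n * 4 ^ n / γ) := by
        rw [ENNReal.ofReal_rpow_of_pos (by positivity), ← ENNReal.ofReal_mul (by positivity),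
          ← Real.rpow_mul (by positivity), neg_mul, inv_mul_cancel₀ hp1.ne', Real.rpow_neg_one,
          mul_assoc, mul_inv_cancel₀ (by positivity), mul_one]

/-- The roles are exchanged: the dual weight is now the `A_1` weight, and its average enters to the
power `p - 1`. -/
lemma apConst_norm_rpow_dual_le (hn : 0 < n) {p γ : ℝ} (hp : 1 < p) (hγ : 0 < γ) (hγ1 : γ ≤ 1) :
    apConst p (fun x : Fin n → ℝ => (‖x‖ ^ (γ - n)) ^ (-(p - 1))) ≤
      ENNReal.ofReal (n * 4 ^ n / γ) ^ (p - 1) := by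
  have hp1 : 0 < p - 1 := by linarith
  have hn1 : (1 : ℝ) ≤ n := by exact_mod_cast hn
  refine iSup_le fun a => iSup_le fun l => iSup_le fun hl => ?_
  obtain ⟨R, hR, hle, h⟩ := setLAverage_cube_norm_rpow_le hn hγ hγ1 a hl
  have hw : ⨍⁻ y in cube a l, ENNReal.ofReal ((‖y‖ ^ (γ - n)) ^ (-(p - 1))) ∂volume ≤
      ENNReal.ofReal ((R ^ (γ - n)) ^ (-(p - 1))) := by
    refine setLAverage_le_of_ae_le measurableSet_Icc ?_
    filter_upwards [ae_norm_pos hn] with y hy hyQ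
    refine ENNReal.ofReal_le_ofReal ?_
    exact Real.rpow_le_rpow_of_nonpos (by positivity)
      (Real.rpow_le_rpow_of_nonpos hy (hle y hyQ) (by linarith)) (by linarith)
  have hdual : ⨍⁻ y in cube a l, ENNReal.ofReal ((‖y‖ ^ (γ - n)) ^ (-(p - 1))) ^
      (1 - Real.conjExponent p) ∂volume =
        ⨍⁻ y in cube a l, ENNReal.ofReal (‖y‖ ^ (γ - n)) ∂volume := by
    refine laverage_congr (ae_restrict_of_ae ?_)
    filter_upwards [ae_norm_pos hn] with y hy
    rw [ofReal_rpow_conj hp (by positivity), ← Real.rpow_mul (by positivity), neg_mul_neg,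
      mul_inv_cancel₀ hp1.ne', Real.rpow_one]
  rw [hdual]
  calc _ ≤ ENNReal.ofReal ((R ^ (γ - n)) ^ (-(p - 1))) *
        ENNReal.ofReal (n * 4 ^ n / γ * R ^ (γ - n)) ^ (p - 1) := by gcongr
    _ = ENNReal.ofReal (n * 4 ^ n / γ) ^ (p - 1) := by
        rw [ENNReal.ofReal_mul (by positivity), ENNReal.mul_rpow_of_nonneg _ _ hp1.le,
          ENNReal.ofReal_rpow_of_pos (p := p - 1) (x := R ^ (γ - n)) (by positivity), mul_left_comm,
          ← ENNReal.ofReal_mul (by positivity), ← Real.rpow_add (by positivity), neg_add_cancel,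
          Real.rpow_zero, ENNReal.ofReal_one, mul_one]

lemma one_le_apConst {p : ℝ} (hp : 1 < p) {w : (Fin n → ℝ) → ℝ} (hw : Measurable w)
    (hpos : ∀ᵐ x, 0 < w x) : 1 ≤ apConst p w := by
  have hp1 : 0 < p - 1 := by linarith
  have h1 := lintegral_cube_mul_le hp w (0 : Fin n → ℝ) one_pos
  have h2 := measure_univ_rpow_le (ν := volume.restrict (cube (0 : Fin n → ℝ) 1))
    hw.ennreal_ofReal (hw.ennreal_ofReal.pow_const (1 - Real.conjExponent p)) hp1.le (by
      filter_upwards [ae_restrict_of_ae hpos] with x hx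
      rw [← ENNReal.rpow_mul, one_sub_conjExponent hp, neg_mul, inv_mul_cancel₀ hp1.ne',
        ENNReal.rpow_neg, ENNReal.rpow_one, ENNReal.mul_inv_cancel (by simpa using hx) (by simp)])
  rw [Measure.restrict_apply_univ, volume_cube] at h2
  rw [volume_cube] at h1
  simpa using h2.trans h1

/-- For negative `β` an upper bound on the `A_p` constant says nothing about its `β`-th power. As
the constant is at least `1`, the exponent may first be raised to `max β 0`. -/
lemma apConst_rpow_le {p β : ℝ} {K : ℝ≥0∞} {w : (Fin n → ℝ) → ℝ} (h1 : 1 ≤ apConst p w)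
    (hK : apConst p w ≤ K) : apConst p w ^ β ≤ K ^ max β 0 :=
  (ENNReal.rpow_le_rpow_of_exponent_le h1 (le_max_left β 0)).trans
    (ENNReal.rpow_le_rpow hK (le_max_right β 0))

lemma isAp_norm_rpow (hn : 0 < n) {p γ : ℝ} (hp : 1 < p) (hγ : 0 < γ) (hγ1 : γ ≤ 1) :
    IsAp p (fun x : Fin n → ℝ => ‖x‖ ^ (γ - n)) where
  locallyIntegrable x := by
    refine ⟨Metric.closedBall 0 (‖x‖ + 1), ?_, ?_⟩
    · exact Filter.mem_of_superset (Metric.isOpen_ball.mem_nhds (by simp))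
        Metric.ball_subset_closedBall
    · refine ⟨(measurable_norm.pow_const _).aestronglyMeasurable, ?_⟩
      have h := lintegral_closedBall_norm_rpow hn hγ (R := ‖x‖ + 1) (by positivity)
      rw [HasFiniteIntegral]
      refine lt_of_le_of_lt (le_of_eq ?_) (h.trans_lt ENNReal.ofReal_lt_top)
      exact lintegral_congr fun y => Real.enorm_of_nonneg (by positivity)
  pos := by filter_upwards [ae_norm_pos hn] with x hx; positivity
  apConst_lt_top := (apConst_norm_rpow_le hn hp hγ hγ1).trans_lt ENNReal.ofReal_lt_top

lemma isAp_norm_rpow_dual (hn : 0 < n) {p γ : ℝ} (hp : 1 < p) (hγ : 0 < γ) (hγ1 : γ ≤ 1) :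
    IsAp p (fun x : Fin n → ℝ => (‖x‖ ^ (γ - n)) ^ (-(p - 1))) where
  locallyIntegrable := by
    have hn1 : (1 : ℝ) ≤ n := by exact_mod_cast hn
    have : (fun x : Fin n → ℝ => (‖x‖ ^ (γ - n)) ^ (-(p - 1))) =
        fun x => ‖x‖ ^ ((γ - n) * (-(p - 1))) := by
      ext x; rw [← Real.rpow_mul (norm_nonneg x)]
    rw [this]
    exact (continuous_norm.rpow_const fun x => Or.inr (by nlinarith)).locallyIntegrable
  pos := by filter_upwards [ae_norm_pos hn] with x hx; positivity
  apConst_lt_top := (apConst_norm_rpow_dual_le hn hp hγ hγ1).trans_lt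
    (ENNReal.rpow_lt_top_of_nonneg (by linarith) ENNReal.ofReal_ne_top)

/-- A larger power of `m` eventually dominates. -/
lemma exists_nat_mul_rpow_lt {a b θ τ : ℝ} (hb : 0 < b) (hθτ : θ < τ) :
    ∃ m : ℕ, 0 < m ∧ a * (m : ℝ) ^ θ < b * (m : ℝ) ^ τ := by
  have ht : Filter.Tendsto (fun m : ℕ => (m : ℝ) ^ (τ - θ)) Filter.atTop Filter.atTop :=
    (tendsto_rpow_atTop (by linarith)).comp tendsto_natCast_atTop_atTop
  obtain ⟨m, hm1, hm2⟩ := ((ht.eventually_gt_atTop (a / b)).and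
    (Filter.eventually_gt_atTop 0)).exists
  refine ⟨m, hm2, ?_⟩
  have hm0 : (0 : ℝ) < m := by exact_mod_cast hm2
  rw [div_lt_iff₀ hb] at hm1
  have : (m : ℝ) ^ τ = (m : ℝ) ^ (τ - θ) * (m : ℝ) ^ θ := by
    rw [← Real.rpow_add hm0]; congr 1; ring
  rw [this]
  have hp : (0 : ℝ) < (m : ℝ) ^ θ := by positivity
  nlinarith

end VectorMaximal

/-! ### Examples showing sharpness. -/

namespace VectorMaximal

variable {n : ℕ} {𝕜 : Type*} [RCLike 𝕜]

lemma weightedNorm_const_mul_le {p : ℝ} (hp : 0 < p) (w : (Fin n → ℝ) → ℝ) {k : ℝ≥0∞}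
    {g h : (Fin n → ℝ) → ℝ≥0∞} (hgh : ∀ᵐ x, k * g x ≤ h x) :
    k * weightedNorm p w g ≤ weightedNorm p w h := by
  rw [weightedNorm_eq hp, weightedNorm_eq hp]
  set ω := (volume : Measure (Fin n → ℝ)).withDensity fun x => ENNReal.ofReal (w x)
  have h1 : k ^ p * ∫⁻ x, g x ^ p ∂ω ≤ ∫⁻ x, h x ^ p ∂ω := by
    refine (lintegral_const_mul_le _ _).trans (lintegral_mono_ae ?_)
    refine (withDensity_absolutelyContinuous _ _).ae_le ?_
    filter_upwards [hgh] with x hx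
    rw [← ENNReal.mul_rpow_of_nonneg _ _ hp.le]
    exact ENNReal.rpow_le_rpow hx hp.le
  calc k * (∫⁻ x, g x ^ p ∂ω) ^ (1 / p) = (k ^ p * ∫⁻ x, g x ^ p ∂ω) ^ (1 / p) := by
        rw [ENNReal.mul_rpow_of_nonneg _ _ (by positivity), ← ENNReal.rpow_mul,
          mul_one_div_cancel hp.ne', ENNReal.rpow_one]
    _ ≤ _ := ENNReal.rpow_le_rpow h1 (by positivity)

lemma setLAverage_closedBall_le_maximal (f : (Fin n → ℝ) → 𝕜) {r : ℝ} (hr : 0 < r)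
    {x : Fin n → ℝ} (hx : ‖x‖ ≤ r) :
    ⨍⁻ y in Metric.closedBall 0 r, ‖f y‖ₑ ∂volume ≤ maximal f x := by
  rw [← cube_neg_eq_closedBall hr.le]
  refine le_iSup_of_le (fun _ => -r) (le_iSup_of_le (2 * r) (le_iSup_of_le (by positivity)
    (le_iSup_of_le ?_ le_rfl)))
  rw [cube_neg_eq_closedBall hr.le]
  simpa using hx

lemma maximal_le_vectorMaximal {q : ℝ} (hq : 0 < q) (f : ℕ → (Fin n → ℝ) → 𝕜) (j : ℕ)
    (x : Fin n → ℝ) : maximal (f j) x ≤ vectorMaximal q f x := by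
  rw [← ENNReal.rpow_le_rpow_iff hq, vectorMaximal, ← ENNReal.rpow_mul,
    one_div_mul_cancel hq.ne', ENNReal.rpow_one]
  exact ENNReal.le_tsum (f := fun j => maximal (f j) x ^ q) j

lemma volume_closedBall_zero {r : ℝ} (hr : 0 ≤ r) :
    volume (Metric.closedBall (0 : Fin n → ℝ) r) = ENNReal.ofReal (2 * r) ^ n := by
  rw [← cube_neg_eq_closedBall hr, volume_cube]

/-- The exponent `1/(p-1)` cannot be improved. -/
theorem exists_lt_of_lt_one_div_sub_one (𝕜 : Type*) [RCLike 𝕜] (hn : 0 < n) {p q : ℝ}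
    (hp : 1 < p) (hq : 1 < q) {β : ℝ} (hβ : β < 1 / (p - 1)) (c : ℝ≥0) :
    ∃ w : (Fin n → ℝ) → ℝ, IsAp p w ∧
      ∃ f : ℕ → (Fin n → ℝ) → 𝕜, (∀ j, AEStronglyMeasurable (f j) volume) ∧
        c * apConst p w ^ β * weightedNorm p w (lqNorm q f) <
          weightedNorm p w (vectorMaximal q f) := by
  have hp0 : 0 < p := by linarith
  have hq0 : 0 < q := by linarith
  have hp1 : 0 < p - 1 := by linarith
  have hn0 : (0 : ℝ) < n := by exact_mod_cast hn
  set θ := (p - 1) * max β 0 with hθ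
  have hθ0 : 0 ≤ θ := by positivity
  have hθ1 : θ < 1 := by
    rw [hθ, mul_comm, ← lt_div_iff₀ hp1]
    exact max_lt hβ (by positivity)
  -- The `A_p` side grows at most like `m^θ` with `θ < 1`, while the maximal function gains the
  -- factor `nm`; `m` is taken large enough for the gain to win.
  obtain ⟨m, hm, hlt⟩ := exists_nat_mul_rpow_lt (a := c * (n * 4 ^ n : ℝ) ^ θ) hn0 hθ1
  have hm0 : (0 : ℝ) < m := by exact_mod_cast hm
  have hm1 : (1 : ℝ) ≤ m := by exact_mod_cast hm
  set γ : ℝ := 1 / m with hγ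
  have hγ0 : 0 < γ := by positivity
  have hγ1 : γ ≤ 1 := by rw [hγ, div_le_one hm0]; exact hm1
  set u : (Fin n → ℝ) → ℝ := fun x => ‖x‖ ^ (γ - n) with hu
  have hu0 : ∀ x, 0 ≤ u x := fun x => by positivity
  have hum : Measurable u := measurable_norm.pow_const _
  set w : (Fin n → ℝ) → ℝ := fun x => u x ^ (-(p - 1)) with hw
  have hwA : IsAp p w := isAp_norm_rpow_dual hn hp hγ0 hγ1
  have hwm : Measurable w := hum.pow_const _
  set B : Set (Fin n → ℝ) := Metric.closedBall 0 1 with hB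
  have hBm : MeasurableSet B := Metric.isClosed_closedBall.measurableSet
  set f : ℕ → (Fin n → ℝ) → 𝕜 := fun j x => if j = 0 then ((B.indicator u x : ℝ) : 𝕜) else 0
    with hf
  have hfm : ∀ j, Measurable (f j) := by
    intro j
    by_cases hj : j = 0
    · simp only [hf, hj, if_true]
      exact RCLike.measurable_ofReal.comp (hum.indicator hBm)
    · simp only [hf, hj, if_false]
      exact measurable_const
  refine ⟨w, hwA, f, fun j => (hfm j).aestronglyMeasurable, ?_⟩
  have hf0 : ∀ x, ‖f 0 x‖ₑ = B.indicator (fun x => ENNReal.ofReal (u x)) x := by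
    intro x
    simp only [hf, if_true]
    rw [← ofReal_norm, RCLike.norm_ofReal]
    by_cases hx : x ∈ B
    · simp [hx, abs_of_nonneg (hu0 x)]
    · simp [hx]
  have hlq : lqNorm q f = B.indicator fun x => ENNReal.ofReal (u x) := by
    ext x
    rw [lqNorm, tsum_eq_single 0 (fun j hj => by simp [hf, hj, hq0]), ← ENNReal.rpow_mul,
      mul_one_div_cancel hq0.ne', ENNReal.rpow_one, hf0]
  have hN : weightedNorm p w (lqNorm q f) = ENNReal.ofReal (n * 2 ^ n * m) ^ (1 / p) := by
    rw [weightedNorm_eq hp0, hlq, lintegral_withDensity_eq_lintegral_mul _ hwm.ennreal_ofReal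
      ((hum.ennreal_ofReal.indicator hBm).pow_const p)]
    have h1 := lintegral_closedBall_norm_rpow hn hγ0 zero_le_one
    rw [Real.one_rpow, mul_one, hγ, div_div_eq_mul_div, div_one] at h1
    rw [← h1, ← lintegral_indicator hBm]
    congr 1
    refine lintegral_congr_ae ?_
    filter_upwards [ae_norm_pos hn] with x hx
    simp only [Pi.mul_apply]
    by_cases hxB : x ∈ B
    · rw [Set.indicator_of_mem hxB]
      have hux : 0 < u x := by positivity
      rw [ENNReal.ofReal_rpow_of_pos hux, ← ENNReal.ofReal_mul (by positivity)]
      congr 1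
      simp only [hw]
      rw [← Real.rpow_add hux, show -(p - 1) + p = 1 by ring, Real.rpow_one]
    · rw [Set.indicator_of_notMem hxB, ENNReal.zero_rpow_of_pos hp0, mul_zero]
  -- At a nonzero `x` in the unit ball, the centred ball of radius `‖x‖` has `u`-average `n 2^n
  -- ‖x‖^γ / γ` divided by `(2‖x‖)^n`, which is exactly `n m u(x)`.
  have hV : ENNReal.ofReal (n * m) * weightedNorm p w (lqNorm q f) ≤
      weightedNorm p w (vectorMaximal q f) := by
    refine weightedNorm_const_mul_le hp0 w ?_
    filter_upwards [ae_norm_pos hn] with x hx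
    rw [hlq]
    by_cases hxB : x ∈ B
    · have hx1 : ‖x‖ ≤ 1 := by simpa [hB] using hxB
      refine le_trans ?_ ((setLAverage_closedBall_le_maximal (f 0) hx le_rfl).trans
        (maximal_le_vectorMaximal hq0 f 0 x))
      have hsub : Metric.closedBall (0 : Fin n → ℝ) ‖x‖ ⊆ B := Metric.closedBall_subset_closedBall hx1
      rw [Set.indicator_of_mem hxB, setLAverage_eq, volume_closedBall_zero hx.le,
        setLIntegral_congr_fun Metric.isClosed_closedBall.measurableSet
          (g := fun x => ENNReal.ofReal (u x))
          (fun y hy => by simp only [hf0]; rw [Set.indicator_of_mem (hsub hy)]),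
        lintegral_closedBall_norm_rpow hn hγ0 hx.le, ENNReal.le_div_iff_mul_le
          (Or.inl (pow_ne_zero _ (by simpa using hx))) (Or.inl (ENNReal.pow_ne_top ENNReal.ofReal_ne_top)),
        ← ENNReal.ofReal_mul (by positivity), ← ENNReal.ofReal_pow (by positivity),
        ← ENNReal.ofReal_mul (by positivity)]
      refine ENNReal.ofReal_le_ofReal (le_of_eq ?_)
      have h1 : ‖x‖ ^ γ = ‖x‖ ^ (γ - n) * ‖x‖ ^ n := by
        rw [← Real.rpow_natCast, ← Real.rpow_add hx]; congr 1; ring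
      rw [h1, hu, mul_pow, hγ]
      field_simp
    · rw [Set.indicator_of_notMem hxB, mul_zero]
      exact zero_le
  refine lt_of_lt_of_le ?_ hV
  have hN0 : weightedNorm p w (lqNorm q f) ≠ 0 := by
    rw [hN]
    refine ENNReal.rpow_ne_zero_of_ne ?_ ENNReal.ofReal_ne_top _
    simp only [ne_eq, ENNReal.ofReal_eq_zero, not_le]; positivity
  have hNt : weightedNorm p w (lqNorm q f) ≠ ∞ := by
    rw [hN]
    exact ENNReal.rpow_ne_top_of_nonneg (by positivity) ENNReal.ofReal_ne_top
  refine (ENNReal.mul_lt_mul_iff_left hN0 hNt).2 ?_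
  calc c * apConst p w ^ β
      ≤ c * (ENNReal.ofReal (n * 4 ^ n / γ) ^ (p - 1)) ^ max β 0 := by
        gcongr
        exact apConst_rpow_le (one_le_apConst hp hwm hwA.pos)
          (apConst_norm_rpow_dual_le hn hp hγ0 hγ1)
    _ = ENNReal.ofReal (c * (n * 4 ^ n : ℝ) ^ θ * m ^ θ) := by
        rw [← ENNReal.rpow_mul, ← hθ, ENNReal.ofReal_rpow_of_nonneg (by positivity) hθ0,
          ← ENNReal.ofReal_coe_nnreal, ← ENNReal.ofReal_mul (by positivity), mul_assoc (c : ℝ),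
          ← Real.mul_rpow (by positivity) (by positivity), hγ, div_div_eq_mul_div, div_one]
    _ < ENNReal.ofReal (n * m) := by
        rw [Real.rpow_one] at hlt
        exact (ENNReal.ofReal_lt_ofReal_iff (by positivity)).2 hlt

lemma weightedNorm_indicator_closedBall (hn : 0 < n) {p γ R : ℝ} (hp : 0 < p) (hγ : 0 < γ)
    (hR : 0 ≤ R) :
    weightedNorm p (fun x : Fin n → ℝ => ‖x‖ ^ (γ - n))
      ((Metric.closedBall 0 R).indicator fun _ => 1) =
      ENNReal.ofReal (n * 2 ^ n * R ^ γ / γ) ^ (1 / p) := by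
  have hBm : MeasurableSet (Metric.closedBall (0 : Fin n → ℝ) R) :=
    Metric.isClosed_closedBall.measurableSet
  rw [weightedNorm_eq hp, lintegral_withDensity_eq_lintegral_mul _
    (measurable_norm.pow_const _).ennreal_ofReal
    ((measurable_const.indicator hBm).pow_const p), ← lintegral_closedBall_norm_rpow hn hγ hR,
    ← lintegral_indicator hBm]
  congr 1
  refine lintegral_congr fun x => ?_
  by_cases hx : x ∈ Metric.closedBall (0 : Fin n → ℝ) R
  · simp only [Pi.mul_apply, Set.indicator_of_mem hx, ENNReal.one_rpow, mul_one]
  · simp only [Pi.mul_apply, Set.indicator_of_notMem hx, ENNReal.zero_rpow_of_pos hp, mul_zero]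

/-- The exponent `1/q` cannot be improved. -/
theorem exists_lt_of_lt_one_div (𝕜 : Type*) [RCLike 𝕜] (hn : 0 < n) {p q : ℝ}
    (hp : 1 < p) (hq : 1 < q) {β : ℝ} (hβ : β < 1 / q) (c : ℝ≥0) :
    ∃ w : (Fin n → ℝ) → ℝ, IsAp p w ∧
      ∃ f : ℕ → (Fin n → ℝ) → 𝕜, (∀ j, AEStronglyMeasurable (f j) volume) ∧
        c * apConst p w ^ β * weightedNorm p w (lqNorm q f) <
          weightedNorm p w (vectorMaximal q f) := by
  have hp0 : 0 < p := by linarith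
  have hq0 : 0 < q := by linarith
  have hn0 : (0 : ℝ) < n := by exact_mod_cast hn
  set θ := max β 0 with hθ
  have hθ0 : 0 ≤ θ := le_max_right _ _
  have hθ1 : θ < 1 / q := max_lt hβ (by positivity)
  -- The factor `1/4` is the product of two losses of `1/2`: one from the averages over the balls `B
  -- j`, the other from the norm of the indicator of `B m`.
  obtain ⟨m, hm, hlt⟩ := exists_nat_mul_rpow_lt (a := c * (n * 4 ^ n : ℝ) ^ θ)
    (show (0 : ℝ) < 1 / 4 by norm_num) hθ1
  have hm0 : (0 : ℝ) < m := by exact_mod_cast hm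
  have hm1 : (1 : ℝ) ≤ m := by exact_mod_cast hm
  set γ : ℝ := 1 / m with hγ
  have hγ0 : 0 < γ := by positivity
  have hγ1 : γ ≤ 1 := by rw [hγ, div_le_one hm0]; exact hm1
  set w : (Fin n → ℝ) → ℝ := fun x => ‖x‖ ^ (γ - n) with hw
  have hwA : IsAp p w := isAp_norm_rpow hn hp hγ0 hγ1
  have hwm : Measurable w := measurable_norm.pow_const _
  set r : ℕ → ℝ := fun j => (1 / 2) ^ j with hr
  have hr0 : ∀ j, 0 < r j := fun j => by positivity
  have hranti : Antitone r := fun i j h => pow_le_pow_of_le_one (by norm_num) (by norm_num) h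
  set B : ℕ → Set (Fin n → ℝ) := fun j => Metric.closedBall 0 (r j) with hB
  have hBm : ∀ j, MeasurableSet (B j) := fun j => Metric.isClosed_closedBall.measurableSet
  have hBanti : Antitone B := fun i j h => Metric.closedBall_subset_closedBall (hranti h)
  set E : ℕ → Set (Fin n → ℝ) := fun j => B j \ B (j + 1) with hE
  have hEm : ∀ j, MeasurableSet (E j) := fun j => (hBm j).diff (hBm (j + 1))
  set f : ℕ → (Fin n → ℝ) → 𝕜 := fun j => (E j).indicator fun _ => 1 with hf
  refine ⟨w, hwA, f, fun j => (measurable_const.indicator (hEm j)).aestronglyMeasurable, ?_⟩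
  have hfe : ∀ j x, ‖f j x‖ₑ = (E j).indicator (fun _ => 1) x := by
    intro j x
    by_cases hx : x ∈ E j <;> simp [hf, hx]
  have hEdisj : ∀ i j x, x ∈ E i → x ∈ E j → i ≤ j := by
    intro i j x hi hj
    by_contra! h
    exact hj.2 (hBanti h hi.1)
  have hlq : ∀ x, 1 * lqNorm q f x ≤ (B 0).indicator (fun _ => 1) x := by
    intro x
    rw [one_mul, lqNorm]
    by_cases hx : ∃ j, x ∈ E j
    · obtain ⟨j, hj⟩ := hx
      rw [tsum_eq_single j fun i hi => by
        have : x ∉ E i := fun h => hi (le_antisymm (hEdisj i j x h hj) (hEdisj j i x hj h))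
        rw [hfe, Set.indicator_of_notMem this, ENNReal.zero_rpow_of_pos hq0], hfe,
        Set.indicator_of_mem hj, Set.indicator_of_mem (hBanti (Nat.zero_le j) hj.1)]
      simp
    · push Not at hx
      have : ∀ j, ‖f j x‖ₑ ^ q = 0 := fun j => by
        rw [hfe, Set.indicator_of_notMem (hx j), ENNReal.zero_rpow_of_pos hq0]
      simp [this, hq0]
  set N : ℝ≥0∞ := ENNReal.ofReal (n * 2 ^ n * m) ^ (1 / p) with hNdef
  have hN : weightedNorm p w (lqNorm q f) ≤ N := by
    have h1 := weightedNorm_const_mul_le hp0 w (Filter.Eventually.of_forall hlq)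
    rw [one_mul] at h1
    refine h1.trans (le_of_eq ?_)
    simp only [hB, hw]
    rw [weightedNorm_indicator_closedBall hn hp0 hγ0 (hr0 0).le, hNdef]
    simp [hr, hγ]
  -- The inner ball occupies at most half of `B j`, because halving the radius divides the volume by
  -- `2^n ≥ 2`. The annulus fills at least the other half.
  have hhalf : ∀ j x, x ∈ B j → (1 / 2 : ℝ≥0∞) ≤ maximal (f j) x := by
    intro j x hx
    have hxr : ‖x‖ ≤ r j := by simpa [hB] using hx
    refine le_trans ?_ (setLAverage_closedBall_le_maximal (f j) (hr0 j) hxr)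
    have hv : volume (B j) = ENNReal.ofReal (2 * r j) ^ n := volume_closedBall_zero (hr0 j).le
    have hv' : volume (B (j + 1)) = ENNReal.ofReal (2 * r (j + 1)) ^ n :=
      volume_closedBall_zero (hr0 _).le
    have hB0 : volume (B j) ≠ 0 := by
      rw [hv]
      refine pow_ne_zero _ ?_
      simpa using hr0 j
    have hBt : volume (B j) ≠ ∞ := by rw [hv]; exact ENNReal.pow_ne_top ENNReal.ofReal_ne_top
    have hB't : volume (B (j + 1)) ≠ ∞ := by
      rw [hv']; exact ENNReal.pow_ne_top ENNReal.ofReal_ne_top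
    have h2 : 2 * volume (B (j + 1)) ≤ volume (B j) := by
      have : ENNReal.ofReal (2 * r j) = 2 * ENNReal.ofReal (2 * r (j + 1)) := by
        rw [show (2 : ℝ≥0∞) = ENNReal.ofReal 2 by simp, ← ENNReal.ofReal_mul (by norm_num)]
        congr 1
        simp only [hr]
        ring
      rw [hv, hv', this, mul_pow]
      gcongr
      exact le_self_pow₀ (by norm_num) hn.ne'
    have h3 : volume (B j) = volume (E j) + volume (B (j + 1)) := by
      rw [← measure_sdiff_add_inter (B j) (hBm (j + 1)), Set.inter_eq_right.2 (hBanti j.le_succ)]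
    have h4 : volume (B (j + 1)) ≤ volume (E j) := by
      rw [h3, two_mul] at h2
      exact (ENNReal.add_le_add_iff_right hB't).1 h2
    have hint : ∫⁻ y in B j, ‖f j y‖ₑ = volume (E j) := by
      simp_rw [hfe]
      rw [lintegral_indicator (hEm j), Measure.restrict_restrict (hEm j),
        Set.inter_eq_left.2 Set.sdiff_subset, setLIntegral_one]
    change _ ≤ ⨍⁻ y in B j, ‖f j y‖ₑ ∂volume
    rw [setLAverage_eq, hint, ENNReal.le_div_iff_mul_le (Or.inl hB0) (Or.inl hBt), one_div,
      ENNReal.inv_mul_le_iff (by simp) (by simp), h3, two_mul]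
    gcongr
  -- The ball `B m` lies in every `B j` with `j < m`, so `m` terms, each at least `(1/2)^q`, add up
  -- there.
  have hV : ∀ x, ENNReal.ofReal ((m : ℝ) ^ (1 / q) / 2) * (B m).indicator (fun _ => 1) x ≤
      vectorMaximal q f x := by
    intro x
    by_cases hx : x ∈ B m
    · rw [Set.indicator_of_mem hx, mul_one]
      calc ENNReal.ofReal ((m : ℝ) ^ (1 / q) / 2)
          = (∑ _j ∈ Finset.range m, (1 / 2 : ℝ≥0∞) ^ q) ^ (1 / q) := by
            rw [Finset.sum_const, Finset.card_range, nsmul_eq_mul,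
              ENNReal.mul_rpow_of_nonneg _ _ (by positivity), ← ENNReal.rpow_mul,
              mul_one_div_cancel hq0.ne', ENNReal.rpow_one, div_eq_mul_one_div,
              ENNReal.ofReal_mul (by positivity), ← ENNReal.ofReal_rpow_of_pos hm0,
              ENNReal.ofReal_natCast]
            congr 1
            rw [ENNReal.ofReal_div_of_pos (by norm_num)]
            simp
        _ ≤ (∑ j ∈ Finset.range m, maximal (f j) x ^ q) ^ (1 / q) := by
            gcongr with j hj
            exact hhalf j x (hBanti (Finset.mem_range.1 hj).le hx)
        _ ≤ _ := by
            rw [vectorMaximal]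
            gcongr
            exact ENNReal.sum_le_tsum _
    · rw [Set.indicator_of_notMem hx, mul_zero]
      exact zero_le
  have hV' := weightedNorm_const_mul_le hp0 w (Filter.Eventually.of_forall hV)
  have hNm : ENNReal.ofReal (1 / 2) * N ≤ weightedNorm p w ((B m).indicator fun _ => 1) := by
    simp only [hB, hw]
    rw [weightedNorm_indicator_closedBall hn hp0 hγ0 (hr0 m).le, hNdef]
    -- The choice `γ = 1/m` is tuned to the radius `2^{-m}`, so that shrinking the unit ball `m`
    -- times costs only half of its weighted mass.
    have h1 : (r m) ^ γ = 1 / 2 := by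
      simp only [hr]
      rw [← Real.rpow_natCast, ← Real.rpow_mul (by norm_num), hγ, mul_one_div_cancel hm0.ne',
        Real.rpow_one]
    have h2 : (n * 2 ^ n * r m ^ γ / γ : ℝ) = 1 / 2 * (n * 2 ^ n * m) := by
      rw [h1, hγ]; field_simp
    rw [h2, ENNReal.ofReal_mul (p := 1 / 2) (by norm_num),
      ENNReal.mul_rpow_of_nonneg _ _ (by positivity)]
    gcongr
    rw [ENNReal.ofReal_rpow_of_pos (by norm_num)]
    refine ENNReal.ofReal_le_ofReal ?_
    exact Real.self_le_rpow_of_le_one (by norm_num) (by norm_num)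
      ((div_le_one hp0).2 hp.le)
  have hN0 : N ≠ 0 := by
    refine ENNReal.rpow_ne_zero_of_ne ?_ ENNReal.ofReal_ne_top _
    simp only [ne_eq, ENNReal.ofReal_eq_zero, not_le]; positivity
  have hNt : N ≠ ∞ := ENNReal.rpow_ne_top_of_nonneg (by positivity) ENNReal.ofReal_ne_top
  have hcA : c * apConst p w ^ β < ENNReal.ofReal ((m : ℝ) ^ (1 / q) / 2) *
      ENNReal.ofReal (1 / 2) := by
    calc c * apConst p w ^ β
        ≤ c * ENNReal.ofReal (n * 4 ^ n / γ) ^ θ := by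
          gcongr
          exact apConst_rpow_le (one_le_apConst hp hwm hwA.pos)
            (apConst_norm_rpow_le hn hp hγ0 hγ1)
      _ = ENNReal.ofReal (c * (n * 4 ^ n : ℝ) ^ θ * m ^ θ) := by
          rw [ENNReal.ofReal_rpow_of_nonneg (by positivity) hθ0,
            ← ENNReal.ofReal_coe_nnreal, ← ENNReal.ofReal_mul (by positivity), mul_assoc (c : ℝ),
            ← Real.mul_rpow (by positivity) (by positivity), hγ, div_div_eq_mul_div, div_one]
      _ < ENNReal.ofReal (1 / 4 * m ^ (1 / q)) :=
          (ENNReal.ofReal_lt_ofReal_iff (by positivity)).2 hlt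
      _ = _ := by
          rw [← ENNReal.ofReal_mul (by positivity)]
          congr 1
          ring
  calc c * apConst p w ^ β * weightedNorm p w (lqNorm q f) ≤ c * apConst p w ^ β * N := by gcongr
    _ < ENNReal.ofReal ((m : ℝ) ^ (1 / q) / 2) * ENNReal.ofReal (1 / 2) * N :=
        (ENNReal.mul_lt_mul_iff_left hN0 hNt).2 hcA
    _ ≤ ENNReal.ofReal ((m : ℝ) ^ (1 / q) / 2) *
          weightedNorm p w ((B m).indicator fun _ => 1) := by rw [mul_assoc]; gcongr
    _ ≤ _ := hV'

end VectorMaximal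

theorem corollary4p3 {𝕜 : Type*} [RCLike 𝕜] (n : ℕ) (hn : 0 < n) (p q : ℝ) (hp : 1 < p)
    (hq : 1 < q) :
    (∃ c : ℝ≥0, ∀ w : (Fin n → ℝ) → ℝ, VectorMaximal.IsAp p w →
      ∀ f : ℕ → (Fin n → ℝ) → 𝕜, (∀ j, AEStronglyMeasurable (f j) volume) →
        VectorMaximal.weightedNorm p w (VectorMaximal.vectorMaximal q f) ≤
          c * VectorMaximal.apConst p w ^ max (1 / q) (1 / (p - 1)) *
            VectorMaximal.weightedNorm p w (VectorMaximal.lqNorm q f)) ∧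
    (∀ β : ℝ, β < max (1 / q) (1 / (p - 1)) → ∀ c : ℝ≥0,
      ∃ w : (Fin n → ℝ) → ℝ, VectorMaximal.IsAp p w ∧
        ∃ f : ℕ → (Fin n → ℝ) → 𝕜, (∀ j, AEStronglyMeasurable (f j) volume) ∧
          c * VectorMaximal.apConst p w ^ β *
              VectorMaximal.weightedNorm p w (VectorMaximal.lqNorm q f) <
            VectorMaximal.weightedNorm p w (VectorMaximal.vectorMaximal q f)) := by
  refine ⟨VectorMaximal.exists_weightedNorm_vectorMaximal_le 𝕜 n hp hq, fun β hβ c => ?_⟩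
  rcases lt_max_iff.1 hβ with h | h
  · exact VectorMaximal.exists_lt_of_lt_one_div 𝕜 hn hp hq h c
  · exact VectorMaximal.exists_lt_of_lt_one_div_sub_one 𝕜 hn hp hq h c
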